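/- Let $n\ge 1$. Let $\Phi:\mathbb{R}^n\to[0,1]$ be smooth and radial with $\operatorname{supp}\Phi\subseteq\{|x|\le 2\}$ and $\Phi(x)=1$ for $|x|\le 1$, and put $\psi(x)=\Phi(x)-\Phi(2x)$. For a function $m$ on $\mathbb{R}^n$ that is smooth with all derivatives of at most polynomial growth, let $m(D)=\mathscr{F}^{-1}m(\xi)\mathscr{F}$ on $\mathcal{S}'(\mathbb{R}^n)$, where the Fourier transform is normalized so that $-\Delta$ has the symbol $|\xi|^2$. Let $P_{\le 0}=\Phi(D)$ and $\triangle_k=\psi(2^{-k}D)$. For $s\in\mathbb{R}$ and $1\le p,q\le\infty$ let $$\|f\|_{B^s_{p,q}}=\Big(\|P_{\le 0}f\|_{L^p}^q+\sum_{k=1}^\infty 2^{ksq}\|\triangle_k f\|_{L^p}^q\Big)^{1/q}\in[0,\infty],\qquad f\in\mathcal{S}'(\mathbb{R}^n),$$ with the supremum $\max\big(\|P_{\le 0}f\|_{L^p},\ \sup_{k\ge1}2^{ks}\|\triangle_kf\|_{L^p}\big)$ if $q=\infty$, where the $L^p$ norm of a tempered distribution that is not an $L^p$ function is $\infty$; $B^s_{p,q}$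 is the space of those $f$ with $\|f\|_{B^s_{p,q}}<\infty$. Let $\omega=\sqrt{I-\Delta}$ (with symbol $(1+|\xi|^2)^{1/2}$) and $K(t)=\omega^{-1}\sin(t\omega)$ for $t\in\mathbb{R}$. Let $2\le p\le\infty$, $1\le q\le\infty$, $\frac1p+\frac1{p'}=1$, $\delta=\frac12-\frac1p$ and $s,s',\theta\in\mathbb{R}$. In each of the following, $C<\infty$ is a constant that does not depend on $t$ and $g$, and negative powers of $|t|$ are $+\infty$ at $t=0$ (with $0^0=1$ and $\infty\cdot 0=0$). (i) If $0\le\theta\le1$ and $(n+1+\theta)\delta=1+s'-s$, then there is $C$ such that for all $t\in\mathbb{R}$ and all $g\in\mathcal{S}'(\mathbb{R}^n)$ $$\|K(t)g\|_{B^s_{p,q}}\le C\,|t|^{-(n-1+\theta)\delta}\,\|g\|_{B^{s'}_{p',q}}.$$ (ii) If $0\le\theta\le n-1$ and $(n+1+\theta)\delta=1+s'-s$, then there is $C$ such that for all $t\in\mathbb{R}$ and all $g\in\mathcal{S}'(\mathbb{R}^n)$ $$\|K(t)g\|_{B^s_{p,q}}\le C\,|t|^{-(n-1-\theta)\delta}\,\|g\|_{B^{s'}_{p',q}}.$$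 (iii) If $0\le\theta\le1$ and $(n+1+\theta)\delta\le 1+s'-s$, then there is $C$ such that for all $t\in\mathbb{R}$ and all $g\in\mathcal{S}'(\mathbb{R}^n)$ $$\|K(t)g\|_{B^s_{p,q}}\le C\,k(t)\,\|g\|_{B^{s'}_{p',q}},\qquad k(t)=\begin{cases}|t|^{\min(1+s'-s-2n\delta,\,0)},&|t|\le1,\\ |t|^{-(n-1+\theta)\delta},&|t|\ge1.\end{cases}$$ -/

import Mathlib

open MeasureTheory
open scoped ENNReal NNReal SchwartzMap ContDiff

noncomputable section

namespace KleinGordon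

/-- `Φ` is an admissible low-frequency cutoff on `ℝⁿ`: smooth, radial (in particular even), with
values in `[0,1]`, supported in `{|x| ≤ 2}` and equal to `1` on `{|x| ≤ 1}`. -/
structure IsCutoff {n : ℕ} (Φ : EuclideanSpace ℝ (Fin n) → ℝ) : Prop where
  smooth : ContDiff ℝ ∞ Φ
  mem_Icc : ∀ x, Φ x ∈ Set.Icc (0 : ℝ) 1
  radial : ∀ x y, ‖x‖ = ‖y‖ → Φ x = Φ y
  tsupport_subset : tsupport Φ ⊆ Metric.closedBall 0 2
  eq_one : ∀ x, ‖x‖ ≤ 1 → Φ x = 1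

/-- The operator `m(D) = 𝓕⁻¹ m(ξ) 𝓕` on tempered distributions, where `ξ` is the angular frequency,
so that `-Δ` has the symbol `|ξ|²`. Mathlib's Fourier transform has the kernel
`exp (-2πi ⟪x, η⟫)`; its frequency variable `η` and the angular frequency are related by
`ξ = 2π η`. -/
def multiplier {n : ℕ} (m : EuclideanSpace ℝ (Fin n) → ℝ) :
    𝓢'(EuclideanSpace ℝ (Fin n), ℂ) →L[ℂ] 𝓢'(EuclideanSpace ℝ (Fin n), ℂ) :=
  TemperedDistribution.fourierMultiplierCLM ℂ fun η ↦ (m ((2 * Real.pi) • η) : ℂ)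

/-- The symbol `(1 + |ξ|²)^{1/2}` of `ω = √(I - Δ)`. -/
def omega {n : ℕ} (ξ : EuclideanSpace ℝ (Fin n)) : ℝ :=
  (1 + ‖ξ‖ ^ 2) ^ (1 / 2 : ℝ)

/-- The symbol of `K(t)`. -/
def symbolK {n : ℕ} (t : ℝ) (ξ : EuclideanSpace ℝ (Fin n)) : ℝ :=
  (omega ξ)⁻¹ * Real.sin (t * omega ξ)

/-- The Klein–Gordon operator `K(t) = ω⁻¹ sin(tω)`. -/
def K {n : ℕ} (t : ℝ) :
    𝓢'(EuclideanSpace ℝ (Fin n), ℂ) →L[ℂ] 𝓢'(EuclideanSpace ℝ (Fin n), ℂ) :=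
  multiplier (symbolK t)

/-- `ψ(x) = Φ(x) - Φ(2x)`. -/
def psi {n : ℕ} (Φ : EuclideanSpace ℝ (Fin n) → ℝ) (x : EuclideanSpace ℝ (Fin n)) : ℝ :=
  Φ x - Φ ((2 : ℝ) • x)

/-- The Littlewood–Paley projector `Δ_k = 𝓕⁻¹ ψ(2^{-k} ξ) 𝓕`. -/
def lpProj {n : ℕ} (Φ : EuclideanSpace ℝ (Fin n) → ℝ) (k : ℤ) :
    𝓢'(EuclideanSpace ℝ (Fin n), ℂ) →L[ℂ] 𝓢'(EuclideanSpace ℝ (Fin n), ℂ) :=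
  multiplier fun ξ ↦ psi Φ ((2 : ℝ) ^ (-k) • ξ)

/-- The low-frequency projector `P_{≤0} = 𝓕⁻¹ Φ(ξ) 𝓕`. -/
def lowProj {n : ℕ} (Φ : EuclideanSpace ℝ (Fin n) → ℝ) :
    𝓢'(EuclideanSpace ℝ (Fin n), ℂ) →L[ℂ] 𝓢'(EuclideanSpace ℝ (Fin n), ℂ) :=
  multiplier Φ

/-- The `L^p` norm of a tempered distribution: the norm of the (unique) `L^p` function that
represents it, and `∞` if there is none (an infimum over the empty set). -/
def distLpNorm {n : ℕ} (p : ℝ≥0∞) [Fact (1 ≤ p)] (u : 𝓢'(EuclideanSpace ℝ (Fin n), ℂ)) : ℝ≥0∞ :=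
  ⨅ (h : Lp ℂ p (volume : Measure (EuclideanSpace ℝ (Fin n))))
    (_ : Lp.toTemperedDistribution h = u), ‖h‖ₑ

/-- The Besov norm `‖f‖_{B^s_{p,q}}` of a tempered distribution, with values in `[0, ∞]`; the space
`B^s_{p,q}` consists of the `f` for which it is finite. The summation index `j` stands for
`k = j + 1`; for `q = ∞` the `ℓ^q` norm is the supremum. -/
def besovNorm {n : ℕ} (Φ : EuclideanSpace ℝ (Fin n) → ℝ) (s : ℝ) (p q : ℝ≥0∞) [Fact (1 ≤ p)]
    (f : 𝓢'(EuclideanSpace ℝ (Fin n), ℂ)) : ℝ≥0∞ :=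
  if q = ⊤ then
    max (distLpNorm p (lowProj Φ f))
      (⨆ j : ℕ, (2 : ℝ≥0∞) ^ (((j : ℝ) + 1) * s) * distLpNorm p (lpProj Φ ((j : ℤ) + 1) f))
  else
    (distLpNorm p (lowProj Φ f) ^ q.toReal +
      ∑' j : ℕ, (2 : ℝ≥0∞) ^ (((j : ℝ) + 1) * s * q.toReal) *
        distLpNorm p (lpProj Φ ((j : ℤ) + 1) f) ^ q.toReal) ^ (1 / q.toReal)

/-- The kernel `k(t)` of the combined estimate: `|t|^{min(1+s'-s-2nδ, 0)}` for `|t| ≤ 1` and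
`|t|^{-(n-1+θ)δ}` for `|t| ≥ 1` (both are `1` for `|t| = 1`). -/
def kernel (n : ℕ) (δ θ s s' t : ℝ) : ℝ≥0∞ :=
  if |t| ≤ 1 then ENNReal.ofReal |t| ^ (min (1 + s' - s - 2 * n * δ) 0)
  else ENNReal.ofReal |t| ^ (-((n - 1 + θ) * δ))

/-! The symbols above are smooth with derivatives of polynomial growth, as Mathlib's Fourier
multipliers require. -/

theorem hasTemperateGrowth_cutoff {n : ℕ} {Φ : EuclideanSpace ℝ (Fin n) → ℝ} (hΦ : IsCutoff Φ) :
    Φ.HasTemperateGrowth :=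
  HasCompactSupport.hasTemperateGrowth
    ((isCompact_closedBall _ _).of_isClosed_subset (isClosed_tsupport _) hΦ.tsupport_subset)
    hΦ.smooth

theorem hasTemperateGrowth_dilate {n : ℕ} {m : EuclideanSpace ℝ (Fin n) → ℝ}
    (hm : m.HasTemperateGrowth) (c : ℝ) :
    (fun ξ : EuclideanSpace ℝ (Fin n) ↦ m (c • ξ)).HasTemperateGrowth :=
  hm.comp (c • ContinuousLinearMap.id ℝ (EuclideanSpace ℝ (Fin n))).hasTemperateGrowth

theorem hasTemperateGrowth_psi {n : ℕ} {Φ : EuclideanSpace ℝ (Fin n) → ℝ} (hΦ : IsCutoff Φ) :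
    (psi Φ).HasTemperateGrowth :=
  (hasTemperateGrowth_cutoff hΦ).sub (hasTemperateGrowth_dilate (hasTemperateGrowth_cutoff hΦ) 2)

theorem hasTemperateGrowth_sin : Real.sin.HasTemperateGrowth := by
  refine ⟨Real.contDiff_sin, fun k ↦ ⟨0, 1, fun x ↦ ?_⟩⟩
  rw [norm_iteratedFDeriv_eq_norm_iteratedDeriv]
  simpa using Real.abs_iteratedDeriv_sin_le_one k x

theorem hasTemperateGrowth_symbolK {n : ℕ} (t : ℝ) :
    (symbolK t : EuclideanSpace ℝ (Fin n) → ℝ).HasTemperateGrowth := by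
  have h1 : (omega : EuclideanSpace ℝ (Fin n) → ℝ).HasTemperateGrowth :=
    Function.hasTemperateGrowth_one_add_norm_sq_rpow _ _
  have h2 : (fun ξ : EuclideanSpace ℝ (Fin n) ↦ (omega ξ)⁻¹).HasTemperateGrowth := by
    have : (fun ξ : EuclideanSpace ℝ (Fin n) ↦ (omega ξ)⁻¹)
        = fun ξ ↦ (1 + ‖ξ‖ ^ 2) ^ (-(1 / 2) : ℝ) := by
      funext ξ
      rw [omega, Real.rpow_neg (by positivity)]
    rw [this]
    exact Function.hasTemperateGrowth_one_add_norm_sq_rpow _ _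
  exact h2.mul (hasTemperateGrowth_sin.comp ((Function.HasTemperateGrowth.const t).mul h1))

end KleinGordon

end

/-! The estimate is proved on each frequency block with a constant that is the same for all blocks,
so the `ℓ^q` sums on the two sides are compared term by term. Put ε = 2^{-k}, with ε = 1 for the
low-frequency block. A slightly wider cutoff `a`, equal to 1 where the symbol of the block does not
vanish, turns K(t) on the block into the multiplier with the compactly supported symbol a(εξ) ω⁻¹
sin(tω). Its L² → L² norm is at most 4ε, since ω ≥ 1/(4ε) where a(εξ) ≠ 0; its L¹ → L^∞ norm is at
most the supremum of its kernel. Riesz–Thorin on the line of duality takes the powers 1 - 2δ and 2δ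
of these two bounds (`exists_toTemperedDistribution_multiplier`).

The kernel is estimated without stationary phase, by moving to complex time. The symbol equals
(ε/2i)(e^{-(ε-it)ω} - e^{-(ε+it)ω}) b, where b = a(εξ) e^{εω}/(εω). In the variable εξ the
amplitudes b form a family of test functions with common compact support; for the high blocks it is
smooth up to ε = 0. Hence their inverse Fourier transforms are bounded in L¹ uniformly in ε
(`exists_integral_norm_fourierInv_le`), and it remains to bound the kernel of e^{-zω} for Re z = ε.

Subordination to the heat semigroup writes that kernel as a factor of size |z|^{-(n-1)/2} times ∫
s^{(n-1)/2} e^{-αs - z/s} ds with Re α ≥ ε/4 (`fourierInv_semigroupSymbol`). Taking absolute values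
gives, after the factor ε, the wave-type bound (ε max(ε,|t|))^{-(n-1)/2}. The same integral with
s^{-3/2} has a closed form, and through it one gains |z|^{-1/2} at the price ε^{-1/2}; this is the
Klein–Gordon bound (ε|t|)^{-n/2}.

`dispersiveRate` is the minimum of the two bounds. The three claims follow by comparing powers of ε
and |t|: (i) interpolates between the two bounds, (ii) and the small-time part of (iii) use only the
first one and the maximum in it. At t = 0 there is nothing to prove because K(0) = 0. -/

namespace KleinGordon

/-! ### Three-lines argument on simple functions. -/

section Interpolation

variable {X : Type*} [MeasurableSpace X] {μ : Measure X}

/-- `c ↦ c |c|^w`, the analytic deformation of the values of a simple function. -/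
noncomputable def twist (w c : ℂ) : ℂ := c * (‖c‖ : ℂ) ^ w

@[simp] theorem twist_apply_zero (w : ℂ) : twist w 0 = 0 := by simp [twist]

@[simp] theorem twist_zero (c : ℂ) : twist 0 c = c := by simp [twist]

theorem norm_twist {w : ℂ} (hw : 0 < 1 + w.re) (c : ℂ) : ‖twist w c‖ = ‖c‖ ^ (1 + w.re) := by
  rcases eq_or_ne c 0 with rfl | hc
  · simp [Real.zero_rpow hw.ne']
  · have hc' : 0 < ‖c‖ := norm_pos_iff.2 hc
    rw [twist, norm_mul, Complex.norm_cpow_eq_rpow_re_of_pos hc', Real.rpow_add hc', Real.rpow_one]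

/-- The inner product is conjugate-linear in its first argument; twisting that argument by the
conjugate exponent makes the pairing holomorphic in `w`. -/
theorem conj_twist_conj (w c : ℂ) :
    (starRingEnd ℂ) (twist ((starRingEnd ℂ) w) c) = (starRingEnd ℂ) c * (‖c‖ : ℂ) ^ w := by
  rw [twist, map_mul, Complex.cpow_conj, Complex.conj_ofReal, Complex.conj_conj]
  rw [Complex.arg_ofReal_of_nonneg (norm_nonneg c)]
  exact Real.pi_pos.ne

theorem integrable_map_simpleFunc {f : SimpleFunc X ℂ} (hf : Integrable f μ) {h : ℂ → ℂ}
    (h0 : h 0 = 0) : Integrable (f.map h) μ := by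
  rw [SimpleFunc.integrable_iff_finMeasSupp] at hf ⊢
  exact hf.map h0

theorem memLp_simpleFunc {f : SimpleFunc X ℂ} (hf : Integrable f μ) (p : ℝ≥0∞) :
    MemLp f p μ :=
  SimpleFunc.memLp_of_finite_measure_preimage p (SimpleFunc.integrable_iff.1 hf)

/-- The vectors `e c` are the indicators of the level sets and do not depend on `h`, so deforming
the values of `f` analytically moves only finitely many scalar coefficients. The level set of 0 may
have infinite measure; it is discarded by `e 0 = 0`, which `h 0 = 0` makes harmless. -/
theorem exists_toLp_map_eq_sum {f : SimpleFunc X ℂ} (hf : Integrable f μ) :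
    ∃ e : ℂ → Lp ℂ 2 μ, ∀ (h : ℂ → ℂ) (h0 : h 0 = 0),
      (memLp_simpleFunc (integrable_map_simpleFunc hf h0) 2).toLp (f.map h) =
        ∑ c ∈ f.range, h c • e c := by
  classical
  have hfin : ∀ c : ℂ, c ≠ 0 → μ (f ⁻¹' {c}) ≠ ⊤ := fun c hc ↦
    (SimpleFunc.integrable_iff.1 hf c hc).ne
  refine ⟨fun c ↦ if hc : c ≠ 0 then
    indicatorConstLp 2 (f.measurableSet_fiber c) (hfin c hc) (1 : ℂ) else 0, fun h h0 ↦ ?_⟩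
  have key : ∀ c : ℂ, ⇑(h c • (if hc : c ≠ 0 then
      indicatorConstLp 2 (f.measurableSet_fiber c) (hfin c hc) (1 : ℂ) else 0 : Lp ℂ 2 μ))
      =ᵐ[μ] fun x ↦ if f x = c then h c else 0 := by
    intro c
    by_cases hc : c ≠ 0
    · simp only [hc, ne_eq, not_false_eq_true, dite_true]
      filter_upwards [Lp.coeFn_smul (h c)
        (indicatorConstLp 2 (f.measurableSet_fiber c) (hfin c hc) (1 : ℂ)),
        indicatorConstLp_coeFn (p := 2) (hs := f.measurableSet_fiber c) (hμs := hfin c hc)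
          (c := (1 : ℂ))] with x h1 h2
      rw [h1, Pi.smul_apply, h2]
      by_cases hx : f x = c
      · simp [hx]
      · simp [hx]
    · push Not at hc
      subst hc
      simp only [h0, zero_smul, ite_self]
      exact Lp.coeFn_zero _ _ _
  apply Lp.ext
  refine (MemLp.coeFn_toLp _).trans ?_
  refine Filter.EventuallyEq.trans ?_ (Lp.coeFn_finsetSum _ _).symm
  have hall : ∀ᵐ x ∂μ, ∀ c ∈ f.range, ⇑(h c • (if hc : c ≠ 0 then
      indicatorConstLp 2 (f.measurableSet_fiber c) (hfin c hc) (1 : ℂ) else 0 : Lp ℂ 2 μ)) x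
      = if f x = c then h c else 0 :=
    (Finset.eventually_all _).2 fun c _ ↦ key c
  filter_upwards [hall] with x hx
  rw [Finset.sum_apply, Finset.sum_congr rfl hx, Finset.sum_ite_eq]
  simp [f.mem_range_self x]

theorem norm_toLp_two_sq {f : X → ℂ} (hf : MemLp f 2 μ) :
    ‖hf.toLp f‖ = (∫ x, ‖f x‖ ^ (2 : ℝ) ∂μ) ^ (1 / 2 : ℝ) := by
  rw [Lp.norm_toLp, hf.eLpNorm_eq_integral_rpow_norm (by simp) (by simp),
    ENNReal.toReal_ofReal (by positivity)]
  simp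

/-- The Riesz–Thorin argument between `L¹ → L^∞` and `L² → L²`, tested on simple functions. -/
theorem norm_inner_simpleFunc_le (T : Lp ℂ 2 μ →L[ℂ] Lp ℂ 2 μ) {M₁ M₂ : ℝ} (hM₁ : 0 ≤ M₁)
    (hM₂ : 0 ≤ M₂)
    (h₁ : ∀ f g : Lp ℂ 2 μ, Integrable f μ → Integrable g μ →
      ‖inner ℂ g (T f)‖ ≤ M₁ * (∫ x, ‖f x‖ ∂μ) * ∫ x, ‖g x‖ ∂μ)
    (h₂ : ∀ f, ‖T f‖ ≤ M₂ * ‖f‖) {r : ℝ} (hr₁ : 1 ≤ r) (hr₂ : r ≤ 2) {f g : SimpleFunc X ℂ}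
    (hf : Integrable f μ) (hg : Integrable g μ) :
    ‖inner ℂ ((memLp_simpleFunc hg 2).toLp g) (T ((memLp_simpleFunc hf 2).toLp f))‖ ≤
      M₁ ^ (2 / r - 1) * M₂ ^ (2 - 2 / r) *
        ((∫ x, ‖f x‖ ^ r ∂μ) ^ (1 / r) * (∫ x, ‖g x‖ ^ r ∂μ) ^ (1 / r)) := by
  have hr0 : 0 < r := by linarith
  -- The twisted functions have modulus |f|^{r(1 - Re z/2)}: this is |f|^r on Re z = 0, where the L¹
  -- → L^∞ bound applies, and |f|^{r/2} on Re z = 1, where the L² bound applies. At z = 2 - 2/r the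
  -- exponent `w` vanishes and the original functions return.
  set w : ℂ → ℂ := fun z ↦ r * (1 - z / 2) - 1 with hw
  have hwre : ∀ z : ℂ, 1 + (w z).re = r * (1 - z.re / 2) := by
    intro z; simp [hw]
  have hwre' : ∀ z : ℂ, 1 + ((starRingEnd ℂ) (w z)).re = r * (1 - z.re / 2) := by
    intro z; rw [Complex.conj_re, hwre]
  have hpos : ∀ z : ℂ, z.re ≤ 1 → 0 < r * (1 - z.re / 2) := by
    intro z hz; apply mul_pos hr0; linarith
  set F : ℂ → ℂ := fun z ↦ inner ℂ
    ((memLp_simpleFunc (integrable_map_simpleFunc hg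
      (twist_apply_zero ((starRingEnd ℂ) (w z)))) 2).toLp (g.map (twist ((starRingEnd ℂ) (w z)))))
    (T ((memLp_simpleFunc (integrable_map_simpleFunc hf
      (twist_apply_zero (w z))) 2).toLp (f.map (twist (w z))))) with hF
  obtain ⟨e, he⟩ := exists_toLp_map_eq_sum hf
  obtain ⟨e', he'⟩ := exists_toLp_map_eq_sum hg
  have hFsum : ∀ z, F z = ∑ d ∈ g.range, ∑ c ∈ f.range,
      (starRingEnd ℂ) d * (‖d‖ : ℂ) ^ w z * (c * (‖c‖ : ℂ) ^ w z * inner ℂ (e' d) (T (e c))) := by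
    intro z
    simp only [hF]
    rw [he _ (twist_apply_zero _), he' _ (twist_apply_zero _), map_sum, sum_inner]
    refine Finset.sum_congr rfl fun d _ ↦ ?_
    rw [inner_sum]
    refine Finset.sum_congr rfl fun c _ ↦ ?_
    rw [map_smul, inner_smul_left, inner_smul_right, conj_twist_conj]
    rfl
  have hwdiff : Differentiable ℂ w := by
    simp only [hw]; fun_prop
  have hpow : ∀ c : ℂ, Differentiable ℂ fun z ↦ c * (‖c‖ : ℂ) ^ w z := by
    intro c
    rcases eq_or_ne c 0 with rfl | hc
    · simp
    · have : (‖c‖ : ℂ) ≠ 0 := by simpa using hc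
      exact (hwdiff.const_cpow (Or.inl this)).const_mul _
  have hpow' : ∀ d : ℂ, Differentiable ℂ fun z ↦ (starRingEnd ℂ) d * (‖d‖ : ℂ) ^ w z := by
    intro c
    rcases eq_or_ne c 0 with rfl | hc
    · simp
    · have : (‖c‖ : ℂ) ≠ 0 := by simpa using hc
      exact (hwdiff.const_cpow (Or.inl this)).const_mul _
  have hFdiff : Differentiable ℂ F := by
    rw [funext hFsum]
    exact Differentiable.fun_sum fun d _ ↦ Differentiable.fun_sum fun c _ ↦
      (hpow' d).mul ((hpow c).mul_const _)
  have hbd : ∀ (c : ℂ) {z : ℂ}, z ∈ Complex.HadamardThreeLines.verticalClosedStrip 0 1 →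
      ‖c * (‖c‖ : ℂ) ^ w z‖ ≤ (1 + ‖c‖) ^ r := by
    intro c z hz
    have hz1 : z.re ∈ Set.Icc (0 : ℝ) 1 := hz
    have hp := hpos z hz1.2
    have := norm_twist (w := w z) (by rw [hwre]; exact hp) c
    rw [twist] at this
    rw [this, hwre]
    calc ‖c‖ ^ (r * (1 - z.re / 2)) ≤ (1 + ‖c‖) ^ (r * (1 - z.re / 2)) :=
          Real.rpow_le_rpow (norm_nonneg _) (by linarith) hp.le
      _ ≤ (1 + ‖c‖) ^ r := Real.rpow_le_rpow_of_exponent_le (by linarith [norm_nonneg c])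
          (by nlinarith [hz1.1])
  have hB : BddAbove ((norm ∘ F) '' Complex.HadamardThreeLines.verticalClosedStrip 0 1) := by
    refine ⟨∑ d ∈ g.range, ∑ c ∈ f.range, (1 + ‖d‖) ^ r *
      ((1 + ‖c‖) ^ r * ‖inner ℂ (e' d) (T (e c))‖), ?_⟩
    rintro _ ⟨z, hz, rfl⟩
    simp only [Function.comp_apply]
    rw [hFsum]
    refine (norm_sum_le _ _).trans (Finset.sum_le_sum fun d _ ↦ ?_)
    refine (norm_sum_le _ _).trans (Finset.sum_le_sum fun c _ ↦ ?_)
    rw [norm_mul, norm_mul (c * _)]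
    gcongr
    · rw [norm_mul, RCLike.norm_conj, ← norm_mul]
      exact hbd d hz
    · exact hbd c hz
  set A : ℝ := ∫ x, ‖f x‖ ^ r ∂μ with hA
  set B : ℝ := ∫ x, ‖g x‖ ^ r ∂μ with hB'
  have hA0 : 0 ≤ A := by positivity
  have hB0 : 0 ≤ B := by positivity
  have hone : ∀ {k : SimpleFunc X ℂ} (hk : Integrable k μ) {v : ℂ}, 1 + v.re = r →
      ∫ x, ‖((memLp_simpleFunc (integrable_map_simpleFunc hk
        (twist_apply_zero v)) 2).toLp (k.map (twist v))) x‖ ∂μ = ∫ x, ‖k x‖ ^ r ∂μ := by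
    intro k hk v hv
    refine integral_congr_ae ?_
    filter_upwards [(memLp_simpleFunc (integrable_map_simpleFunc hk
        (twist_apply_zero v)) 2).coeFn_toLp] with x hx
    rw [hx, SimpleFunc.map_apply, norm_twist (by rw [hv]; exact hr0), hv]
  have honei : ∀ {k : SimpleFunc X ℂ} (hk : Integrable k μ) {v : ℂ},
      Integrable ((memLp_simpleFunc (integrable_map_simpleFunc hk
        (twist_apply_zero v)) 2).toLp (k.map (twist v))) μ := by
    intro k hk v
    exact (integrable_map_simpleFunc hk (twist_apply_zero v)).congr (MemLp.coeFn_toLp _).symm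
  have htwo : ∀ {k : SimpleFunc X ℂ} (hk : Integrable k μ) {v : ℂ}, 1 + v.re = r / 2 →
      ‖(memLp_simpleFunc (integrable_map_simpleFunc hk
        (twist_apply_zero v)) 2).toLp (k.map (twist v))‖ = (∫ x, ‖k x‖ ^ r ∂μ) ^ (1 / 2 : ℝ) := by
    intro k hk v hv
    rw [norm_toLp_two_sq]
    congr 1
    refine integral_congr_ae (Filter.Eventually.of_forall fun x ↦ ?_)
    simp only [SimpleFunc.map_apply]
    rw [norm_twist (by rw [hv]; positivity), hv, ← Real.rpow_mul (norm_nonneg _)]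
    congr 1; ring
  have hleft : ∀ z ∈ Complex.re ⁻¹' {(0 : ℝ)}, ‖F z‖ ≤ M₁ * A * B := by
    intro z hz
    have hz' : z.re = 0 := hz
    refine (h₁ _ _ (honei hf) (honei hg)).trans (le_of_eq ?_)
    rw [hone hf (by rw [hwre, hz']; ring), hone hg (by rw [hwre', hz']; ring)]
  have hright : ∀ z ∈ Complex.re ⁻¹' {(1 : ℝ)}, ‖F z‖ ≤ M₂ * A ^ (1 / 2 : ℝ) * B ^ (1 / 2 : ℝ) := by
    intro z hz
    have hz' : z.re = 1 := hz
    refine (norm_inner_le_norm _ _).trans ?_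
    rw [htwo hg (by rw [hwre', hz']; ring), mul_comm]
    gcongr
    refine (h₂ _).trans (le_of_eq ?_)
    rw [htwo hf (by rw [hwre, hz']; ring)]
  have hθ0 : 0 ≤ 2 - 2 / r := by
    rw [sub_nonneg, div_le_iff₀ hr0]; linarith
  have hθ1 : 2 - 2 / r ≤ 1 := by
    have : 1 ≤ 2 / r := by rw [le_div_iff₀ hr0]; linarith
    linarith
  have hmain := Complex.HadamardThreeLines.norm_le_interp_of_mem_verticalClosedStrip₀₁' F
    (z := ((2 - 2 / r : ℝ) : ℂ)) (a := M₁ * A * B) (b := M₂ * A ^ (1 / 2 : ℝ) * B ^ (1 / 2 : ℝ))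
    (by simpa [Complex.HadamardThreeLines.verticalClosedStrip] using ⟨sub_nonneg.1 hθ0, by
      simpa using hθ1⟩) hFdiff.diffContOnCl hB hleft hright
  have hw0 : w ((2 - 2 / r : ℝ) : ℂ) = 0 := by
    simp only [hw]
    push_cast
    have : (r : ℂ) ≠ 0 := by exact_mod_cast hr0.ne'
    field_simp
    ring
  have hFθ : F ((2 - 2 / r : ℝ) : ℂ) = inner ℂ ((memLp_simpleFunc hg 2).toLp g)
      (T ((memLp_simpleFunc hf 2).toLp f)) := by
    simp only [hF, hw0, map_zero]
    congr 1
    · congr 1; ext x; simp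
    · congr 2; ext x; simp
  rw [hFθ, Complex.ofReal_re] at hmain
  refine hmain.trans (le_of_eq ?_)
  have e1 : (1 : ℝ) - (2 - 2 / r) = 2 / r - 1 := by ring
  have e2 : ∀ {Z : ℝ}, 0 ≤ Z → Z ^ (2 / r - 1) * (Z ^ (1 / 2 : ℝ)) ^ (2 - 2 / r) = Z ^ (1 / r) := by
    intro Z hZ
    rw [← Real.rpow_mul hZ, ← Real.rpow_add_of_nonneg hZ (by linarith) (by linarith)]
    congr 1; ring
  rw [e1, Real.mul_rpow (by positivity) hB0, Real.mul_rpow hM₁ hA0,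
    Real.mul_rpow (by positivity) (by positivity), Real.mul_rpow hM₂ (by positivity),
    ← e2 hA0, ← e2 hB0]
  ring

end Interpolation

/-! ### From bilinear bounds to L^p norms by duality. -/

section Duality

variable {X : Type*} [MeasurableSpace X] {μ : Measure X}

theorem toReal_eLpNorm_ofReal {r : ℝ} (hr : 0 < r) {f : X → ℂ}
    (hf : MemLp f (ENNReal.ofReal r) μ) :
    (eLpNorm f (ENNReal.ofReal r) μ).toReal = (∫ x, ‖f x‖ ^ r ∂μ) ^ (1 / r) := by
  rw [hf.eLpNorm_eq_integral_rpow_norm (by simpa using hr) (by simp),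
    ENNReal.toReal_ofReal (by positivity), ENNReal.toReal_ofReal hr.le, one_div]

/-- Since |h|^P ≤ C^{P-2} |h|². It supplies the qualitative membership in L^P without which the norm
cannot be recovered by duality. -/
theorem memLp_of_memLp_two_of_bounded {P C : ℝ} (hP : 2 ≤ P) {h : X → ℂ} (h2 : MemLp h 2 μ)
    (hC : ∀ᵐ x ∂μ, ‖h x‖ ≤ C) : MemLp h (ENNReal.ofReal P) μ := by
  have hP0 : 0 < P := by linarith
  rw [← integrable_norm_rpow_iff h2.1 (by simpa using hP0) (by simp),
    ENNReal.toReal_ofReal hP0.le]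
  have h2' : Integrable (fun x ↦ ‖h x‖ ^ (2 : ℝ)) μ := by
    have := (integrable_norm_rpow_iff h2.1 (by simp) (by simp)).2 h2
    simpa using this
  refine (h2'.const_mul (C ^ (P - 2))).mono'
    ((h2.1.norm.aemeasurable.pow_const P).aestronglyMeasurable) ?_
  filter_upwards [hC] with x hx
  rw [Real.norm_of_nonneg (by positivity)]
  calc ‖h x‖ ^ P = ‖h x‖ ^ (P - 2) * ‖h x‖ ^ (2 : ℝ) := by
        rw [← Real.rpow_add_of_nonneg (norm_nonneg _) (by linarith) (by norm_num)]
        congr 1; ring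
    _ ≤ C ^ (P - 2) * ‖h x‖ ^ (2 : ℝ) := by
        gcongr

/-- Converse of Hölder's inequality. Testing against the extremal function h|h|^{P-2} gives I ≤ A
I^{1/r} for I = ∫|h|^P, and dividing by I^{1/r} gives I^{1/P} ≤ A. The extremal function is not
simple, hence an approximation in L^r. -/
theorem toReal_eLpNorm_le_of_simpleFunc {P r : ℝ} (hPr : P.HolderConjugate r) (hP : 2 ≤ P)
    {h : X → ℂ} (hh : MemLp h (ENNReal.ofReal P) μ) {A : ℝ} (hA : 0 ≤ A)
    (hle : ∀ g : SimpleFunc X ℂ, Integrable g μ →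
      ‖∫ x, (starRingEnd ℂ) (g x) * h x ∂μ‖ ≤ A * (∫ x, ‖g x‖ ^ r ∂μ) ^ (1 / r)) :
    (eLpNorm h (ENNReal.ofReal P) μ).toReal ≤ A := by
  have hP0 : 0 < P := by linarith
  have hr0 : 0 < r := hPr.symm.pos
  have hr1 : 1 < r := hPr.symm.lt
  set I : ℝ := ∫ x, ‖h x‖ ^ P ∂μ with hI
  have hI0 : 0 ≤ I := by positivity
  rw [toReal_eLpNorm_ofReal hP0 hh, ← hI]
  set g : X → ℂ := fun x ↦ h x * ((‖h x‖ ^ (P - 2) : ℝ) : ℂ) with hg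
  have hgn : ∀ x, ‖g x‖ = ‖h x‖ ^ (P - 1) := by
    intro x
    rw [hg]
    simp only [norm_mul, Complex.norm_real]
    rw [Real.norm_of_nonneg (by positivity)]
    nth_rewrite 1 [← Real.rpow_one ‖h x‖]
    rw [← Real.rpow_add_of_nonneg (norm_nonneg _) (by norm_num) (by linarith)]
    congr 1; ring
  have hgr : ∀ x, ‖g x‖ ^ r = ‖h x‖ ^ P := by
    intro x
    rw [hgn, ← Real.rpow_mul (norm_nonneg _)]
    congr 1
    exact hPr.sub_one_mul_conj
  have hgm : AEStronglyMeasurable g μ := by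
    refine hh.1.mul ?_
    exact (Complex.measurable_ofReal.comp_aemeasurable
      (hh.1.norm.aemeasurable.pow_const _)).aestronglyMeasurable
  have hhI : Integrable (fun x ↦ ‖h x‖ ^ P) μ := by
    have := (integrable_norm_rpow_iff hh.1 (by simpa using hP0) (by simp)).2 hh
    rwa [ENNReal.toReal_ofReal hP0.le] at this
  have hgL : MemLp g (ENNReal.ofReal r) μ := by
    rw [← integrable_norm_rpow_iff hgm (by simpa using hr0) (by simp),
      ENNReal.toReal_ofReal hr0.le]
    simpa only [hgr] using hhI
  have hholder : ∀ k : X → ℂ, MemLp k (ENNReal.ofReal r) μ →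
      Integrable (fun x ↦ (starRingEnd ℂ) (k x) * h x) μ ∧
      ‖∫ x, (starRingEnd ℂ) (k x) * h x ∂μ‖ ≤
        (eLpNorm k (ENNReal.ofReal r) μ).toReal * I ^ (1 / P) := by
    intro k hk
    have : ENNReal.HolderConjugate (ENNReal.ofReal P) (ENNReal.ofReal r) := hPr.ennrealOfReal
    constructor
    · have h1 : MemLp (fun x ↦ (starRingEnd ℂ) (k x)) (ENNReal.ofReal r) μ := hk.star
      exact memLp_one_iff_integrable.1 (hh.mul h1)
    · refine (norm_integral_le_integral_norm _).trans ?_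
      simp only [norm_mul, RCLike.norm_conj]
      rw [toReal_eLpNorm_ofReal hr0 hk]
      exact integral_mul_norm_le_Lp_mul_Lq hPr.symm hk hh
  -- With `k` simple and within ε of the extremal `g` in L^r, the hypothesis controls the pairing
  -- with `k`, and Hölder the pairing with `g - k`.
  have hmain : ∀ ε : ℝ, 0 < ε → I ≤ A * (I ^ (1 / r) + ε) + ε * I ^ (1 / P) := by
    intro ε hε
    obtain ⟨k, hk, hkL⟩ := hgL.exists_simpleFunc_eLpNorm_sub_lt (by simp)
      (ε := ENNReal.ofReal ε) (by simpa using hε)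
    have hki : Integrable k μ :=
      (SimpleFunc.memLp_iff_integrable (by simpa using hr0) (by simp)).1 hkL
    have hsub : (eLpNorm (g - ⇑k) (ENNReal.ofReal r) μ).toReal ≤ ε :=
      ENNReal.toReal_le_of_le_ofReal hε.le hk.le
    have hkn : (∫ x, ‖k x‖ ^ r ∂μ) ^ (1 / r) ≤ I ^ (1 / r) + ε := by
      rw [← toReal_eLpNorm_ofReal hr0 hkL]
      have hgn' : (eLpNorm g (ENNReal.ofReal r) μ).toReal = I ^ (1 / r) := by
        rw [toReal_eLpNorm_ofReal hr0 hgL]; simp only [hgr, hI]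
      have htri : eLpNorm k (ENNReal.ofReal r) μ ≤
          eLpNorm g (ENNReal.ofReal r) μ + eLpNorm (g - ⇑k) (ENNReal.ofReal r) μ := by
        have : (k : X → ℂ) = g - (g - ⇑k) := by abel
        nth_rewrite 1 [this]
        exact eLpNorm_sub_le hgL.1 (hgL.sub hkL).1 (by simpa using hr1.le)
      have := ENNReal.toReal_mono
        (ENNReal.add_ne_top.2 ⟨hgL.eLpNorm_ne_top, (hgL.sub hkL).eLpNorm_ne_top⟩) htri
      rw [ENNReal.toReal_add hgL.eLpNorm_ne_top (hgL.sub hkL).eLpNorm_ne_top, hgn'] at this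
      linarith
    have hIeq : ((I : ℝ) : ℂ) = (∫ x, (starRingEnd ℂ) (k x) * h x ∂μ) +
        ∫ x, (starRingEnd ℂ) ((g - ⇑k) x) * h x ∂μ := by
      rw [← integral_add (hholder k hkL).1 (hholder _ (hgL.sub hkL)).1, hI, ← integral_complex_ofReal]
      refine integral_congr_ae (Filter.Eventually.of_forall fun x ↦ ?_)
      simp only [Pi.sub_apply, map_sub]
      have h3 : (starRingEnd ℂ) (g x) * h x = ((‖h x‖ ^ P : ℝ) : ℂ) := by
        simp only [hg, map_mul, Complex.conj_ofReal]
        have h4 : (starRingEnd ℂ) (h x) * h x = ((‖h x‖ ^ 2 : ℝ) : ℂ) := by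
          rw [mul_comm, Complex.mul_conj, Complex.normSq_eq_norm_sq]
        rw [mul_right_comm, h4, ← Complex.ofReal_mul]
        congr 1
        rw [← Real.rpow_natCast, ← Real.rpow_add_of_nonneg (norm_nonneg _) (by norm_num)
          (by linarith)]
        congr 1; push_cast; ring
      rw [← h3]; ring
    have : I = ‖((I : ℝ) : ℂ)‖ := by rw [Complex.norm_real, Real.norm_of_nonneg hI0]
    rw [this, hIeq]
    refine (norm_add_le _ _).trans ?_
    rw [← hIeq, ← this]
    refine add_le_add ((hle k hki).trans ?_) ((hholder _ (hgL.sub hkL)).2.trans ?_)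
    · gcongr
    · gcongr
  have hlim : I ≤ A * I ^ (1 / r) := by
    have ht : Filter.Tendsto (fun ε : ℝ ↦ A * (I ^ (1 / r) + ε) + ε * I ^ (1 / P))
        (nhdsWithin 0 (Set.Ioi 0)) (nhds (A * (I ^ (1 / r) + 0) + 0 * I ^ (1 / P))) := by
      refine Filter.Tendsto.mono_left ?_ nhdsWithin_le_nhds
      exact (Continuous.tendsto (by fun_prop) 0)
    have := ge_of_tendsto ht (eventually_nhdsWithin_of_forall fun ε hε ↦ hmain ε hε)
    simpa using this
  rcases hI0.eq_or_lt with h0 | hpos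
  · rw [← h0, Real.zero_rpow (by positivity)]; exact hA
  · have hsum : 1 / P + 1 / r = 1 := by simpa using hPr.inv_add_inv_eq_one
    have : I ^ (1 / P) * I ^ (1 / r) = I := by
      rw [← Real.rpow_add hpos, hsum, Real.rpow_one]
    rw [← this] at hlim
    exact le_of_mul_le_mul_right (by rwa [this] at hlim ⊢) (Real.rpow_pos_of_pos hpos (1 / r))

/-- Riesz–Thorin interpolation between `L¹ → L^∞` and `L² → L²` on the line of duality. -/
theorem eLpNorm_simpleFunc_le (T : Lp ℂ 2 μ →L[ℂ] Lp ℂ 2 μ) {M₁ M₂ : ℝ} (hM₁ : 0 ≤ M₁)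
    (hM₂ : 0 ≤ M₂)
    (h₁ : ∀ f : Lp ℂ 2 μ, Integrable f μ → ∀ᵐ x ∂μ, ‖T f x‖ ≤ M₁ * ∫ x, ‖f x‖ ∂μ)
    (h₂ : ∀ f, ‖T f‖ ≤ M₂ * ‖f‖) {p p' : ℝ≥0∞} (hp : 2 ≤ p) (hpp' : p⁻¹ + p'⁻¹ = 1)
    {f : SimpleFunc X ℂ} (hf : Integrable f μ) :
    eLpNorm (T ((memLp_simpleFunc hf 2).toLp f)) p μ ≤
      ENNReal.ofReal (M₁ ^ (1 - 2 * p⁻¹.toReal) * M₂ ^ (2 * p⁻¹.toReal)) * eLpNorm f p' μ := by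
  set F : Lp ℂ 2 μ := (memLp_simpleFunc hf 2).toLp f with hF
  have hFf : F =ᵐ[μ] f := MemLp.coeFn_toLp _
  have hFi : Integrable F μ := hf.congr hFf.symm
  rcases eq_or_ne p ⊤ with rfl | hptop
  · have hp1 : p' = 1 := by simpa using hpp'
    subst hp1
    simp only [ENNReal.inv_top, ENNReal.toReal_zero, mul_zero, sub_zero, Real.rpow_one,
      Real.rpow_zero, mul_one]
    have : eLpNorm f 1 μ = ENNReal.ofReal (∫ x, ‖F x‖ ∂μ) := by
      rw [← eLpNorm_congr_ae hFf, eLpNorm_one_eq_lintegral_enorm,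
        ofReal_integral_norm_eq_lintegral_enorm hFi]
    rw [this, ← ENNReal.ofReal_mul hM₁, eLpNorm_exponent_top]
    exact eLpNormEssSup_le_of_ae_bound (h₁ F hFi)
  set P : ℝ := p.toReal with hPdef
  have hPp : p = ENNReal.ofReal P := (ENNReal.ofReal_toReal hptop).symm
  have hP : 2 ≤ P := by
    rw [hPp] at hp
    have : ENNReal.ofReal 2 ≤ ENNReal.ofReal P := by simpa using hp
    exact (ENNReal.ofReal_le_ofReal_iff (by positivity)).1 this
  have hP0 : 0 < P := by linarith
  have hpinv : p⁻¹ = ENNReal.ofReal P⁻¹ := by rw [hPp, ENNReal.ofReal_inv_of_pos hP0]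
  have hPinv : P⁻¹ ≤ 1 / 2 := by
    rw [one_div]; exact inv_anti₀ (by norm_num) hP
  have hp'inv : p'⁻¹ = ENNReal.ofReal (1 - P⁻¹) := by
    have h1 : p'⁻¹ = 1 - p⁻¹ := by
      rw [← hpp']; exact (ENNReal.add_sub_cancel_left (by rw [hpinv]; simp)).symm
    rw [h1, hpinv, ENNReal.ofReal_sub _ (by positivity), ENNReal.ofReal_one]
  set r : ℝ := (1 - P⁻¹)⁻¹ with hr
  have hp'r : p' = ENNReal.ofReal r := by
    rw [hr, ENNReal.ofReal_inv_of_pos (by linarith), ← hp'inv, inv_inv]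
  have hPr : P.HolderConjugate r := by
    rw [Real.holderConjugate_iff]
    exact ⟨by linarith, by rw [hr, inv_inv]; ring⟩
  have hr0 : 0 < r := hPr.symm.pos
  have hr2 : r ≤ 2 := by
    rw [hr]
    exact inv_le_of_inv_le₀ (by norm_num) (by linarith)
  have hrinv : 1 / r = 1 - P⁻¹ := by rw [one_div, hr, inv_inv]
  have hmem : MemLp (T F) (ENNReal.ofReal P) μ :=
    memLp_of_memLp_two_of_bounded hP (Lp.memLp _) (h₁ F hFi)
  have hpt : p⁻¹.toReal = P⁻¹ := by rw [hpinv, ENNReal.toReal_ofReal (by positivity)]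
  have hfL : MemLp f (ENNReal.ofReal r) μ := memLp_simpleFunc hf _
  rw [hp'r, hPp, ← hPp, hpt, hPp]
  rw [← ENNReal.toReal_le_toReal hmem.eLpNorm_ne_top
    (ENNReal.mul_ne_top ENNReal.ofReal_ne_top hfL.eLpNorm_ne_top), ENNReal.toReal_mul,
    ENNReal.toReal_ofReal (by positivity)]
  refine toReal_eLpNorm_le_of_simpleFunc hPr hP hmem (by positivity) fun g hg ↦ ?_
  have key := norm_inner_simpleFunc_le T hM₁ hM₂ (fun a b ha hb ↦ by
    rw [L2.inner_def]
    refine (norm_integral_le_integral_norm _).trans ?_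
    rw [← integral_const_mul]
    refine integral_mono_ae (L2.integrable_inner b (T a)).norm (hb.norm.const_mul _) ?_
    filter_upwards [h₁ a ha] with x hx
    refine (norm_inner_le_norm _ _).trans ?_
    rw [mul_comm]
    gcongr) h₂ hPr.symm.lt.le hr2 hf hg
  rw [L2.inner_def] at key
  have hcongr : ∫ x, inner ℂ ((memLp_simpleFunc hg 2).toLp g x) (T F x) ∂μ =
      ∫ x, (starRingEnd ℂ) (g x) * T F x ∂μ := by
    refine integral_congr_ae ?_
    filter_upwards [(memLp_simpleFunc hg 2).coeFn_toLp] with x hx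
    rw [hx]
    simp [mul_comm]
  rw [hcongr] at key
  refine key.trans (le_of_eq ?_)
  rw [toReal_eLpNorm_ofReal hr0 hfL]
  have e1 : 2 / r = 2 - 2 * P⁻¹ := by
    rw [div_eq_mul_one_div, hrinv]; ring
  rw [e1, show (2 : ℝ) - 2 * P⁻¹ - 1 = 1 - 2 * P⁻¹ by ring,
    show (2 : ℝ) - (2 - 2 * P⁻¹) = 2 * P⁻¹ by ring]
  ring

end Duality

/-! ### Fourier multipliers from L^{p'} to L^p. -/

section Multiplier

open FourierTransform

variable {E : Type*} [NormedAddCommGroup E] [InnerProductSpace ℝ E] [FiniteDimensional ℝ E]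
  [MeasurableSpace E] [BorelSpace E]

/-- Convolution theorem, with the kernel of the multiplier on the left. -/
theorem fourierInv_mul_fourier {f m : E → ℂ} (hf : Integrable f) (hm : Integrable m) (x : E) :
    𝓕⁻ (fun η ↦ m η * 𝓕 f η) x = ∫ y, f y * 𝓕⁻ m (x - y) := by
  set g : E → ℂ := fun η ↦ Real.fourierChar (inner ℝ η x) • m η with hg
  have hgi : Integrable g := by
    have := (Real.fourierIntegral_convergent_iff (μ := (volume : Measure E)) (f := m) (-x)).2 hm
    simpa [hg, Circle.smul_def] using this
  have key := VectorFourier.integral_fourierIntegral_smul_eq_flip (L := innerₗ E)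
    (μ := (volume : Measure E)) (ν := (volume : Measure E))
    Real.continuous_fourierChar continuous_inner hf hgi
  have h1 : 𝓕⁻ (fun η ↦ m η * 𝓕 f η) x = ∫ ξ, (VectorFourier.fourierIntegral Real.fourierChar
      (volume : Measure E) (innerₗ E) f ξ) • g ξ := by
    rw [Real.fourierInv_eq]
    refine integral_congr_ae (Filter.Eventually.of_forall fun η ↦ ?_)
    have : VectorFourier.fourierIntegral Real.fourierChar
      (volume : Measure E) (innerₗ E) f η = 𝓕 f η := rfl
    simp only [this, hg, Circle.smul_def, smul_eq_mul]
    ring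
  rw [h1, key]
  refine integral_congr_ae (Filter.Eventually.of_forall fun y ↦ ?_)
  simp only [smul_eq_mul]
  congr 1
  rw [Real.fourierInv_eq, VectorFourier.fourierIntegral]
  refine integral_congr_ae (Filter.Eventually.of_forall fun η ↦ ?_)
  simp only [hg, smul_smul, ← AddChar.map_add_eq_mul]
  congr 2
  simp only [LinearMap.flip_apply, innerₗ_apply_apply, inner_sub_right, real_inner_comm y η]
  rw [real_inner_comm]
  ring

/-- Plancherel gives the operator and its L² bound. For the sup bound, the convolution formula is
known on Schwartz functions; it passes to every f in L² along a subsequence converging almost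
everywhere, because the translated kernel is itself in L², so that its pairing with f is continuous
at each fixed x. -/
theorem exists_l2_multiplier {m : E → ℂ} (hm : ContDiff ℝ ∞ m) (hmc : HasCompactSupport m)
    {M₁ M₂ : ℝ} (h₁ : ∀ x, ‖𝓕⁻ m x‖ ≤ M₁) (h₂ : ∀ ξ, ‖m ξ‖ ≤ M₂) :
    ∃ T : Lp ℂ 2 (volume : Measure E) →L[ℂ] Lp ℂ 2 (volume : Measure E),
      (∀ f, Lp.toTemperedDistribution (T f) =
        TemperedDistribution.fourierMultiplierCLM ℂ m (Lp.toTemperedDistribution f)) ∧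
      (∀ f, ‖T f‖ ≤ M₂ * ‖f‖) ∧
      ∀ f : Lp ℂ 2 (volume : Measure E), Integrable f →
        ∀ᵐ x, ‖T f x‖ ≤ M₁ * ∫ x, ‖f x‖ := by
  have hM₂ : 0 ≤ M₂ := (norm_nonneg _).trans (h₂ 0)
  have hmg : m.HasTemperateGrowth := hmc.hasTemperateGrowth hm
  have hmL : MemLp m ⊤ (volume : Measure E) :=
    memLp_top_of_bound hm.continuous.aestronglyMeasurable M₂ (Filter.Eventually.of_forall h₂)
  have hmn : ‖hmL.toLp m‖ ≤ M₂ := by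
    rw [Lp.norm_toLp, eLpNorm_exponent_top]
    exact ENNReal.toReal_le_of_le_ofReal hM₂
      (eLpNormEssSup_le_of_ae_bound (Filter.Eventually.of_forall h₂))
  let T₀ : Lp ℂ 2 (volume : Measure E) →ₗ[ℂ] Lp ℂ 2 (volume : Measure E) :=
    { toFun := fun f ↦ 𝓕⁻ (hmL.toLp m • 𝓕 f : Lp ℂ 2 (volume : Measure E))
      map_add' := fun f g ↦ by
        rw [FourierTransform.fourier_add, Lp.add_smul, FourierTransform.fourierInv_add]
      map_smul' := fun c f ↦ by
        rw [FourierTransform.fourier_smul, ← Lp.smul_comm, FourierTransform.fourierInv_smul]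
        rfl }
  have hT₀ : ∀ f, ‖T₀ f‖ ≤ M₂ * ‖f‖ := by
    intro f
    have h3 : ‖T₀ f‖ = ‖(hmL.toLp m • 𝓕 f : Lp ℂ 2 (volume : Measure E))‖ :=
      (Lp.fourierTransformₗᵢ E ℂ).symm.norm_map _
    rw [h3]
    refine (Lp.norm_smul_le _ _).trans ?_
    rw [Lp.norm_fourier_eq]
    gcongr
  set T := T₀.mkContinuous M₂ hT₀ with hT
  have hTD : ∀ f, Lp.toTemperedDistribution (T f) =
      TemperedDistribution.fourierMultiplierCLM ℂ m (Lp.toTemperedDistribution f) := by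
    intro f
    have : T f = 𝓕⁻ (hmL.toLp m • 𝓕 f : Lp ℂ 2 (volume : Measure E)) := rfl
    rw [this, ← Lp.fourierInv_toTemperedDistribution_eq,
      TemperedDistribution.fourierMultiplierCLM_apply, Lp.fourier_toTemperedDistribution_eq]
    congr 1
    exact Lp.toTemperedDistribution_smul_eq hmg hmL (𝓕 f)
  refine ⟨T, hTD, hT₀, fun f hfi ↦ ?_⟩
  set κ : 𝓢(E, ℂ) := 𝓕⁻ (hmc.toSchwartzMap hm) with hκ
  have hκm : ∀ x, κ x = 𝓕⁻ m x := by
    intro x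
    rw [hκ, SchwartzMap.fourierInv_coe]
    rfl
  have hmi : Integrable m := hm.continuous.integrable_of_hasCompactSupport hmc
  have hTS : ∀ (g : 𝓢(E, ℂ)), ∀ᵐ x, T (g.toLp 2) x = ∫ y, g y * κ (x - y) := by
    intro g
    have heq : T (g.toLp 2) = (SchwartzMap.fourierMultiplierCLM ℂ m g).toLp 2 := by
      have hinj : Function.Injective (Lp.toTemperedDistributionCLM ℂ (volume : Measure E) 2) :=
        LinearMap.ker_eq_bot.1 Lp.ker_toTemperedDistributionCLM_eq_bot
      apply hinj
      rw [Lp.toTemperedDistributionCLM_apply, Lp.toTemperedDistributionCLM_apply, hTD,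
        Lp.toTemperedDistribution_toLp_eq, Lp.toTemperedDistribution_toLp_eq,
        TemperedDistribution.fourierMultiplierCLM_toTemperedDistributionCLM_eq hmg]
    rw [heq]
    filter_upwards [(SchwartzMap.fourierMultiplierCLM ℂ m g).coeFn_toLp 2] with x hx
    rw [hx, SchwartzMap.fourierMultiplierCLM_apply, SchwartzMap.fourierInv_coe]
    simp only [hκm]
    rw [← fourierInv_mul_fourier g.integrable hmi x]
    refine congrArg (fun h : E → ℂ ↦ 𝓕⁻ h x) (funext fun η ↦ ?_)
    rw [SchwartzMap.smulLeftCLM_apply_apply hmg, SchwartzMap.fourier_coe]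
    rfl
  have hκL : ∀ x, MemLp (fun y ↦ (starRingEnd ℂ) (κ (x - y))) 2 (volume : Measure E) := by
    intro x
    have h3 : MemLp (fun y ↦ κ (x - y)) 2 (volume : Measure E) :=
      (κ.memLp 2 volume).comp_measurePreserving (Measure.measurePreserving_sub_left volume x)
    exact h3.star
  have hinner : ∀ x (g : Lp ℂ 2 (volume : Measure E)),
      inner ℂ ((hκL x).toLp _) g = ∫ y, g y * κ (x - y) := by
    intro x g
    rw [L2.inner_def]
    refine integral_congr_ae ?_
    filter_upwards [(hκL x).coeFn_toLp] with y hy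
    rw [hy]
    simp
  have hkernel : ∀ᵐ x, T f x = ∫ y, f y * κ (x - y) := by
    obtain ⟨u, hu⟩ : ∃ u : ℕ → 𝓢(E, ℂ), Filter.Tendsto (fun k ↦ (u k).toLp 2 (volume : Measure E))
        Filter.atTop (nhds f) := by
      have hd := SchwartzMap.denseRange_toLpCLM (E := E) (F := ℂ) (p := 2)
        (μ := (volume : Measure E)) (by simp)
      obtain ⟨v, hv, hvt⟩ := mem_closure_iff_seq_limit.1 (hd f)
      choose u hu using hv
      refine ⟨u, ?_⟩
      convert! hvt using 2 with k
      exact hu k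
    have hTu : Filter.Tendsto (fun k ↦ T ((u k).toLp 2 (volume : Measure E))) Filter.atTop
        (nhds (T f)) := (T.continuous.tendsto f).comp hu
    obtain ⟨ns, hns, hae⟩ := (tendstoInMeasure_of_tendsto_Lp hTu).exists_seq_tendsto_ae
    have hall := ae_all_iff.2 fun k ↦ hTS (u k)
    filter_upwards [hae, hall] with x hx hk
    refine tendsto_nhds_unique hx ?_
    have h4 : Filter.Tendsto (fun k ↦ inner ℂ ((hκL x).toLp _)
        ((u (ns k)).toLp 2 (volume : Measure E))) Filter.atTop
        (nhds (inner ℂ ((hκL x).toLp _) f)) :=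
      Filter.Tendsto.inner tendsto_const_nhds (hu.comp hns.tendsto_atTop)
    rw [hinner] at h4
    refine h4.congr fun k ↦ ?_
    rw [hinner, hk]
    refine integral_congr_ae ?_
    filter_upwards [(u (ns k)).coeFn_toLp 2] with y hy
    rw [hy]
  filter_upwards [hkernel] with x hx
  rw [hx, mul_comm, ← integral_mul_const]
  refine norm_integral_le_of_norm_le (hfi.norm.mul_const _) (Filter.Eventually.of_forall fun y ↦ ?_)
  rw [norm_mul, hκm]
  gcongr
  exact h₁ _

/-- A bound on a dense class of `L^{p'}` extends to all of `L^{p'}`. -/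
theorem exists_toTemperedDistribution_eq_of_simpleFunc {p p' : ℝ≥0∞} [Fact (1 ≤ p)]
    [Fact (1 ≤ p')] (hp' : p' ≠ ⊤) (S : 𝓢'(E, ℂ) →L[ℂ] 𝓢'(E, ℂ)) {A : ℝ} (hA : 0 ≤ A)
    (h : ∀ f ∈ Lp.simpleFunc ℂ p' (volume : Measure E), ∃ k : Lp ℂ p (volume : Measure E),
      Lp.toTemperedDistribution k = S (Lp.toTemperedDistribution f) ∧ ‖k‖ ≤ A * ‖f‖)
    (f : Lp ℂ p' (volume : Measure E)) : ∃ k : Lp ℂ p (volume : Measure E),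
      Lp.toTemperedDistribution k = S (Lp.toTemperedDistribution f) ∧ ‖k‖ ≤ A * ‖f‖ := by
  have hinj : Function.Injective (Lp.toTemperedDistributionCLM ℂ (volume : Measure E) p) :=
    LinearMap.ker_eq_bot.1 Lp.ker_toTemperedDistributionCLM_eq_bot
  obtain ⟨v, hv, hvt⟩ := mem_closure_iff_seq_limit.1 ((Lp.simpleFunc.dense (E := ℂ) hp') f)
  choose k hk hkn using fun j ↦ h (v j) (hv j)
  have hdiff : ∀ i j, ‖k i - k j‖ ≤ A * ‖v i - v j‖ := by
    intro i j
    obtain ⟨l, hl, hln⟩ := h (v i - v j) ((Lp.simpleFunc ℂ p' _).sub_mem (hv i) (hv j))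
    have : l = k i - k j := by
      apply hinj
      rw [map_sub]
      simp only [Lp.toTemperedDistributionCLM_apply, hl, hk]
      rw [← map_sub]
      congr 1
      exact map_sub (Lp.toTemperedDistributionCLM ℂ (volume : Measure E) p') (v i) (v j)
    rwa [← this]
  have hcauchy : CauchySeq k := by
    rw [Metric.cauchySeq_iff']
    intro ε hε
    obtain ⟨N, hN⟩ := Metric.cauchySeq_iff'.1 hvt.cauchySeq (ε / (A + 1)) (by positivity)
    refine ⟨N, fun j hj ↦ ?_⟩
    have h1 := hN j hj
    rw [dist_eq_norm] at h1 ⊢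
    rw [lt_div_iff₀ (by positivity)] at h1
    refine (hdiff j N).trans_lt (lt_of_le_of_lt ?_ h1)
    nlinarith [norm_nonneg (v j - v N)]
  obtain ⟨l, hl⟩ := cauchySeq_tendsto_of_complete hcauchy
  refine ⟨l, ?_, ?_⟩
  · have h1 := ((Lp.toTemperedDistributionCLM ℂ (volume : Measure E) p).continuous.tendsto l).comp hl
    have h2 := ((S ∘L Lp.toTemperedDistributionCLM ℂ (volume : Measure E) p').continuous.tendsto
      f).comp hvt
    refine tendsto_nhds_unique h1 (h2.congr fun j ↦ ?_)
    exact (hk j).symm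
  · exact le_of_tendsto_of_tendsto' hl.norm (hvt.norm.const_mul A) hkn

/-- Interpolation handles simple functions, which are dense because p ≥ 2 forces p' < ∞. The limit
is identified in the space of tempered distributions, where the multiplier is continuous. -/
theorem exists_toTemperedDistribution_multiplier {m : E → ℂ} (hm : ContDiff ℝ ∞ m)
    (hmc : HasCompactSupport m) {M₁ M₂ : ℝ} (h₁ : ∀ x, ‖𝓕⁻ m x‖ ≤ M₁) (h₂ : ∀ ξ, ‖m ξ‖ ≤ M₂)
    {p p' : ℝ≥0∞} [Fact (1 ≤ p)] [Fact (1 ≤ p')] (hp : 2 ≤ p) (hpp' : p⁻¹ + p'⁻¹ = 1)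
    (f : Lp ℂ p' (volume : Measure E)) : ∃ k : Lp ℂ p (volume : Measure E),
      Lp.toTemperedDistribution k =
        TemperedDistribution.fourierMultiplierCLM ℂ m (Lp.toTemperedDistribution f) ∧
      ‖k‖ ≤ M₁ ^ (1 - 2 * p⁻¹.toReal) * M₂ ^ (2 * p⁻¹.toReal) * ‖f‖ := by
  have hM₁ : 0 ≤ M₁ := (norm_nonneg _).trans (h₁ 0)
  have hM₂ : 0 ≤ M₂ := (norm_nonneg _).trans (h₂ 0)
  have hp'0 : p' ≠ 0 := (lt_of_lt_of_le one_pos (Fact.out : 1 ≤ p')).ne'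
  have hp' : p' ≠ ⊤ := by
    rintro rfl
    have h3 : p⁻¹ = 1 := by simpa using hpp'
    have h4 : p = 1 := by simpa using h3
    rw [h4] at hp
    exact absurd hp (by norm_num)
  have hA : 0 ≤ M₁ ^ (1 - 2 * p⁻¹.toReal) * M₂ ^ (2 * p⁻¹.toReal) := by positivity
  obtain ⟨T, hTD, hT₂, hT₁⟩ := exists_l2_multiplier hm hmc h₁ h₂
  refine exists_toTemperedDistribution_eq_of_simpleFunc hp' _ hA (fun f hf ↦ ?_) f
  set g : SimpleFunc E ℂ := Lp.simpleFunc.toSimpleFunc ⟨f, hf⟩ with hg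
  have hgf : g =ᵐ[volume] f := Lp.simpleFunc.toSimpleFunc_eq_toFun ⟨f, hf⟩
  have hgi : Integrable g := (SimpleFunc.memLp_iff_integrable hp'0 hp').1
    ((memLp_congr_ae hgf).2 (Lp.memLp f))
  have hle := eLpNorm_simpleFunc_le T hM₁ hM₂ hT₁ hT₂ hp hpp' hgi
  rw [eLpNorm_congr_ae hgf] at hle
  have hfin : eLpNorm f p' (volume : Measure E) ≠ ⊤ := (Lp.memLp f).eLpNorm_ne_top
  have hmem : MemLp (T ((memLp_simpleFunc hgi 2).toLp g)) p (volume : Measure E) :=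
    ⟨(Lp.memLp _).1, hle.trans_lt (ENNReal.mul_lt_top ENNReal.ofReal_lt_top hfin.lt_top)⟩
  refine ⟨hmem.toLp _, ?_, ?_⟩
  · have h3 : Lp.toTemperedDistribution (hmem.toLp _) =
        Lp.toTemperedDistribution (T ((memLp_simpleFunc hgi 2).toLp g)) := by
      ext u
      simp only [Lp.toTemperedDistribution_apply]
      refine integral_congr_ae ?_
      filter_upwards [hmem.coeFn_toLp] with x hx
      rw [hx]
    have h4 : Lp.toTemperedDistribution ((memLp_simpleFunc hgi 2).toLp g) =
        Lp.toTemperedDistribution f := by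
      ext u
      simp only [Lp.toTemperedDistribution_apply]
      refine integral_congr_ae ?_
      filter_upwards [(memLp_simpleFunc hgi 2).coeFn_toLp, hgf] with x hx hx'
      rw [hx, hx']
    rw [h3, hTD, h4]
  · rw [Lp.norm_toLp, Lp.norm_def]
    have := ENNReal.toReal_mono (ENNReal.mul_ne_top ENNReal.ofReal_ne_top hfin) hle
    rwa [ENNReal.toReal_mul, ENNReal.toReal_ofReal hA] at this

/-- If `u` is not in L^{p'}, the right-hand side has to be ∞; this is why `M₁` and `M₂` are positive
and not merely nonnegative, as 0 · ∞ = 0. -/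
theorem distLpNorm_multiplier_le {n : ℕ} {m : EuclideanSpace ℝ (Fin n) → ℂ}
    (hm : ContDiff ℝ ∞ m) (hmc : HasCompactSupport m) {M₁ M₂ : ℝ} (hM₁ : 0 < M₁)
    (hM₂ : 0 < M₂) (h₁ : ∀ x, ‖𝓕⁻ m x‖ ≤ M₁) (h₂ : ∀ ξ, ‖m ξ‖ ≤ M₂) {p p' : ℝ≥0∞}
    [Fact (1 ≤ p)] [Fact (1 ≤ p')] (hp : 2 ≤ p) (hpp' : p⁻¹ + p'⁻¹ = 1) (u : 𝓢'(EuclideanSpace ℝ (Fin n), ℂ)) :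
    distLpNorm p (TemperedDistribution.fourierMultiplierCLM ℂ m u) ≤
      ENNReal.ofReal (M₁ ^ (1 - 2 * p⁻¹.toReal) * M₂ ^ (2 * p⁻¹.toReal)) * distLpNorm p' u := by
  set A : ℝ := M₁ ^ (1 - 2 * p⁻¹.toReal) * M₂ ^ (2 * p⁻¹.toReal) with hAdef
  have hA : 0 < A := by positivity
  by_cases hex : ∃ f : Lp ℂ p' (volume : Measure (EuclideanSpace ℝ (Fin n))),
      Lp.toTemperedDistribution f = u
  · obtain ⟨f, rfl⟩ := hex
    have hinj : Function.Injective (Lp.toTemperedDistributionCLM ℂ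
        (volume : Measure (EuclideanSpace ℝ (Fin n))) p') :=
      LinearMap.ker_eq_bot.1 Lp.ker_toTemperedDistributionCLM_eq_bot
    have hf : distLpNorm p' (Lp.toTemperedDistribution f) = ‖f‖ₑ := by
      refine le_antisymm (iInf₂_le (f := fun (h : Lp ℂ p'
        (volume : Measure (EuclideanSpace ℝ (Fin n)))) (_ : Lp.toTemperedDistribution h =
          Lp.toTemperedDistribution f) ↦ ‖h‖ₑ) f rfl) (le_iInf₂ fun g hg ↦ ?_)
      rw [show g = f from hinj hg]
    obtain ⟨k, hk, hkn⟩ := exists_toTemperedDistribution_multiplier hm hmc h₁ h₂ hp hpp' f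
    rw [hf]
    refine (iInf₂_le (f := fun (h : Lp ℂ p (volume : Measure (EuclideanSpace ℝ (Fin n))))
      (_ : Lp.toTemperedDistribution h = _) ↦ ‖h‖ₑ) k hk).trans ?_
    rw [← ofReal_norm, ← ofReal_norm, ← ENNReal.ofReal_mul hA.le]
    exact ENNReal.ofReal_le_ofReal hkn
  · have htop : distLpNorm p' u = ⊤ := by
      simp only [distLpNorm, iInf_eq_top]
      exact fun f hf ↦ absurd ⟨f, hf⟩ hex
    rw [htop, ENNReal.mul_top (by simpa using hA)]
    exact le_top

end Multiplier

/-! ### A closed-form Bessel integral with complex parameters. -/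

section BesselIntegrals

open FourierTransform Complex Set

/-- Near y = 0 the factors c ± iy both have real part Re c > 0; for large y the term y² dominates.
This makes the complex Lorentzian integrable. -/
theorem norm_sq_add_sq_ge {c : ℂ} (hc : 0 < c.re) :
    ∃ k : ℝ, 0 < k ∧ ∀ y : ℝ, k * (1 + y ^ 2) ≤ ‖c ^ 2 + (y : ℂ) ^ 2‖ := by
  have h1 : ∀ y : ℝ, c.re ^ 2 ≤ ‖c ^ 2 + (y : ℂ) ^ 2‖ := by
    intro y
    have : c ^ 2 + (y : ℂ) ^ 2 = (c + I * y) * (c - I * y) := by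
      ring_nf; simp
    rw [this, norm_mul, sq]
    have h2 : c.re ≤ ‖c + I * y‖ := by
      have := (le_abs_self _).trans (Complex.abs_re_le_norm (c + I * y)); simpa using this
    have h3 : c.re ≤ ‖c - I * y‖ := by
      have := (le_abs_self _).trans (Complex.abs_re_le_norm (c - I * y)); simpa using this
    exact mul_le_mul h2 h3 hc.le (norm_nonneg _)
  have h2 : ∀ y : ℝ, y ^ 2 - ‖c‖ ^ 2 ≤ ‖c ^ 2 + (y : ℂ) ^ 2‖ := by
    intro y
    have := norm_sub_le (c ^ 2 + (y : ℂ) ^ 2) (c ^ 2)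
    rw [add_sub_cancel_left, norm_pow, norm_pow, Complex.norm_real, Real.norm_eq_abs, sq_abs] at this
    linarith
  refine ⟨(1 + (1 + ‖c‖ ^ 2) / c.re ^ 2)⁻¹, by positivity, fun y ↦ ?_⟩
  rw [inv_mul_le_iff₀ (by positivity)]
  have h3 : 1 + ‖c‖ ^ 2 ≤ (1 + ‖c‖ ^ 2) / c.re ^ 2 * ‖c ^ 2 + (y : ℂ) ^ 2‖ := by
    rw [div_mul_eq_mul_div, le_div_iff₀ (by positivity)]
    exact mul_le_mul_of_nonneg_left (h1 y) (by positivity)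
  nlinarith [h2 y]

theorem integrable_of_norm_le_inv_one_add_sq {f : ℝ → ℂ} (hf : Continuous f) {C : ℝ}
    (h : ∀ y, ‖f y‖ ≤ C * (1 + y ^ 2)⁻¹) : Integrable f :=
  (integrable_inv_one_add_sq.const_mul C).mono' hf.aestronglyMeasurable
    (Filter.Eventually.of_forall h)

/-- The Fourier transform of the Lorentzian. -/
theorem integral_exp_div_sq_add_sq {c : ℂ} (hc : 0 < c.re) :
    ∫ y : ℝ, cexp (2 * I * y) / (c ^ 2 + (y : ℂ) ^ 2) = Real.pi / c * cexp (-2 * c) := by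
  have hπ := Real.pi_pos
  have hπ' : (Real.pi : ℂ) ≠ 0 := by exact_mod_cast hπ.ne'
  have hc0 : c ≠ 0 := by rintro rfl; simp at hc
  obtain ⟨k, hk, hky⟩ := norm_sq_add_sq_ge hc
  have hne : ∀ y : ℝ, c ^ 2 + (y : ℂ) ^ 2 ≠ 0 := fun y ↦ norm_pos_iff.1
    (lt_of_lt_of_le (by positivity) (hky y))
  -- The Fourier transform of e^{-2πc|x|} is c/(π(c² + y²)); Fourier inversion at the point 1/π is
  -- the asserted integral.
  set f : ℝ → ℂ := fun x ↦ cexp (-(2 * Real.pi * c) * (|x| : ℝ)) with hf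
  have hfc : Continuous f := by fun_prop
  have hIoi : ∀ y : ℝ, ∀ x ∈ Ioi (0 : ℝ), cexp ((-(2 * Real.pi * (c + I * y))) * x) =
      cexp (↑(-2 * Real.pi * x * y) * I) • f x := by
    intro y x hx
    rw [hf]; simp only [smul_eq_mul, abs_of_pos (mem_Ioi.1 hx)]
    rw [← Complex.exp_add]; congr 1; push_cast; ring
  have hIic : ∀ y : ℝ, ∀ x ∈ Iic (0 : ℝ), cexp ((2 * Real.pi * (c - I * y)) * x) =
      cexp (↑(-2 * Real.pi * x * y) * I) • f x := by
    intro y x hx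
    rw [hf]; simp only [smul_eq_mul, abs_of_nonpos (mem_Iic.1 hx)]
    rw [← Complex.exp_add]; congr 1; push_cast; ring
  have hre1 : ∀ y : ℝ, (-(2 * Real.pi * (c + I * y))).re < 0 := by
    intro y
    have : (-(2 * Real.pi * (c + I * y))).re = -(2 * Real.pi * c.re) := by simp
    rw [this]; nlinarith
  have hre2 : ∀ y : ℝ, 0 < (2 * Real.pi * (c - I * y)).re := by
    intro y
    have : (2 * Real.pi * (c - I * y)).re = (2 * Real.pi * c.re) := by simp
    rw [this]; positivity
  have hint1 : ∀ y : ℝ, IntegrableOn (fun x : ℝ ↦ cexp (↑(-2 * Real.pi * x * y) * I) • f x)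
      (Ioi 0) := fun y ↦
    (integrableOn_exp_mul_complex_Ioi (hre1 y) 0).congr_fun (hIoi y) measurableSet_Ioi
  have hint2 : ∀ y : ℝ, IntegrableOn (fun x : ℝ ↦ cexp (↑(-2 * Real.pi * x * y) * I) • f x)
      (Iic 0) := fun y ↦
    (integrableOn_exp_mul_complex_Iic (hre2 y) 0).congr_fun (hIic y) measurableSet_Iic
  have hfi : Integrable f := by
    have h3 := (hint2 0).union (hint1 0)
    rw [Iic_union_Ioi, integrableOn_univ] at h3
    simpa using h3
  have hF : ∀ y : ℝ, 𝓕 f y = c / (Real.pi * (c ^ 2 + (y : ℂ) ^ 2)) := by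
    intro y
    rw [Real.fourier_real_eq_integral_exp_smul, ← setIntegral_univ, ← Iic_union_Ioi (a := (0 : ℝ)),
      setIntegral_union (by simp) measurableSet_Ioi (hint2 y) (hint1 y),
      ← setIntegral_congr_fun measurableSet_Iic (hIic y),
      ← setIntegral_congr_fun measurableSet_Ioi (hIoi y),
      integral_exp_mul_complex_Iic (hre2 y), integral_exp_mul_complex_Ioi (hre1 y)]
    have hm : c - I * y ≠ 0 := by
      intro h; have := congrArg Complex.re h; simp at this; exact hc.ne' this
    have hp : c + I * y ≠ 0 := by
      intro h; have := congrArg Complex.re h; simp at this; exact hc.ne' this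
    have : c ^ 2 + (y : ℂ) ^ 2 = (c + I * y) * (c - I * y) := by
      ring_nf; simp
    rw [this]
    simp only [ofReal_zero, mul_zero, Complex.exp_zero]
    field_simp
    ring
  have hFc : Continuous fun y : ℝ ↦ c / (Real.pi * (c ^ 2 + (y : ℂ) ^ 2)) :=
    continuous_const.div (by fun_prop) fun y ↦ mul_ne_zero hπ' (hne y)
  have hFi : Integrable (𝓕 f) := by
    rw [show 𝓕 f = fun y : ℝ ↦ c / (Real.pi * (c ^ 2 + (y : ℂ) ^ 2)) from funext hF]
    refine integrable_of_norm_le_inv_one_add_sq hFc (C := ‖c‖ / (Real.pi * k)) fun y ↦ ?_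
    rw [norm_div, norm_mul, Complex.norm_real, Real.norm_of_nonneg hπ.le, div_mul_eq_mul_div,
      ← div_eq_mul_inv, div_div, mul_comm (1 + y ^ 2), mul_assoc]
    gcongr
    exact hky y
  have hinv := congrFun (hfc.fourierInv_fourier_eq hfi hFi) (1 / Real.pi)
  rw [Real.fourierInv_eq'] at hinv
  have hlhs : (∫ v : ℝ, cexp (↑(2 * Real.pi * inner ℝ v (1 / Real.pi)) * I) • 𝓕 f v) =
      c / Real.pi * ∫ y : ℝ, cexp (2 * I * y) / (c ^ 2 + (y : ℂ) ^ 2) := by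
    rw [← integral_const_mul]
    refine integral_congr_ae (Filter.Eventually.of_forall fun y ↦ ?_)
    simp only [hF, smul_eq_mul]
    have h5 : (↑(2 * Real.pi * inner ℝ y (1 / Real.pi)) * I : ℂ) = 2 * I * y := by
      simp
      field_simp
    rw [h5]
    have := hne y
    field_simp
  rw [hlhs] at hinv
  have hfv : f (1 / Real.pi) = cexp (-2 * c) := by
    rw [hf]; simp only []
    rw [abs_of_pos (by positivity)]
    congr 1
    push_cast
    field_simp
  rw [hfv] at hinv
  rw [← hinv]
  field_simp

/-- Square roots of the right half-plane fill the sector |arg| < π/4. Two elements of this sector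
have a product with positive real part (`re_mul_pos`), which is what the closed form needs. -/
theorem exists_sq_eq_of_re_pos {a : ℂ} (ha : 0 < a.re) :
    ∃ w : ℂ, w ^ 2 = a ∧ 0 < w.re ∧ |w.im| < w.re := by
  obtain ⟨w, hw⟩ := IsAlgClosed.exists_pow_nat_eq a (n := 2) (by norm_num)
  have h1 : 0 < w.re ^ 2 - w.im ^ 2 := by
    rw [← hw, sq, Complex.mul_re] at ha; nlinarith
  rcases lt_trichotomy w.re 0 with h | h | h
  · exact ⟨-w, by rw [neg_sq, hw], by simpa using h, by
      simp only [neg_im, neg_re, abs_neg]; rw [abs_lt]; constructor <;> nlinarith⟩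
  · rw [h] at h1; nlinarith [sq_nonneg w.im]
  · exact ⟨w, hw, h, by rw [abs_lt]; constructor <;> nlinarith⟩

theorem re_mul_pos {p q : ℂ} (hp : |p.im| < p.re) (hq : |q.im| < q.re) : 0 < (p * q).re := by
  rw [Complex.mul_re]
  have h1 := abs_nonneg p.im
  have h2 := abs_nonneg q.im
  have h3 : p.im * q.im ≤ |p.im| * |q.im| := by rw [← abs_mul]; exact le_abs_self _
  nlinarith

theorem integrableOn_rpow_mul_exp_neg {a b : ℝ} (ha : -1 < a) (hb : 0 < b) :
    IntegrableOn (fun s : ℝ ↦ s ^ a * Real.exp (-b * s)) (Ioi 0) := by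
  simpa using integrableOn_rpow_mul_exp_neg_mul_rpow (p := 1) ha one_pos hb

/-- The integral of `s^{-1/2} e^{-p²s - q²/s}` over the half line. -/
theorem integral_rpow_neg_half_mul_exp {p q : ℂ} (hp : 0 < p.re) (hp' : |p.im| < p.re)
    (hq : 0 < q.re) (hq' : |q.im| < q.re) :
    ∫ s : ℝ in Ioi 0, ((s ^ (-(1 / 2) : ℝ) : ℝ) : ℂ) * cexp (-p ^ 2 * s - q ^ 2 / s) =
      Real.sqrt Real.pi / p * cexp (-2 * (p * q)) := by
  have hp0 : p ≠ 0 := by rintro rfl; simp at hp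
  have hq0 : q ≠ 0 := by rintro rfl; simp at hq
  have hpq := re_mul_pos hp' hq'
  have hpp : 0 < (p ^ 2).re := by rw [sq]; exact re_mul_pos hp' hp'
  have hqq : 0 < ((q ^ 2)⁻¹).re := by
    have h1 : 0 < (q ^ 2).re := by rw [sq]; exact re_mul_pos hq' hq'
    rw [Complex.inv_re]
    exact div_pos h1 (Complex.normSq_pos.2 (pow_ne_zero 2 hq0))
  set ρ : ℝ := ((q ^ 2)⁻¹).re with hρ
  have hsπ : (Real.sqrt Real.pi : ℂ) ≠ 0 := by
    exact_mod_cast (Real.sqrt_pos.2 Real.pi_pos).ne'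
  -- Integrating `G` in y, a Gaussian, produces √π q times the desired integrand; integrating it in
  -- s, an exponential, produces the Lorentzian with parameter pq. Fubini equates the two.
  set G : ℝ → ℝ → ℂ := fun s y ↦ cexp (-p ^ 2 * s) * (cexp (2 * I * y) *
    cexp (-(s * (q ^ 2)⁻¹) * (y : ℂ) ^ 2)) with hG
  have hre : ∀ s : ℝ, (s * (q ^ 2)⁻¹ : ℂ).re = s * ρ := fun s ↦ by simp [hρ]
  have hGnorm : ∀ s y : ℝ, ‖G s y‖ =
      Real.exp (-(p ^ 2).re * s) * Real.exp (-(s * ρ) * y ^ 2) := by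
    intro s y
    simp only [hG, norm_mul, Complex.norm_exp]
    have e1 : (-p ^ 2 * s : ℂ).re = -(p ^ 2).re * s := by
      rw [Complex.re_mul_ofReal, Complex.neg_re]
    have e2 : (2 * I * y : ℂ).re = 0 := by simp
    have e3 : (-(s * (q ^ 2)⁻¹) * (y : ℂ) ^ 2).re = -(s * ρ) * y ^ 2 := by
      rw [← Complex.ofReal_pow, Complex.re_mul_ofReal, Complex.neg_re, hre]
    rw [e1, e2, e3, Real.exp_zero, one_mul]
  have hGint : ∀ s : ℝ, 0 < s → Integrable (G s) := by
    intro s hs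
    have h3 : 0 < (s * (q ^ 2)⁻¹ : ℂ).re := by rw [hre]; positivity
    have h4 := integrable_cexp_quadratic (b := (s * (q ^ 2)⁻¹ : ℂ)) h3 (2 * I) 0
    refine (h4.const_mul (cexp (-p ^ 2 * s))).congr (Filter.Eventually.of_forall fun y ↦ ?_)
    simp only [hG]
    rw [← Complex.exp_add, ← Complex.exp_add, ← Complex.exp_add]
    congr 1; ring
  have hGmeas : Continuous (Function.uncurry G) := by
    simp only [hG, Function.uncurry_def]
    fun_prop
  have hGprod : Integrable (Function.uncurry G) ((volume.restrict (Ioi 0)).prod volume) := by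
    rw [integrable_prod_iff hGmeas.aestronglyMeasurable]
    constructor
    · exact (ae_restrict_iff' measurableSet_Ioi).2 (Filter.Eventually.of_forall fun s hs ↦
        hGint s hs)
    · have h5 := (integrableOn_rpow_mul_exp_neg (a := -(1 / 2)) (by norm_num) hpp).const_mul
        (Real.sqrt (Real.pi / ρ))
      refine h5.congr ((ae_restrict_iff' measurableSet_Ioi).2
        (Filter.Eventually.of_forall fun s hs ↦ ?_))
      have hs' : 0 < s := hs
      simp only [Function.uncurry_apply_pair, hGnorm]
      rw [integral_const_mul, integral_gaussian]
      have h6 : Real.sqrt (Real.pi / (s * ρ)) = Real.sqrt (Real.pi / ρ) * s ^ (-(1 / 2) : ℝ) := by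
        rw [mul_comm s, ← div_div, Real.sqrt_div (by positivity), Real.rpow_neg hs'.le,
          ← Real.sqrt_eq_rpow, div_eq_mul_inv]
      rw [h6]; ring
  have hinner : ∀ s : ℝ, 0 < s → ∫ y, G s y = Real.sqrt Real.pi * q *
      (((s ^ (-(1 / 2) : ℝ) : ℝ) : ℂ) * cexp (-p ^ 2 * s - q ^ 2 / s)) := by
    intro s hs
    have h3 : 0 < (s * (q ^ 2)⁻¹ : ℂ).re := by rw [hre]; positivity
    have h4 := fourierIntegral_gaussian h3 2
    have hs0 : (s : ℂ) ≠ 0 := by exact_mod_cast hs.ne'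
    have h5 : ((Real.pi : ℂ) / (s * (q ^ 2)⁻¹)) ^ (1 / 2 : ℂ) =
        Real.sqrt Real.pi * q * ((s ^ (-(1 / 2) : ℝ) : ℝ) : ℂ) := by
      have h6 : ((Real.pi : ℂ) / (s * (q ^ 2)⁻¹)) =
          (Real.sqrt Real.pi * q * ((s ^ (-(1 / 2) : ℝ) : ℝ) : ℂ)) ^ 2 := by
        rw [mul_pow, mul_pow, ← Complex.ofReal_pow, ← Complex.ofReal_pow,
          Real.sq_sqrt Real.pi_pos.le, ← Real.rpow_natCast (s ^ _), ← Real.rpow_mul hs.le]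
        norm_num
        rw [Real.rpow_neg_one]
        push_cast
        field_simp
      -- The principal branch of the square root is the right one because √π q s^{-1/2} has positive
      -- real part.
      rw [h6, show (1 / 2 : ℂ) = 2⁻¹ from one_div _, Complex.sq_cpow_two_inv]
      rw [Complex.re_mul_ofReal, Complex.re_ofReal_mul]
      have := Real.sqrt_pos.2 Real.pi_pos
      positivity
    simp only [hG]
    rw [integral_const_mul]
    have h7 : (∫ y : ℝ, cexp (2 * I * y) * cexp (-(s * (q ^ 2)⁻¹) * (y : ℂ) ^ 2)) =
        ∫ y : ℝ, cexp (I * 2 * y) * cexp (-(s * (q ^ 2)⁻¹) * (y : ℂ) ^ 2) := by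
      congr 1; ext y; ring_nf
    rw [h7, h4, h5]
    have h8 : cexp (-p ^ 2 * s - q ^ 2 / s) = cexp (-p ^ 2 * s) *
        cexp (-2 ^ 2 / (4 * (s * (q ^ 2)⁻¹))) := by
      rw [← Complex.exp_add]
      congr 1
      field_simp
      ring
    rw [h8]
    ring
  have houter : ∀ y : ℝ, ∫ s in Ioi (0 : ℝ), G s y =
      q ^ 2 * (cexp (2 * I * y) / ((p * q) ^ 2 + (y : ℂ) ^ 2)) := by
    intro y
    have h3 : (-(p ^ 2 + (q ^ 2)⁻¹ * (y : ℂ) ^ 2)).re < 0 := by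
      rw [Complex.neg_re, Complex.add_re, ← Complex.ofReal_pow, Complex.re_mul_ofReal]
      have : 0 ≤ ρ * y ^ 2 := by positivity
      rw [← hρ]; linarith
    have h4 := integral_exp_mul_complex_Ioi h3 0
    have h5 : ∀ s : ℝ, G s y = cexp (2 * I * y) *
        cexp (-(p ^ 2 + (q ^ 2)⁻¹ * (y : ℂ) ^ 2) * s) := by
      intro s
      simp only [hG]
      rw [← Complex.exp_add, ← Complex.exp_add, ← Complex.exp_add]
      congr 1; ring
    simp only [h5]
    rw [integral_const_mul, h4]
    have h6 : p ^ 2 + (q ^ 2)⁻¹ * (y : ℂ) ^ 2 ≠ 0 := by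
      intro h; rw [h] at h3; simp at h3
    have h7 : (p * q) ^ 2 + (y : ℂ) ^ 2 = q ^ 2 * (p ^ 2 + (q ^ 2)⁻¹ * (y : ℂ) ^ 2) := by
      field_simp
    rw [h7]
    simp only [ofReal_zero, mul_zero, Complex.exp_zero]
    field_simp
  have hswap := integral_integral_swap hGprod
  simp only [houter] at hswap
  rw [setIntegral_congr_fun measurableSet_Ioi (fun s hs ↦ hinner s hs), integral_const_mul,
    integral_const_mul, integral_exp_div_sq_add_sq hpq] at hswap
  have hpi : (Real.pi : ℂ) = Real.sqrt Real.pi * Real.sqrt Real.pi := by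
    rw [← Complex.ofReal_mul, Real.mul_self_sqrt Real.pi_pos.le]
  have h9 : (Real.sqrt Real.pi * q : ℂ) ≠ 0 := mul_ne_zero hsπ hq0
  apply mul_left_cancel₀ h9
  rw [hswap, hpi]
  field_simp

end BesselIntegrals

/-! ### Uniform bounds for Bessel-type integrals. -/

section BesselBounds

open FourierTransform Complex Set Filter

theorem integrableOn_rpow_mul_cexp {a : ℝ} (ha : -1 < a) {r : ℂ} (hr : 0 < r.re) :
    IntegrableOn (fun s : ℝ ↦ ((s ^ a : ℝ) : ℂ) * cexp (-r * s)) (Ioi 0) := by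
  refine (integrableOn_rpow_mul_exp_neg ha hr).mono' (by fun_prop) ?_
  refine (ae_restrict_iff' measurableSet_Ioi).2 (Eventually.of_forall fun s hs ↦ ?_)
  have hs' : (0 : ℝ) < s := hs
  rw [norm_mul, Complex.norm_real, Complex.norm_exp, Real.norm_of_nonneg (by positivity),
    Complex.re_mul_ofReal, Complex.neg_re]

/-- Integration by parts; s^a vanishes at 0 and the exponential at infinity. Two applications give
the decay ‖r‖⁻² in the next lemma, and this costs a > 1. -/
theorem integral_rpow_mul_cexp_eq {a : ℝ} (ha : 0 < a) {r : ℂ} (hr : 0 < r.re) :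
    ∫ s : ℝ in Ioi 0, ((s ^ a : ℝ) : ℂ) * cexp (-r * s) =
      a / r * ∫ s : ℝ in Ioi 0, ((s ^ (a - 1) : ℝ) : ℂ) * cexp (-r * s) := by
  have hr0 : r ≠ 0 := by rintro rfl; simp at hr
  have h1 : IntegrableOn (fun s : ℝ ↦ ((s ^ a : ℝ) : ℂ) * cexp (-r * s)) (Ioi 0) :=
    integrableOn_rpow_mul_cexp (by linarith) hr
  have h2 : IntegrableOn (fun s : ℝ ↦ ((s ^ (a - 1) : ℝ) : ℂ) * cexp (-r * s)) (Ioi 0) :=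
    integrableOn_rpow_mul_cexp (by linarith) hr
  have hnorm : ∀ s : ℝ, 0 ≤ s → ‖((s ^ a : ℝ) : ℂ) * (-cexp (-r * s) / r)‖ =
      s ^ a * Real.exp (-r.re * s) / ‖r‖ := by
    intro s hs
    rw [norm_mul, norm_div, norm_neg, Complex.norm_real, Complex.norm_exp,
      Real.norm_of_nonneg (by positivity), Complex.re_mul_ofReal, Complex.neg_re, mul_div_assoc]
  have key := integral_Ioi_mul_deriv_eq_deriv_mul (a := (0 : ℝ)) (a' := (0 : ℂ)) (b' := (0 : ℂ))
    (u := fun s : ℝ ↦ ((s ^ a : ℝ) : ℂ)) (u' := fun s : ℝ ↦ ((a * s ^ (a - 1) : ℝ) : ℂ))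
    (v := fun s : ℝ ↦ -cexp (-r * s) / r) (v' := fun s : ℝ ↦ cexp (-r * s))
    (fun s hs ↦ (Real.hasDerivAt_rpow_const (Or.inl (mem_Ioi.1 hs).ne')).ofReal_comp)
    (fun s _ ↦ by
      have h3 : HasDerivAt (fun s : ℝ ↦ -r * (s : ℂ)) (-r) s := by
        simpa using (Complex.ofRealCLM.hasDerivAt (x := s)).const_mul (-r)
      have h4 := (h3.cexp.neg.div_const r)
      convert! h4 using 1
      field_simp)
    h1
    (by
      refine IntegrableOn.congr_fun (f := fun s : ℝ ↦ (-a / r : ℂ) *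
        (((s ^ (a - 1) : ℝ) : ℂ) * cexp (-r * s))) (h2.const_mul _) (fun s _ ↦ ?_) measurableSet_Ioi
      simp only [Pi.mul_apply]; push_cast; ring)
    (by
      have h5 : Tendsto (fun s : ℝ ↦ ((s ^ a : ℝ) : ℂ) * (-cexp (-r * s) / r)) (nhds 0)
          (nhds ((((0 : ℝ) ^ a : ℝ) : ℂ) * (-cexp (-r * (0 : ℝ)) / r))) := by
        refine Continuous.tendsto (f := fun s : ℝ ↦ ((s ^ a : ℝ) : ℂ) * (-cexp (-r * s) / r)) ?_ 0
        have : Continuous fun s : ℝ ↦ s ^ a := Real.continuous_rpow_const ha.le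
        fun_prop
      rw [Real.zero_rpow ha.ne', Complex.ofReal_zero, zero_mul] at h5
      exact h5.mono_left nhdsWithin_le_nhds)
    (by
      rw [tendsto_zero_iff_norm_tendsto_zero]
      have h6 := (tendsto_rpow_mul_exp_neg_mul_atTop_nhds_zero a r.re hr).div_const ‖r‖
      rw [zero_div] at h6
      refine h6.congr' ?_
      filter_upwards [eventually_ge_atTop 0] with s hs
      exact (hnorm s hs).symm)
  rw [key, sub_self, zero_sub, ← integral_neg, ← integral_const_mul]
  refine integral_congr_ae (Eventually.of_forall fun s ↦ ?_)
  simp only []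
  push_cast
  field_simp

theorem norm_integral_rpow_mul_cexp_le {a : ℝ} (ha : 1 < a) {r : ℂ} (hr : 0 < r.re) :
    ‖∫ s : ℝ in Ioi 0, ((s ^ a : ℝ) : ℂ) * cexp (-r * s)‖ ≤
      a * (a - 1) * (∫ s : ℝ in Ioi 0, s ^ (a - 2) * Real.exp (-r.re * s)) / ‖r‖ ^ 2 := by
  rw [integral_rpow_mul_cexp_eq (by linarith) hr, integral_rpow_mul_cexp_eq (by linarith) hr,
    norm_mul, norm_mul, norm_div, norm_div, Complex.norm_real, Complex.norm_real,
    Real.norm_of_nonneg (by linarith), Real.norm_of_nonneg (by linarith)]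
  have h1 : ‖∫ s : ℝ in Ioi 0, ((s ^ (a - 1 - 1) : ℝ) : ℂ) * cexp (-r * s)‖ ≤
      ∫ s : ℝ in Ioi 0, s ^ (a - 2) * Real.exp (-r.re * s) := by
    refine (norm_integral_le_integral_norm _).trans (le_of_eq ?_)
    refine setIntegral_congr_fun measurableSet_Ioi fun s hs ↦ ?_
    have hs' : (0 : ℝ) < s := hs
    rw [norm_mul, Complex.norm_real, Complex.norm_exp, Real.norm_of_nonneg (by positivity),
      Complex.re_mul_ofReal, Complex.neg_re, sub_sub]
    norm_num
  calc a / ‖r‖ * ((a - 1) / ‖r‖ * _) ≤ a / ‖r‖ * ((a - 1) / ‖r‖ *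
        ∫ s : ℝ in Ioi 0, s ^ (a - 2) * Real.exp (-r.re * s)) := by
        gcongr
    _ = _ := by ring

/-- `s^μ e^{-s/2}` on the half line is a superposition of characters with an integrable density. -/
theorem exists_integrable_fourier_rpow_mul_exp {μ : ℝ} (hμ : 1 < μ) :
    ∃ G : ℝ → ℂ, Integrable G ∧ ∀ s : ℝ, 0 < s →
      ∫ y : ℝ, G y * cexp (2 * Real.pi * I * y * s) = ((s ^ μ * Real.exp (-s / 2) : ℝ) : ℂ) := by
  have hπ := Real.pi_pos
  set g : ℝ → ℂ := fun s ↦ ((max s 0 ^ μ * Real.exp (-s / 2) : ℝ) : ℂ) with hg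
  have hgc : Continuous g := by
    have : Continuous fun s : ℝ ↦ s ^ μ := Real.continuous_rpow_const (by linarith)
    have h2 : Continuous fun s : ℝ ↦ max s 0 ^ μ := this.comp (by fun_prop)
    simp only [hg]
    fun_prop
  have hg0 : ∀ s ∈ Iic (0 : ℝ), g s = 0 := by
    intro s hs
    simp only [hg, max_eq_right (mem_Iic.1 hs)]
    rw [Real.zero_rpow (by linarith)]; simp
  have hgpos : ∀ s ∈ Ioi (0 : ℝ), g s = ((s ^ μ : ℝ) : ℂ) * cexp (-(1 / 2 : ℂ) * s) := by
    intro s hs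
    simp only [hg, max_eq_left (mem_Ioi.1 hs).le]
    push_cast
    congr 2; ring
  have hgi : Integrable g := by
    have h1 : IntegrableOn g (Iic 0) := (integrableOn_zero).congr_fun
      (fun s hs ↦ (hg0 s hs).symm) measurableSet_Iic
    have h2 : IntegrableOn g (Ioi 0) := (integrableOn_rpow_mul_cexp (a := μ) (by linarith)
      (r := 1 / 2) (by norm_num)).congr_fun (fun s hs ↦ (hgpos s hs).symm) measurableSet_Ioi
    have h3 := h1.union h2
    rwa [Iic_union_Ioi, integrableOn_univ] at h3
  have hF : ∀ y : ℝ, 𝓕 g y = ∫ s : ℝ in Ioi 0, ((s ^ μ : ℝ) : ℂ) *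
      cexp (-(1 / 2 + 2 * Real.pi * y * I : ℂ) * s) := by
    intro y
    rw [Real.fourier_real_eq_integral_exp_smul]
    rw [← setIntegral_eq_integral_of_forall_compl_eq_zero (s := Ioi 0)]
    · refine setIntegral_congr_fun measurableSet_Ioi fun s hs ↦ ?_
      simp only [hgpos s hs, smul_eq_mul]
      rw [mul_left_comm, ← Complex.exp_add]
      congr 2; push_cast; ring
    · intro s hs
      rw [hg0 s (by simpa using hs), smul_zero]
  have hFcont : Continuous (𝓕 g) :=
    VectorFourier.fourierIntegral_continuous Real.continuous_fourierChar
      (by exact continuous_inner) hgi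
  -- Two integrations by parts give decay like |1/2 + 2πiy|⁻², and |1/2 + 2πiy|² ≥ (1 + y²)/4
  -- accounts for the factor 4.
  have hFi : Integrable (𝓕 g) := by
    refine integrable_of_norm_le_inv_one_add_sq hFcont
      (C := 4 * (μ * (μ - 1) * ∫ s : ℝ in Ioi 0, s ^ (μ - 2) * Real.exp (-(1 / 2) * s))) fun y ↦ ?_
    have hre : (1 / 2 + 2 * Real.pi * y * I : ℂ).re = 1 / 2 := by simp
    have h1 := norm_integral_rpow_mul_cexp_le hμ (r := (1 / 2 + 2 * Real.pi * y * I : ℂ))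
      (by rw [hre]; norm_num)
    rw [hF]
    refine h1.trans ?_
    rw [hre]
    have h2 : (1 + y ^ 2) / 4 ≤ ‖(1 / 2 + 2 * Real.pi * y * I : ℂ)‖ ^ 2 := by
      rw [Complex.sq_norm, Complex.normSq_apply]
      have him : (1 / 2 + 2 * Real.pi * y * I : ℂ).im = 2 * Real.pi * y := by simp
      rw [hre, him]
      nlinarith [Real.pi_gt_three, sq_nonneg y, mul_pos hπ hπ,
        mul_nonneg (sub_nonneg.2 Real.pi_gt_three.le) (sq_nonneg y),
        mul_nonneg (mul_pos hπ hπ).le (sq_nonneg y)]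
    set Z := μ * (μ - 1) * ∫ s : ℝ in Ioi 0, s ^ (μ - 2) * Real.exp (-(1 / 2) * s) with hZ
    have hZ0 : 0 ≤ Z := by
      have : 0 ≤ ∫ s : ℝ in Ioi 0, s ^ (μ - 2) * Real.exp (-(1 / 2) * s) :=
        setIntegral_nonneg measurableSet_Ioi fun s hs ↦ by
          have : (0 : ℝ) < s := hs
          positivity
      have h5 : 0 ≤ μ - 1 := by linarith
      positivity
    calc Z / _ ≤ Z / ((1 + y ^ 2) / 4) := by gcongr
      _ = 4 * Z * (1 + y ^ 2)⁻¹ := by field_simp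
  refine ⟨𝓕 g, hFi, fun s hs ↦ ?_⟩
  have hinv := congrFun (hgc.fourierInv_fourier_eq hgi hFi) s
  rw [Real.fourierInv_eq'] at hinv
  have : g s = ((s ^ μ * Real.exp (-s / 2) : ℝ) : ℂ) := by
    simp only [hg, max_eq_left hs.le]
  rw [← this, ← hinv]
  refine integral_congr_ae (Eventually.of_forall fun y ↦ ?_)
  simp only [smul_eq_mul]
  rw [mul_comm]
  congr 2
  simp
  ring

/-- The substitution s ↦ 1/s exchanges `a` and `b` and turns s^{-3/2} into s^{-1/2}, which is
integrable at 0 without help from the exponential. -/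
theorem integrableOn_rpow_mul_cexp_inv {a b : ℂ} (ha : 0 < a.re) (hb : 0 < b.re) :
    IntegrableOn (fun s : ℝ ↦ ((s ^ (-(3 / 2) : ℝ) : ℝ) : ℂ) * cexp (-a * s - b / s)) (Ioi 0) := by
  have h1 : IntegrableOn (fun s : ℝ ↦ ((s ^ (-(1 / 2) : ℝ) : ℝ) : ℂ) * cexp (-b * s - a / s))
      (Ioi 0) := by
    refine (integrableOn_rpow_mul_exp_neg (a := -(1 / 2)) (by norm_num) hb).mono'
      (Measurable.aestronglyMeasurable (by fun_prop)) ?_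
    refine (ae_restrict_iff' measurableSet_Ioi).2 (Eventually.of_forall fun s hs ↦ ?_)
    have hs' : (0 : ℝ) < s := hs
    rw [norm_mul, Complex.norm_real, Complex.norm_exp, Real.norm_of_nonneg (by positivity)]
    gcongr
    rw [Complex.sub_re, Complex.re_mul_ofReal, Complex.neg_re, Complex.div_ofReal_re]
    have : 0 ≤ a.re / s := by positivity
    linarith
  rw [← integrableOn_Ioi_comp_rpow_iff _ (p := -1) (by norm_num)] at h1
  refine h1.congr_fun (fun s hs ↦ ?_) measurableSet_Ioi
  have hs' : (0 : ℝ) < s := hs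
  have hs0 : (s : ℂ) ≠ 0 := by exact_mod_cast hs'.ne'
  simp only [abs_neg, abs_one, one_mul, Complex.real_smul]
  rw [← mul_assoc, ← Complex.ofReal_mul, ← Real.rpow_mul hs'.le, ← Real.rpow_add hs',
    Real.rpow_neg_one]
  congr 2
  · congr 2; norm_num
  · push_cast; field_simp; ring

/-- After s ↦ 1/s the closed form is (√π/p) e^{-2pq} with p² = b and q² = a, and the exponential has
modulus at most 1. The bound does not involve `a` at all, so `a` may later be shifted along the
imaginary axis. -/
theorem norm_integral_rpow_mul_cexp_inv_le {a b : ℂ} (ha : 0 < a.re) (hb : 0 < b.re) :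
    ‖∫ s : ℝ in Ioi 0, ((s ^ (-(3 / 2) : ℝ) : ℝ) : ℂ) * cexp (-a * s - b / s)‖ ≤
      Real.sqrt Real.pi * ‖b‖ ^ (-(1 / 2) : ℝ) := by
  obtain ⟨p, hp, hp0, hp'⟩ := exists_sq_eq_of_re_pos hb
  obtain ⟨q, hq, hq0, hq'⟩ := exists_sq_eq_of_re_pos ha
  have h1 := integral_rpow_neg_half_mul_exp hp0 hp' hq0 hq'
  rw [← integral_comp_rpow_Ioi _ (p := -1) (by norm_num)] at h1
  have h2 : ∫ s : ℝ in Ioi 0, ((s ^ (-(3 / 2) : ℝ) : ℝ) : ℂ) * cexp (-a * s - b / s) =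
      Real.sqrt Real.pi / p * cexp (-2 * (p * q)) := by
    rw [← h1]
    refine setIntegral_congr_fun measurableSet_Ioi fun s hs ↦ ?_
    have hs' : (0 : ℝ) < s := hs
    have hs0 : (s : ℂ) ≠ 0 := by exact_mod_cast hs'.ne'
    simp only [abs_neg, abs_one, one_mul, Complex.real_smul, hp, hq]
    rw [← mul_assoc, ← Complex.ofReal_mul, ← Real.rpow_mul hs'.le, ← Real.rpow_add hs',
      Real.rpow_neg_one]
    congr 2
    · congr 2; norm_num
    · push_cast; field_simp; ring
  rw [h2, norm_mul, norm_div, Complex.norm_real, Complex.norm_exp,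
    Real.norm_of_nonneg (Real.sqrt_nonneg _)]
  have hpn : ‖b‖ ^ (-(1 / 2) : ℝ) = ‖p‖⁻¹ := by
    rw [← hp, norm_pow, ← Real.rpow_natCast, ← Real.rpow_mul (norm_nonneg _)]
    norm_num
    rw [Real.rpow_neg_one]
  have hexp : Real.exp (-2 * (p * q)).re ≤ 1 := by
    rw [Real.exp_le_one_iff]
    have : (-2 * (p * q)).re = -2 * (p * q).re := by simp
    rw [this]
    linarith [re_mul_pos hp' hq']
  rw [hpn]
  calc Real.sqrt Real.pi / ‖p‖ * Real.exp (-2 * (p * q)).re ≤ Real.sqrt Real.pi / ‖p‖ * 1 := by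
        gcongr
    _ = _ := by rw [mul_one, div_eq_mul_inv]

/-- Oscillatory bound: the half-power gain in `‖β‖` is uniform in the imaginary part of `α`. -/
theorem exists_norm_integral_rpow_cexp_le {μ : ℝ} (hμ : 1 < μ) :
    ∃ C : ℝ, ∀ (ε : ℝ) (α β : ℂ), 0 < ε → ε ≤ α.re → 0 < β.re →
      ‖∫ s : ℝ in Ioi 0, ((s ^ (μ - 3 / 2) : ℝ) : ℂ) * cexp (-α * s - β / s)‖ ≤
        C * ε ^ (-μ) * ‖β‖ ^ (-(1 / 2) : ℝ) := by
  obtain ⟨G, hG, hGs⟩ := exists_integrable_fourier_rpow_mul_exp hμ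
  refine ⟨(∫ y, ‖G y‖) * Real.sqrt Real.pi, fun ε α β hε hα hβ ↦ ?_⟩
  -- Split s^μ e^{-αs} = ε^{-μ} · (εs)^μ e^{-εs/2} · e^{-(α-ε/2)s}. The middle factor is a
  -- superposition of characters e^{2πiyεs} with integrable density, and each character only shifts
  -- the imaginary part of α. What remains is the s^{-3/2} integral, bounded independently of y.
  set k : ℝ → ℂ := fun s ↦ ((s ^ (-(3 / 2) : ℝ) : ℝ) : ℂ) * cexp (-(α - ε / 2) * s - β / s) with hk
  have hare : 0 < (α - ε / 2 : ℂ).re := by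
    have : (α - ε / 2 : ℂ).re = α.re - ε / 2 := by simp
    rw [this]; linarith
  have hki : IntegrableOn k (Ioi 0) := integrableOn_rpow_mul_cexp_inv hare hβ
  set H : ℝ → ℝ → ℂ := fun s y ↦ cexp (2 * Real.pi * I * y * (ε * s)) * (k s * G y) with hH
  have hHi : Integrable (Function.uncurry H) ((volume.restrict (Ioi 0)).prod volume) := by
    have h1 : Integrable (fun z : ℝ × ℝ ↦ k z.1 * G z.2)
        ((volume.restrict (Ioi 0)).prod volume) := hki.mul_prod hG
    refine h1.bdd_mul (c := 1) (f := fun z : ℝ × ℝ ↦ cexp (2 * Real.pi * I * z.2 * (ε * z.1)))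
      (Continuous.aestronglyMeasurable (by fun_prop)) (Eventually.of_forall fun z ↦ ?_)
    rw [Complex.norm_exp]
    simp
  have hinner : ∀ s ∈ Ioi (0 : ℝ), ∫ y, H s y =
      ((ε ^ μ : ℝ) : ℂ) * (((s ^ (μ - 3 / 2) : ℝ) : ℂ) * cexp (-α * s - β / s)) := by
    intro s hs
    have hs' : (0 : ℝ) < s := hs
    have h1 : ∀ y : ℝ, H s y = k s * (G y * cexp (2 * Real.pi * I * y * ((ε * s : ℝ) : ℂ))) := by
      intro y; simp only [hH]; push_cast; ring
    simp only [h1]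
    rw [integral_const_mul, hGs _ (by positivity), Real.mul_rpow hε.le hs'.le]
    simp only [hk]
    have h2 : (s ^ μ * s ^ (-(3 / 2) : ℝ) : ℝ) = s ^ (μ - 3 / 2) := by
      rw [← Real.rpow_add hs']; congr 1
    have h3 : cexp (-α * s - β / s) = cexp (-(α - ε / 2) * s - β / s) *
        ((Real.exp (-(ε * s) / 2) : ℝ) : ℂ) := by
      rw [Complex.ofReal_exp, ← Complex.exp_add]
      congr 1; push_cast; ring
    rw [h3, ← h2]
    push_cast
    ring
  have houter : ∀ y : ℝ, ‖∫ s in Ioi (0 : ℝ), H s y‖ ≤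
      ‖G y‖ * (Real.sqrt Real.pi * ‖β‖ ^ (-(1 / 2) : ℝ)) := by
    intro y
    set α' : ℂ := α - ε / 2 - 2 * Real.pi * I * y * ε with hα'
    have hre : 0 < α'.re := by
      have : α'.re = (α - ε / 2 : ℂ).re := by simp [hα']
      rw [this]; exact hare
    have h1 : ∀ s : ℝ, H s y = G y * (((s ^ (-(3 / 2) : ℝ) : ℝ) : ℂ) * cexp (-α' * s - β / s)) := by
      intro s
      have : cexp (-α' * s - β / s) = cexp (2 * Real.pi * I * y * (ε * s)) *
          cexp (-(α - ε / 2) * s - β / s) := by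
        rw [← Complex.exp_add]; congr 1; rw [hα']; ring
      simp only [hH, hk]
      rw [this]; ring
    simp only [h1]
    rw [integral_const_mul, norm_mul]
    gcongr
    exact norm_integral_rpow_mul_cexp_inv_le hre hβ
  have hswap := integral_integral_swap hHi
  rw [setIntegral_congr_fun measurableSet_Ioi hinner, integral_const_mul] at hswap
  have hle : ‖∫ y : ℝ, ∫ s in Ioi (0 : ℝ), H s y‖ ≤
      (∫ y, ‖G y‖) * (Real.sqrt Real.pi * ‖β‖ ^ (-(1 / 2) : ℝ)) := by
    rw [← integral_mul_const]
    exact norm_integral_le_of_norm_le (hG.norm.mul_const _) (Eventually.of_forall houter)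
  rw [← hswap, norm_mul, Complex.norm_real, Real.norm_of_nonneg (by positivity)] at hle
  have hεμ : 0 < ε ^ μ := by positivity
  rw [← le_div_iff₀' hεμ] at hle
  refine hle.trans (le_of_eq ?_)
  rw [Real.rpow_neg hε.le]
  field_simp

/-- The trivial bound for the same integral. -/
theorem exists_norm_integral_rpow_cexp_le' {ν : ℝ} (hν : -1 < ν) :
    ∃ C : ℝ, ∀ (ε : ℝ) (α β : ℂ), 0 < ε → ε ≤ α.re → 0 < β.re →
      ‖∫ s : ℝ in Ioi 0, ((s ^ ν : ℝ) : ℂ) * cexp (-α * s - β / s)‖ ≤ C * ε ^ (-(ν + 1)) := by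
  refine ⟨Real.Gamma (ν + 1), fun ε α β hε hα hβ ↦ ?_⟩
  have h1 := Real.integral_rpow_mul_exp_neg_mul_Ioi (a := ν + 1) (r := ε) (by linarith) hε
  have h2 := integrableOn_rpow_mul_exp_neg hν hε
  have h3 : ‖∫ s : ℝ in Ioi 0, ((s ^ ν : ℝ) : ℂ) * cexp (-α * s - β / s)‖ ≤
      ∫ s : ℝ in Ioi 0, s ^ ν * Real.exp (-ε * s) := by
    refine norm_integral_le_of_norm_le h2 ?_
    refine (ae_restrict_iff' measurableSet_Ioi).2 (Eventually.of_forall fun s hs ↦ ?_)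
    have hs' : (0 : ℝ) < s := hs
    rw [norm_mul, Complex.norm_real, Complex.norm_exp, Real.norm_of_nonneg (by positivity)]
    gcongr
    rw [Complex.sub_re, Complex.re_mul_ofReal, Complex.neg_re, Complex.div_ofReal_re]
    have : 0 ≤ β.re / s := by positivity
    nlinarith
  refine h3.trans (le_of_eq ?_)
  simp only [add_sub_cancel_right] at h1
  rw [Real.rpow_neg hε.le, mul_comm, ← Real.inv_rpow hε.le, ← one_div, ← h1]
  simp

end BesselBounds

/-! ### The kernel of e^{-zω} by subordination. -/

section PoissonKernel

open FourierTransform Complex Set Filter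

theorem omega_sq {n : ℕ} (ξ : EuclideanSpace ℝ (Fin n)) : omega ξ ^ 2 = 1 + ‖ξ‖ ^ 2 := by
  rw [omega, ← Real.sqrt_eq_rpow, Real.sq_sqrt (by positivity)]

theorem one_le_omega {n : ℕ} (ξ : EuclideanSpace ℝ (Fin n)) : 1 ≤ omega ξ := by
  rw [omega]
  exact Real.one_le_rpow (by nlinarith [sq_nonneg ‖ξ‖]) (by norm_num)

theorem norm_le_omega {n : ℕ} (ξ : EuclideanSpace ℝ (Fin n)) : ‖ξ‖ ≤ omega ξ := by
  have h1 := one_le_omega ξ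
  refine abs_le_of_sq_le_sq' ?_ (by linarith) |>.2
  rw [omega_sq]; linarith

/-- The symbol of the analytic semigroup `e^{-zω}` in Mathlib's frequency variable. -/
noncomputable def semigroupSymbol {n : ℕ} (z : ℂ) (η : EuclideanSpace ℝ (Fin n)) : ℂ :=
  cexp (-z * omega ((2 * Real.pi) • η))

/-- The integrand in the subordination of `e^{-zω}` to the heat semigroup. -/
noncomputable def subordinationIntegrand {n : ℕ} (z : ℂ) (s : ℝ) (η : EuclideanSpace ℝ (Fin n)) :
    ℂ :=
  ((s ^ (-(1 / 2) : ℝ) : ℝ) : ℂ) * cexp (-(z / 4) * s - z / s) *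
    cexp (-(4 * Real.pi ^ 2 * z / s) * (‖η‖ : ℂ) ^ 2)

theorem cpow_ofReal_mul {s : ℝ} (hs : 0 < s) {z : ℂ} (hz : z ≠ 0) (a : ℝ) :
    ((s : ℂ) * z) ^ (a : ℂ) = ((s ^ a : ℝ) : ℂ) * z ^ (a : ℂ) := by
  have hs0 : (s : ℂ) ≠ 0 := by exact_mod_cast hs.ne'
  rw [Complex.cpow_def_of_ne_zero (mul_ne_zero hs0 hz), Complex.log_ofReal_mul hs hz,
    Complex.cpow_def_of_ne_zero hz, Real.rpow_def_of_pos hs, add_mul, Complex.exp_add]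
  push_cast
  rfl

/-- The closed form with p = w/2 and q = wω: then 2pq = zω, while q²/s = zω²/s is quadratic in the
frequency. The heat time z/s runs along the ray through z, so the formula holds in the whole
half-plane Re z > 0. -/
theorem semigroupSymbol_eq_integral {n : ℕ} {z w : ℂ} (hw : w ^ 2 = z) (hw0 : 0 < w.re)
    (hw' : |w.im| < w.re) (η : EuclideanSpace ℝ (Fin n)) :
    semigroupSymbol z η =
      w / (2 * Real.sqrt Real.pi) * ∫ s in Ioi (0 : ℝ), subordinationIntegrand z s η := by
  set ξ := (2 * Real.pi) • η with hξ
  have hω := one_le_omega ξ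
  have hw0' : w ≠ 0 := by rintro rfl; simp at hw0
  have hsπ : (Real.sqrt Real.pi : ℂ) ≠ 0 := by
    exact_mod_cast (Real.sqrt_pos.2 Real.pi_pos).ne'
  have hp : 0 < (w / 2).re := by simpa using hw0
  have hp' : |(w / 2).im| < (w / 2).re := by
    have h1 : (w / 2).im = w.im / 2 := by simp
    have h2 : (w / 2).re = w.re / 2 := by simp
    rw [h1, h2, abs_div, abs_of_pos (by norm_num : (0 : ℝ) < 2)]
    linarith
  have hq : 0 < (w * omega ξ).re := by
    rw [Complex.re_mul_ofReal]; positivity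
  have hq' : |(w * omega ξ).im| < (w * omega ξ).re := by
    rw [Complex.re_mul_ofReal, Complex.im_mul_ofReal, abs_mul, abs_of_pos (by linarith : 0 < omega ξ)]
    gcongr
  have key := integral_rpow_neg_half_mul_exp hp hp' hq hq'
  have h1 : ∫ s in Ioi (0 : ℝ), subordinationIntegrand z s η =
      Real.sqrt Real.pi / (w / 2) * cexp (-2 * (w / 2 * (w * omega ξ))) := by
    rw [← key]
    refine setIntegral_congr_fun measurableSet_Ioi fun s hs ↦ ?_
    have hs0 : (s : ℂ) ≠ 0 := by exact_mod_cast (mem_Ioi.1 hs).ne'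
    simp only [subordinationIntegrand]
    rw [mul_assoc, ← Complex.exp_add]
    congr 2
    have h2 : (omega ξ : ℂ) ^ 2 = 1 + 4 * Real.pi ^ 2 * (‖η‖ : ℂ) ^ 2 := by
      have h3 := omega_sq ξ
      have h4 : ‖ξ‖ = 2 * Real.pi * ‖η‖ := by
        rw [hξ, norm_smul, Real.norm_of_nonneg (by positivity)]
      rw [h4] at h3
      have h5 := congrArg (fun r : ℝ ↦ (r : ℂ)) h3
      push_cast at h5
      rw [h5]; ring
    rw [mul_pow, h2, div_pow, hw]
    field_simp
    ring
  rw [h1, semigroupSymbol, ← hξ]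
  have h3 : -2 * (w / 2 * (w * omega ξ)) = -z * omega ξ := by rw [← hw]; ring
  rw [h3]
  field_simp

theorem norm_subordinationIntegrand {n : ℕ} (z : ℂ) {s : ℝ} (hs : 0 < s)
    (η : EuclideanSpace ℝ (Fin n)) : ‖subordinationIntegrand z s η‖ =
      s ^ (-(1 / 2) : ℝ) * Real.exp (-(z.re / 4) * s - z.re / s) *
        Real.exp (-(4 * Real.pi ^ 2 * z.re / s) * ‖η‖ ^ 2) := by
  rw [subordinationIntegrand, norm_mul, norm_mul, Complex.norm_real, Complex.norm_exp,
    Complex.norm_exp, Real.norm_of_nonneg (by positivity)]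
  congr 2
  · rw [Complex.sub_re, Complex.re_mul_ofReal, Complex.neg_re, Complex.div_ofReal_re]
    simp
  · have h1 : (-(4 * Real.pi ^ 2 * z / s) * (‖η‖ : ℂ) ^ 2) =
        ((4 * Real.pi ^ 2 / s * ‖η‖ ^ 2 : ℝ) : ℂ) * (-z) := by push_cast; ring
    rw [h1, Complex.re_ofReal_mul, Complex.neg_re]
    ring

/-- The Gaussian integral in η contributes s^{n/2}, which leaves s^{(n-1)/2} e^{-(Re z/4)s},
integrable on the half line. -/
theorem integrable_subordinationIntegrand {n : ℕ} {z : ℂ} (hz : 0 < z.re) :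
    Integrable (Function.uncurry (subordinationIntegrand (n := n) z))
      ((volume.restrict (Ioi 0)).prod volume) := by
  have hmeas : Measurable (Function.uncurry (subordinationIntegrand (n := n) z)) := by
    simp only [Function.uncurry_def, subordinationIntegrand]
    fun_prop
  rw [integrable_prod_iff hmeas.aestronglyMeasurable]
  constructor
  · refine (ae_restrict_iff' measurableSet_Ioi).2 (Eventually.of_forall fun s hs ↦ ?_)
    have hs' : (0 : ℝ) < s := hs
    simp only [Function.uncurry_apply_pair, subordinationIntegrand]
    have hb : 0 < (4 * Real.pi ^ 2 * z / s : ℂ).re := by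
      have h1 : (4 * Real.pi ^ 2 * z / s : ℂ) = ((4 * Real.pi ^ 2 / s : ℝ) : ℂ) * z := by
        push_cast; ring
      rw [h1, Complex.re_ofReal_mul]
      have := Real.pi_pos
      positivity
    have h2 := GaussianFourier.integrable_cexp_neg_mul_sq_norm_add hb 0
      (0 : EuclideanSpace ℝ (Fin n))
    simp only [zero_mul, add_zero] at h2
    exact h2.const_mul _
  · have hnn : (-1 : ℝ) < (n - 1) / 2 := by
      have : (0 : ℝ) ≤ n := n.cast_nonneg
      linarith
    have h5 := (integrableOn_rpow_mul_exp_neg hnn (b := z.re / 4) (by positivity)).const_mul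
      ((4 * Real.pi * z.re)⁻¹ ^ (n / 2 : ℝ))
    refine h5.mono' ?_ ?_
    · exact (hmeas.norm.stronglyMeasurable.integral_prod_right').aestronglyMeasurable
    · refine (ae_restrict_iff' measurableSet_Ioi).2 (Eventually.of_forall fun s hs ↦ ?_)
      have hs' : (0 : ℝ) < s := hs
      have hπ := Real.pi_pos
      simp only [Function.uncurry_apply_pair, norm_subordinationIntegrand z hs']
      rw [integral_const_mul, GaussianFourier.integral_rexp_neg_mul_sq_norm (by positivity),
        finrank_euclideanSpace_fin, Real.norm_of_nonneg (by positivity)]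
      have h6 : Real.pi / (4 * Real.pi ^ 2 * z.re / s) = s * (4 * Real.pi * z.re)⁻¹ := by
        field_simp
      rw [h6, Real.mul_rpow hs'.le (by positivity)]
      have h7 : s ^ (-(1 / 2) : ℝ) * s ^ (n / 2 : ℝ) = s ^ ((n - 1) / 2 : ℝ) := by
        rw [← Real.rpow_add hs']; congr 1; ring
      rw [← h7]
      have h8 : Real.exp (-(z.re / 4) * s - z.re / s) ≤ Real.exp (-(z.re / 4) * s) := by
        gcongr
        exact sub_le_self _ (by positivity)
      calc _ = s ^ (-(1 / 2) : ℝ) * s ^ (n / 2 : ℝ) * (4 * Real.pi * z.re)⁻¹ ^ (n / 2 : ℝ) *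
            Real.exp (-(z.re / 4) * s - z.re / s) := by ring
        _ ≤ s ^ (-(1 / 2) : ℝ) * s ^ (n / 2 : ℝ) * (4 * Real.pi * z.re)⁻¹ ^ (n / 2 : ℝ) *
            Real.exp (-(z.re / 4) * s) := by gcongr
        _ = _ := by ring

theorem integrable_semigroupSymbol {n : ℕ} {z : ℂ} (hz : 0 < z.re) :
    Integrable (semigroupSymbol (n := n) z) := by
  obtain ⟨w, hw, hw0, hw'⟩ := exists_sq_eq_of_re_pos hz
  rw [show semigroupSymbol (n := n) z = _ from funext (semigroupSymbol_eq_integral hw hw0 hw')]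
  exact (integrable_subordinationIntegrand hz).integral_prod_right.const_mul _

/-- Fubini and the Fourier transform of a Gaussian. The position x enters only through α = z/4 +
|x|²/(4z), whose real part is at least Re z/4; bounds that use α through Re α alone are therefore
uniform in x. -/
theorem fourierInv_semigroupSymbol {n : ℕ} {z w : ℂ} (hz : 0 < z.re) (hw : w ^ 2 = z)
    (hw0 : 0 < w.re) (hw' : |w.im| < w.re) (x : EuclideanSpace ℝ (Fin n)) :
    𝓕⁻ (semigroupSymbol z) x = w / (2 * Real.sqrt Real.pi) *
      ((4 * Real.pi * z)⁻¹ ^ ((n / 2 : ℝ) : ℂ) * ∫ s in Ioi (0 : ℝ),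
        ((s ^ ((n - 1) / 2 : ℝ) : ℝ) : ℂ) *
          cexp (-(z / 4 + (‖x‖ : ℂ) ^ 2 / (4 * z)) * s - z / s)) := by
  have hz0 : z ≠ 0 := by rintro rfl; simp at hz
  have hπ := Real.pi_pos
  have hπ0 : (Real.pi : ℂ) ≠ 0 := by exact_mod_cast hπ.ne'
  set H : ℝ → EuclideanSpace ℝ (Fin n) → ℂ := fun s η ↦
    (Real.fourierChar (inner ℝ η x) : ℂ) * subordinationIntegrand z s η with hH
  have hHi : Integrable (Function.uncurry H) ((volume.restrict (Ioi 0)).prod volume) := by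
    refine (integrable_subordinationIntegrand (n := n) hz).bdd_mul (c := 1)
      (f := fun p : ℝ × EuclideanSpace ℝ (Fin n) ↦ (Real.fourierChar (inner ℝ p.2 x) : ℂ))
      (Continuous.aestronglyMeasurable ?_) (Eventually.of_forall fun p ↦ (Circle.norm_coe _).le)
    exact continuous_subtype_val.comp
      (Real.continuous_fourierChar.comp (continuous_snd.inner continuous_const))
  have h1 : 𝓕⁻ (semigroupSymbol z) x =
      ∫ η, ∫ s in Ioi (0 : ℝ), w / (2 * Real.sqrt Real.pi) * H s η := by
    rw [Real.fourierInv_eq]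
    refine integral_congr_ae (Eventually.of_forall fun η ↦ ?_)
    simp only [hH, Circle.smul_def, smul_eq_mul]
    rw [semigroupSymbol_eq_integral hw hw0 hw', integral_const_mul, integral_const_mul]
    ring
  rw [h1]
  simp only [integral_const_mul]
  congr 1
  rw [← integral_integral_swap hHi, ← integral_const_mul]
  refine setIntegral_congr_fun measurableSet_Ioi fun s hs ↦ ?_
  have hs' : (0 : ℝ) < s := hs
  have hs0 : (s : ℂ) ≠ 0 := by exact_mod_cast hs'.ne'
  have hb : 0 < (4 * Real.pi ^ 2 * z / s : ℂ).re := by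
    have h1 : (4 * Real.pi ^ 2 * z / s : ℂ) = ((4 * Real.pi ^ 2 / s : ℝ) : ℂ) * z := by
      push_cast; ring
    rw [h1, Complex.re_ofReal_mul]
    positivity
  have hgauss := fourier_gaussian_innerProductSpace hb (-x)
  have h2 : ∫ η, H s η = ((s ^ (-(1 / 2) : ℝ) : ℝ) : ℂ) * cexp (-(z / 4) * s - z / s) *
      𝓕 (fun η : EuclideanSpace ℝ (Fin n) ↦
        cexp (-(4 * Real.pi ^ 2 * z / s) * (‖η‖ : ℂ) ^ 2)) (-x) := by
    rw [Real.fourier_eq, ← integral_const_mul]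
    refine integral_congr_ae (Eventually.of_forall fun η ↦ ?_)
    simp only [hH, subordinationIntegrand, Circle.smul_def, smul_eq_mul, inner_neg_right, neg_neg]
    ring
  rw [h2, hgauss, finrank_euclideanSpace_fin, norm_neg]
  have h3 : (Real.pi : ℂ) / (4 * Real.pi ^ 2 * z / s) = s * (4 * Real.pi * z)⁻¹ := by
    field_simp
  have h4 : ((n : ℂ) / 2) = ((n / 2 : ℝ) : ℂ) := by push_cast; rfl
  rw [h3, h4, cpow_ofReal_mul hs' (inv_ne_zero (by simp [hπ0, hz0]))]
  have h5 : s ^ (-(1 / 2) : ℝ) * s ^ (n / 2 : ℝ) = s ^ ((n - 1) / 2 : ℝ) := by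
    rw [← Real.rpow_add hs']; congr 1; ring
  have h6 : cexp (-(z / 4 + (‖x‖ : ℂ) ^ 2 / (4 * z)) * s - z / s) =
      cexp (-(z / 4) * s - z / s) *
        cexp (-(Real.pi : ℂ) ^ 2 * (‖x‖ : ℂ) ^ 2 / (4 * Real.pi ^ 2 * z / s)) := by
    rw [← Complex.exp_add]
    congr 1
    field_simp
    ring
  rw [← h5, h6]
  push_cast
  ring

/-- Dispersive bounds for the kernel of `e^{-zω}`, `Re z > 0`. -/
theorem exists_norm_fourierInv_semigroupSymbol_le {n : ℕ} (hn : 1 ≤ n) :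
    ∃ C : ℝ, 0 < C ∧ ∀ (z : ℂ), 0 < z.re → ∀ x : EuclideanSpace ℝ (Fin n),
      ‖𝓕⁻ (semigroupSymbol z) x‖ ≤
        C * z.re ^ (-((n + 1) / 2) : ℝ) * ‖z‖ ^ (-((n - 1) / 2) : ℝ) ∧
      ‖𝓕⁻ (semigroupSymbol z) x‖ ≤ C * z.re ^ (-((n + 2) / 2) : ℝ) * ‖z‖ ^ (-(n / 2) : ℝ) := by
  have hn' : (1 : ℝ) ≤ n := by exact_mod_cast hn
  have hπ := Real.pi_pos
  -- Both bounds concern the same integral with the power s^{(n-1)/2}: the exponent μ = (n+2)/2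
  -- satisfies μ - 3/2 = (n-1)/2, and μ > 1 since n ≥ 1.
  obtain ⟨C₁, hC₁⟩ := exists_norm_integral_rpow_cexp_le' (ν := (n - 1) / 2) (by linarith)
  obtain ⟨C₂, hC₂⟩ := exists_norm_integral_rpow_cexp_le (μ := (n + 2) / 2) (by linarith)
  set A : ℝ := 1 / (2 * Real.sqrt Real.pi) * (4 * Real.pi) ^ (-(n / 2) : ℝ) with hA
  have hA0 : 0 < A := by positivity
  refine ⟨max (A * |C₁| * 4⁻¹ ^ (-((n + 1) / 2) : ℝ)) (A * |C₂| * 4⁻¹ ^ (-((n + 2) / 2) : ℝ)) + 1,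
    by positivity, fun z hz x ↦ ?_⟩
  have hz0 : z ≠ 0 := by rintro rfl; simp at hz
  have hzn : 0 < ‖z‖ := norm_pos_iff.2 hz0
  obtain ⟨w, hw, hw0, hw'⟩ := exists_sq_eq_of_re_pos hz
  have hα : z.re * 4⁻¹ ≤ (z / 4 + (‖x‖ : ℂ) ^ 2 / (4 * z)).re := by
    have h1 : (‖x‖ : ℂ) ^ 2 / (4 * z) = ((‖x‖ ^ 2 / 4 : ℝ) : ℂ) * z⁻¹ := by
      push_cast; field_simp
    rw [Complex.add_re, h1, Complex.re_ofReal_mul, Complex.inv_re]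
    have h2 : (z / 4).re = z.re * 4⁻¹ := by simp [div_eq_mul_inv]
    have h3 : 0 ≤ ‖x‖ ^ 2 / 4 * (z.re / Complex.normSq z) :=
      mul_nonneg (by positivity) (div_nonneg hz.le (Complex.normSq_nonneg _))
    rw [h2]
    exact le_add_of_nonneg_right h3
  have hwn : ‖w‖ = ‖z‖ ^ (1 / 2 : ℝ) := by
    rw [← hw, norm_pow, ← Real.rpow_natCast, ← Real.rpow_mul (norm_nonneg _)]
    norm_num
  have hcp : ‖(4 * Real.pi * z)⁻¹ ^ ((n / 2 : ℝ) : ℂ)‖ =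
      (4 * Real.pi) ^ (-(n / 2) : ℝ) * ‖z‖ ^ (-(n / 2) : ℝ) := by
    rw [Complex.norm_cpow_real, norm_inv, Real.inv_rpow (norm_nonneg _), ← Real.rpow_neg
      (norm_nonneg _), norm_mul, ← Real.mul_rpow (by positivity) hzn.le]
    congr 2
    rw [norm_mul, Complex.norm_real, Real.norm_of_nonneg hπ.le]; simp
  have hform : ∀ J : ℂ, ‖w / (2 * Real.sqrt Real.pi) *
      ((4 * Real.pi * z)⁻¹ ^ ((n / 2 : ℝ) : ℂ) * J)‖ = A * ‖z‖ ^ (-((n - 1) / 2) : ℝ) * ‖J‖ := by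
    intro J
    rw [norm_mul, norm_mul, hcp, norm_div, hwn, norm_mul, Complex.norm_real,
      Real.norm_of_nonneg (Real.sqrt_nonneg _), hA]
    have h1 : ‖z‖ ^ (-((n - 1) / 2) : ℝ) = ‖z‖ ^ (1 / 2 : ℝ) * ‖z‖ ^ (-(n / 2) : ℝ) := by
      rw [← Real.rpow_add hzn]; congr 1; ring
    rw [h1]
    simp only [Complex.norm_ofNat]
    ring
  rw [fourierInv_semigroupSymbol hz hw hw0 hw', hform]
  constructor
  · have h1 := hC₁ (z.re * 4⁻¹) (z / 4 + (‖x‖ : ℂ) ^ 2 / (4 * z)) z (by positivity) hα hz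
    rw [show ((n - 1) / 2 + 1 : ℝ) = (n + 1) / 2 by ring, Real.mul_rpow hz.le (by norm_num)] at h1
    calc _ ≤ A * ‖z‖ ^ (-((n - 1) / 2) : ℝ) *
          (|C₁| * (z.re ^ (-((n + 1) / 2) : ℝ) * 4⁻¹ ^ (-((n + 1) / 2) : ℝ))) := by
          gcongr
          exact h1.trans (by gcongr; exact le_abs_self _)
      _ = (A * |C₁| * 4⁻¹ ^ (-((n + 1) / 2) : ℝ)) * z.re ^ (-((n + 1) / 2) : ℝ) *
          ‖z‖ ^ (-((n - 1) / 2) : ℝ) := by ring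
      _ ≤ _ := by
          gcongr
          exact (le_max_left _ _).trans (le_add_of_nonneg_right zero_le_one)
  · have h1 := hC₂ (z.re * 4⁻¹) (z / 4 + (‖x‖ : ℂ) ^ 2 / (4 * z)) z (by positivity) hα hz
    rw [show ((n + 2) / 2 - 3 / 2 : ℝ) = (n - 1) / 2 by ring, Real.mul_rpow hz.le (by norm_num)]
      at h1
    calc _ ≤ A * ‖z‖ ^ (-((n - 1) / 2) : ℝ) *
          (|C₂| * (z.re ^ (-((n + 2) / 2) : ℝ) * 4⁻¹ ^ (-((n + 2) / 2) : ℝ)) *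
            ‖z‖ ^ (-(1 / 2) : ℝ)) := by
          gcongr
          exact h1.trans (by gcongr; exact le_abs_self _)
      _ = (A * |C₂| * 4⁻¹ ^ (-((n + 2) / 2) : ℝ)) * z.re ^ (-((n + 2) / 2) : ℝ) *
          (‖z‖ ^ (-((n - 1) / 2) : ℝ) * ‖z‖ ^ (-(1 / 2) : ℝ)) := by ring
      _ = (A * |C₂| * 4⁻¹ ^ (-((n + 2) / 2) : ℝ)) * z.re ^ (-((n + 2) / 2) : ℝ) *
          ‖z‖ ^ (-(n / 2) : ℝ) := by
          rw [← Real.rpow_add hzn]; congr 2; ring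
      _ ≤ _ := by
          gcongr
          exact (le_max_right _ _).trans (le_add_of_nonneg_right zero_le_one)

end PoissonKernel

/-! ### Complex time and uniform amplitudes for the localized propagator. -/

section Amplitude

open FourierTransform Complex Set Filter

/-- In a smooth compact family of test functions, the inverse Fourier transforms are bounded in
`L¹`. -/
theorem exists_integral_norm_fourierInv_le {E : Type*} [NormedAddCommGroup E]
    [InnerProductSpace ℝ E] [FiniteDimensional ℝ E] [MeasurableSpace E] [BorelSpace E]
    {B : ℝ × E → ℂ} (hB : ContDiff ℝ ∞ B) {K : Set E} (hK : IsCompact K)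
    (hBK : ∀ ε η, η ∉ K → B (ε, η) = 0) :
    ∃ C : ℝ, ∀ ε ∈ Icc (0 : ℝ) 1, ∫ x, ‖𝓕⁻ (fun η ↦ B (ε, η)) x‖ ≤ C := by
  have hsmooth : ∀ ε, ContDiff ℝ ∞ fun η ↦ B (ε, η) := fun ε ↦ hB.comp (by fun_prop)
  have hsub : ∀ ε, tsupport (fun η ↦ B (ε, η)) ⊆ K := fun ε ↦
    closure_minimal (fun η hη ↦ by_contra fun h ↦ hη (hBK ε η h)) hK.isClosed
  have hcomp : ∀ ε, HasCompactSupport fun η ↦ B (ε, η) := fun ε ↦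
    hK.of_isClosed_subset (isClosed_tsupport _) (hsub ε)
  have hderiv : ∀ k l : ℕ, ∃ C : ℝ, 0 ≤ C ∧ ∀ ε ∈ Icc (0 : ℝ) 1, ∀ η,
      ‖η‖ ^ k * ‖iteratedFDeriv ℝ l (fun η ↦ B (ε, η)) η‖ ≤ C := by
    intro k l
    have hcont : Continuous fun z : ℝ × E ↦ ‖z.2‖ ^ k * ‖iteratedFDeriv ℝ l B z‖ :=
      (continuous_snd.norm.pow k).mul (hB.continuous_iteratedFDeriv (by exact_mod_cast le_top)).norm
    obtain ⟨C, hC⟩ := (isCompact_Icc.prod hK).bddAbove_image (f := fun z : ℝ × E ↦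
      ‖z.2‖ ^ k * ‖iteratedFDeriv ℝ l B z‖) hcont.continuousOn (K := Icc (0 : ℝ) 1 ×ˢ K)
    refine ⟨max C 0, le_max_right _ _, fun ε hε η ↦ ?_⟩
    by_cases hη : η ∈ K
    · refine le_trans ?_ ((hC ⟨(ε, η), ⟨hε, hη⟩, rfl⟩).trans (le_max_left _ _))
      simp only []
      gcongr
      -- The slice is `B` composed with a translation and with the inclusion of the second factor, a
      -- map of norm at most 1; so the derivatives of the slice are bounded by those of `B`.
      have h1 : (fun η ↦ B (ε, η)) = (fun z ↦ B ((ε, 0) + z)) ∘ ContinuousLinearMap.inr ℝ ℝ E := by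
        ext η; simp
      have h2 : ContDiff ℝ ∞ fun z ↦ B ((ε, 0) + z) := hB.comp (by fun_prop)
      rw [h1, ContinuousLinearMap.iteratedFDeriv_comp_right _ h2 _ (by exact_mod_cast le_top),
        iteratedFDeriv_comp_add_left]
      refine (ContinuousMultilinearMap.norm_compContinuousLinearMap_le _ _).trans ?_
      have h3 : ∏ _i : Fin l, ‖ContinuousLinearMap.inr ℝ ℝ E‖ ≤ 1 :=
        Finset.prod_le_one (fun _ _ ↦ ContinuousLinearMap.opNorm_nonneg _)
          fun _ _ ↦ ContinuousLinearMap.norm_inr_le_one ℝ ℝ E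
      have h4 : ((ε, 0) + ContinuousLinearMap.inr ℝ ℝ E η : ℝ × E) = (ε, η) := by simp
      rw [h4]
      exact mul_le_of_le_one_right (norm_nonneg _) h3
    · have h0 : iteratedFDeriv ℝ l (fun η ↦ B (ε, η)) η = 0 := by
        by_contra h
        exact hη (hsub ε (support_iteratedFDeriv_subset l h))
      rw [h0, norm_zero, mul_zero]
      exact le_max_right _ _
  -- The L¹ norm of the inverse transform is a continuous seminorm on the Schwartz space, hence
  -- dominated by finitely many Schwartz seminorms; those are bounded on the family by compactness
  -- of [0,1] × `K`.
  let q : Seminorm ℝ 𝓢(E, ℂ) := (normSeminorm ℝ (Lp ℂ 1 (volume : Measure E))).comp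
    ((SchwartzMap.toLpCLM ℝ ℂ 1 (volume : Measure E)).toLinearMap ∘ₗ
      (fourierInvCLM ℝ 𝓢(E, ℂ)).toLinearMap)
  have hq : ∀ f : 𝓢(E, ℂ), q f = ‖(𝓕⁻ f).toLp 1 (volume : Measure E)‖ := fun f ↦ rfl
  have hqc : Continuous q :=
    ((SchwartzMap.toLpCLM ℝ ℂ 1 (volume : Measure E)).continuous.comp
      (fourierInvCLM ℝ 𝓢(E, ℂ)).continuous).norm
  obtain ⟨s, c, -, hs⟩ := Seminorm.bound_of_continuous (schwartz_withSeminorms ℝ E ℂ) q hqc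
  choose D hD0 hD using hderiv
  refine ⟨c * ∑ i ∈ s, D i.1 i.2, fun ε hε ↦ ?_⟩
  set f : 𝓢(E, ℂ) := (hcomp ε).toSchwartzMap (hsmooth ε) with hf
  have h5 : ∫ x, ‖𝓕⁻ (fun η ↦ B (ε, η)) x‖ = q f := by
    rw [hq, SchwartzMap.norm_toLp_one]
    refine integral_congr_ae (Eventually.of_forall fun x ↦ ?_)
    simp only []
    rw [SchwartzMap.fourierInv_coe]
    rfl
  rw [h5]
  refine (hs f).trans ?_
  rw [smul_apply, NNReal.smul_def, smul_eq_mul]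
  gcongr
  refine Seminorm.finset_sup_apply_le (Finset.sum_nonneg fun i _ ↦ hD0 _ _) fun i hi ↦ ?_
  refine le_trans ?_ (Finset.single_le_sum (f := fun i : ℕ × ℕ ↦ D i.1 i.2)
    (fun i _ ↦ hD0 _ _) hi)
  exact SchwartzMap.seminorm_le_bound ℝ _ _ f (hD0 _ _) (hD i.1 i.2 ε hε)

/-- Dilation in frequency becomes an L¹-preserving dilation in space, so the amplitude may be
measured in the rescaled variable εξ. -/
theorem integral_norm_fourierInv_comp_smul {E : Type*} [NormedAddCommGroup E]
    [InnerProductSpace ℝ E] [FiniteDimensional ℝ E] [MeasurableSpace E] [BorelSpace E]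
    (f : E → ℂ) {ε : ℝ} (hε : 0 < ε) :
    ∫ x, ‖𝓕⁻ (fun η ↦ f (ε • η)) x‖ = ∫ x, ‖𝓕⁻ f x‖ := by
  set d := Module.finrank ℝ E
  have h1 : ∀ x, 𝓕⁻ (fun η ↦ f (ε • η)) x = ((ε ^ d)⁻¹ : ℝ) • 𝓕⁻ f (ε⁻¹ • x) := by
    intro x
    rw [Real.fourierInv_eq, Real.fourierInv_eq]
    have h2 := Measure.integral_comp_smul_of_nonneg (volume : Measure E)
      (fun η ↦ Real.fourierChar (inner ℝ η (ε⁻¹ • x)) • f η) ε (hR := hε.le)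
    rw [← h2]
    refine integral_congr_ae (Eventually.of_forall fun η ↦ ?_)
    simp only []
    rw [real_inner_smul_left, real_inner_smul_right, mul_inv_cancel_left₀ hε.ne']
  simp only [h1, norm_smul]
  rw [integral_const_mul, Measure.integral_comp_smul_of_nonneg (volume : Measure E)
    (fun x ↦ ‖𝓕⁻ f x‖) ε⁻¹ (hR := by positivity), smul_eq_mul, Real.norm_of_nonneg (by positivity)]
  rw [inv_pow, inv_inv, ← mul_assoc, inv_mul_cancel₀ (by positivity), one_mul]

/-- The part of the localized symbol of `K(t)` that is not oscillating, in the variable `ξ`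
rescaled by the frequency `1/ε`. -/
noncomputable def amplitude {n : ℕ} (a : EuclideanSpace ℝ (Fin n) → ℝ)
    (z : ℝ × EuclideanSpace ℝ (Fin n)) : ℂ :=
  ((a ((2 * Real.pi) • z.2) * (Real.exp (Real.sqrt (z.1 ^ 2 + ‖(2 * Real.pi) • z.2‖ ^ 2)) /
    Real.sqrt (z.1 ^ 2 + ‖(2 * Real.pi) • z.2‖ ^ 2)) : ℝ) : ℂ)

theorem contDiffAt_amplitude {n : ℕ} {a : EuclideanSpace ℝ (Fin n) → ℝ} (ha : ContDiff ℝ ∞ a)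
    {z : ℝ × EuclideanSpace ℝ (Fin n)} (hz : z ≠ 0) : ContDiffAt ℝ ∞ (amplitude a) z := by
  have hπ := Real.pi_pos
  have hpos : 0 < z.1 ^ 2 + ‖(2 * Real.pi) • z.2‖ ^ 2 := by
    by_cases h1 : z.1 = 0
    · have h2 : z.2 ≠ 0 := fun h ↦ hz (Prod.ext h1 h)
      have h3 : 0 < ‖(2 * Real.pi) • z.2‖ :=
        norm_pos_iff.2 (smul_ne_zero (by positivity) h2)
      positivity
    · positivity
  have hq : ContDiffAt ℝ ∞ (fun z : ℝ × EuclideanSpace ℝ (Fin n) ↦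
      z.1 ^ 2 + ‖(2 * Real.pi) • z.2‖ ^ 2) z := by
    refine ContDiff.contDiffAt ?_
    have h1 : ContDiff ℝ ∞ fun z : ℝ × EuclideanSpace ℝ (Fin n) ↦ (2 * Real.pi) • z.2 := by
      fun_prop
    exact (contDiff_fst.pow 2).add (h1.norm_sq ℝ)
  have hsq : ContDiffAt ℝ ∞ (fun z : ℝ × EuclideanSpace ℝ (Fin n) ↦
      Real.sqrt (z.1 ^ 2 + ‖(2 * Real.pi) • z.2‖ ^ 2)) z := hq.sqrt hpos.ne'
  have haz : ContDiffAt ℝ ∞ (fun z : ℝ × EuclideanSpace ℝ (Fin n) ↦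
      a ((2 * Real.pi) • z.2)) z :=
    (ha.comp (by fun_prop : ContDiff ℝ ∞ fun z : ℝ × EuclideanSpace ℝ (Fin n) ↦
      (2 * Real.pi) • z.2)).contDiffAt
  exact Complex.ofRealCLM.contDiff.contDiffAt.comp z
    (haz.mul ((hsq.exp).div hsq (Real.sqrt_pos.2 hpos).ne'))

/-- The square root is singular only at (ε, η) = (0, 0), and there `a` vanishes identically.
Smoothness up to ε = 0 is what makes the bounds uniform as the frequency tends to infinity. -/
theorem contDiff_amplitude {n : ℕ} {a : EuclideanSpace ℝ (Fin n) → ℝ} (ha : ContDiff ℝ ∞ a)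
    (ha0 : a =ᶠ[nhds 0] 0) : ContDiff ℝ ∞ (amplitude a) := by
  rw [contDiff_iff_contDiffAt]
  intro z
  by_cases hz : z = 0
  · subst hz
    have h1 : amplitude a =ᶠ[nhds 0] fun _ ↦ 0 := by
      have h2 : Tendsto (fun z : ℝ × EuclideanSpace ℝ (Fin n) ↦ (2 * Real.pi) • z.2) (nhds 0)
          (nhds 0) := by
        have : Continuous fun z : ℝ × EuclideanSpace ℝ (Fin n) ↦ (2 * Real.pi) • z.2 := by fun_prop
        simpa using this.tendsto 0
      filter_upwards [h2.eventually ha0] with z hz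
      simp only [amplitude]
      rw [hz]; simp
    exact contDiffAt_const.congr_of_eventuallyEq h1
  · exact contDiffAt_amplitude ha hz

/-- For the low-frequency cutoff, which does not vanish at the origin. Only ε = 1 is needed for it;
the dummy first variable lets the same compactness lemma apply. -/
theorem contDiff_amplitude_one {n : ℕ} {a : EuclideanSpace ℝ (Fin n) → ℝ} (ha : ContDiff ℝ ∞ a) :
    ContDiff ℝ ∞ fun z : ℝ × EuclideanSpace ℝ (Fin n) ↦ amplitude a (1, z.2) := by
  rw [contDiff_iff_contDiffAt]
  intro z
  have h1 : ContDiffAt ℝ ∞ (amplitude a) (1, z.2) :=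
    contDiffAt_amplitude ha fun h ↦ by simpa using congrArg Prod.fst h
  exact ContDiffAt.comp z (f := fun z : ℝ × EuclideanSpace ℝ (Fin n) ↦ ((1 : ℝ), z.2)) h1
    (by fun_prop)

theorem exists_compact_amplitude_eq_zero {n : ℕ} {a : EuclideanSpace ℝ (Fin n) → ℝ}
    (hac : HasCompactSupport a) : ∃ K : Set (EuclideanSpace ℝ (Fin n)), IsCompact K ∧
      ∀ ε η, η ∉ K → amplitude a (ε, η) = 0 := by
  have hπ := Real.pi_pos
  refine ⟨(fun ξ ↦ (2 * Real.pi)⁻¹ • ξ) '' tsupport a, hac.image (by fun_prop), fun ε η hη ↦ ?_⟩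
  have h1 : a ((2 * Real.pi) • η) = 0 := by
    by_contra h
    refine hη ⟨(2 * Real.pi) • η, subset_tsupport _ h, ?_⟩
    simp only [smul_smul]
    rw [inv_mul_cancel₀ (by positivity), one_smul]
  simp [amplitude, h1]

theorem mul_omega {n : ℕ} {ε : ℝ} (hε : 0 < ε) (ξ : EuclideanSpace ℝ (Fin n)) :
    Real.sqrt (ε ^ 2 + ‖ε • ξ‖ ^ 2) = ε * omega ξ := by
  have h1 := one_le_omega ξ
  rw [norm_smul, Real.norm_of_nonneg hε.le, mul_pow]
  have : ε ^ 2 + ε ^ 2 * ‖ξ‖ ^ 2 = (ε * omega ξ) ^ 2 := by rw [mul_pow, omega_sq]; ring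
  rw [this, Real.sqrt_sq (by positivity)]

/-- The localized symbol of `K(t)`, at frequency `1/ε`, in Mathlib's frequency variable. -/
noncomputable def localSymbol {n : ℕ} (a : EuclideanSpace ℝ (Fin n) → ℝ) (ε t : ℝ)
    (η : EuclideanSpace ℝ (Fin n)) : ℂ :=
  ((a (ε • (2 * Real.pi) • η) * symbolK t ((2 * Real.pi) • η) : ℝ) : ℂ)

/-- Euler's formula for the sine, multiplied and divided by e^{εω}. The times ± t become ε ± it in
the right half-plane, and e^{εω} is harmless in the amplitude because εω stays bounded on its
support for ε ≤ 1. -/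
theorem localSymbol_eq {n : ℕ} (a : EuclideanSpace ℝ (Fin n) → ℝ) {ε : ℝ} (hε : 0 < ε) (t : ℝ)
    (η : EuclideanSpace ℝ (Fin n)) :
    localSymbol a ε t η = (ε / (2 * I)) *
      (semigroupSymbol (ε - t * I) η * amplitude a (ε, ε • η) -
        semigroupSymbol (ε + t * I) η * amplitude a (ε, ε • η)) := by
  simp only [localSymbol, amplitude, semigroupSymbol, symbolK]
  rw [smul_comm (2 * Real.pi) ε η]
  set ξ := (2 * Real.pi) • η with hξ
  rw [mul_omega hε]
  have hω := one_le_omega ξ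
  have hω0 : (omega ξ : ℂ) ≠ 0 := by exact_mod_cast (by linarith : omega ξ ≠ 0)
  have hε0 : (ε : ℂ) ≠ 0 := by exact_mod_cast hε.ne'
  have h1 : cexp (-(ε - t * I) * omega ξ) = cexp (-(ε * omega ξ)) * cexp (t * omega ξ * I) := by
    rw [← Complex.exp_add]; congr 1; ring
  have h2 : cexp (-(ε + t * I) * omega ξ) = cexp (-(ε * omega ξ)) * cexp (-(t * omega ξ) * I) := by
    rw [← Complex.exp_add]; congr 1; ring
  rw [h1, h2]
  push_cast
  have h3 : cexp (-(ε * omega ξ)) = (cexp (ε * omega ξ))⁻¹ := Complex.exp_neg _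
  rw [h3, Complex.sin]
  have h4 := Complex.exp_ne_zero (ε * omega ξ)
  have h5 := Complex.I_ne_zero
  field_simp
  rw [Complex.I_sq]
  ring

/-- The product becomes a convolution, bounded by the L^∞ norm of one factor times the L¹ norm of
the other. -/
theorem norm_fourierInv_mul_le {E : Type*} [NormedAddCommGroup E]
    [InnerProductSpace ℝ E] [FiniteDimensional ℝ E] [MeasurableSpace E] [BorelSpace E]
    {m b : E → ℂ} (hm : Integrable m) (hb : ContDiff ℝ ∞ b) (hbc : HasCompactSupport b) {N : ℝ}
    (hN : ∀ x, ‖𝓕⁻ m x‖ ≤ N) (x : E) :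
    Integrable (fun η ↦ m η * b η) ∧ ‖𝓕⁻ (fun η ↦ m η * b η) x‖ ≤ N * ∫ y, ‖𝓕⁻ b y‖ := by
  set f : 𝓢(E, ℂ) := 𝓕⁻ (hbc.toSchwartzMap hb) with hf
  have hfb : ∀ y, f y = 𝓕⁻ b y := by
    intro y; rw [hf, SchwartzMap.fourierInv_coe]; rfl
  have hFf : ∀ η, 𝓕 (f : E → ℂ) η = b η := by
    intro η
    rw [← SchwartzMap.fourier_coe, hf, FourierTransform.fourier_fourierInv_eq]
    rfl
  constructor
  · obtain ⟨c, hc⟩ := hb.continuous.bounded_above_of_compact_support hbc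
    exact hm.mul_bdd (c := c) hb.continuous.aestronglyMeasurable (Eventually.of_forall hc)
  · have h1 := fourierInv_mul_fourier f.integrable hm x
    simp only [hFf] at h1
    rw [h1, mul_comm, ← integral_mul_const]
    refine norm_integral_le_of_norm_le ?_ (Eventually.of_forall fun y ↦ ?_)
    · have := f.integrable (μ := volume)
      simp only [← hfb]
      exact this.norm.mul_const _
    · rw [norm_mul, hfb]
      gcongr
      exact hN _

theorem norm_fourierInv_localSymbol_le {n : ℕ} {a : EuclideanSpace ℝ (Fin n) → ℝ} {ε t : ℝ}
    (hε : 0 < ε) (hsm : ContDiff ℝ ∞ fun η ↦ amplitude a (ε, η))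
    (hac : HasCompactSupport a) {N : ℝ}
    (hN : ∀ z : ℂ, z.re = ε → ‖z‖ = ‖(ε + t * I : ℂ)‖ → ∀ x : EuclideanSpace ℝ (Fin n),
      ‖𝓕⁻ (semigroupSymbol z) x‖ ≤ N)
    (x : EuclideanSpace ℝ (Fin n)) :
    ‖𝓕⁻ (localSymbol a ε t) x‖ ≤ ε * N * ∫ y, ‖𝓕⁻ (fun η ↦ amplitude a (ε, η)) y‖ := by
  obtain ⟨K, hK, hK0⟩ := exists_compact_amplitude_eq_zero hac
  set b : EuclideanSpace ℝ (Fin n) → ℂ := fun η ↦ amplitude a (ε, ε • η) with hb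
  have hbs : ContDiff ℝ ∞ b := hsm.comp (contDiff_const_smul ε)
  have hbc : HasCompactSupport b := by
    refine HasCompactSupport.intro (K := (fun η ↦ ε⁻¹ • η) '' K) (hK.image (by fun_prop)) ?_
    intro η hη
    refine hK0 ε _ fun h ↦ hη ⟨ε • η, h, ?_⟩
    simp [smul_smul, inv_mul_cancel₀ hε.ne']
  have hb1 : ∫ y, ‖𝓕⁻ b y‖ = ∫ y, ‖𝓕⁻ (fun η ↦ amplitude a (ε, η)) y‖ :=
    integral_norm_fourierInv_comp_smul (fun η ↦ amplitude a (ε, η)) hε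
  have hre1 : (ε - t * I : ℂ).re = ε := by simp
  have hre2 : (ε + t * I : ℂ).re = ε := by simp
  have hno : ‖(ε - t * I : ℂ)‖ = ‖(ε + t * I : ℂ)‖ := by
    rw [← RCLike.norm_conj]; simp
  obtain ⟨hi1, h1⟩ := norm_fourierInv_mul_le (integrable_semigroupSymbol (by rw [hre1]; exact hε))
    hbs hbc (hN _ hre1 hno) x
  obtain ⟨hi2, h2⟩ := norm_fourierInv_mul_le (integrable_semigroupSymbol (by rw [hre2]; exact hε))
    hbs hbc (hN _ hre2 rfl) x
  rw [hb1] at h1 h2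
  have hchar : ∀ f : EuclideanSpace ℝ (Fin n) → ℂ, Integrable f →
      Integrable fun v ↦ Real.fourierChar (inner ℝ v x) • f v := by
    intro f hf
    simpa using (Real.fourierIntegral_convergent_iff
      (μ := (volume : Measure (EuclideanSpace ℝ (Fin n)))) (f := f) (-x)).2 hf
  have hsplit : 𝓕⁻ (localSymbol a ε t) x = (ε / (2 * I)) *
      (𝓕⁻ (fun η ↦ semigroupSymbol (ε - t * I) η * b η) x -
        𝓕⁻ (fun η ↦ semigroupSymbol (ε + t * I) η * b η) x) := by
    simp only [Real.fourierInv_eq]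
    rw [← integral_sub (hchar _ hi1) (hchar _ hi2), ← integral_const_mul]
    refine integral_congr_ae (Eventually.of_forall fun η ↦ ?_)
    simp only [localSymbol_eq a hε, hb, Circle.smul_def, smul_eq_mul]
    ring
  rw [hsplit, norm_mul, norm_div, norm_mul, Complex.norm_I, Complex.norm_real,
    Real.norm_of_nonneg hε.le]
  have h3 := norm_sub_le (𝓕⁻ (fun η ↦ semigroupSymbol (ε - t * I) η * b η) x)
    (𝓕⁻ (fun η ↦ semigroupSymbol (ε + t * I) η * b η) x)
  simp only [Complex.norm_ofNat, mul_one]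
  calc _ ≤ ε / 2 * (2 * (N * ∫ y, ‖𝓕⁻ (fun η ↦ amplitude a (ε, η)) y‖)) := by
        gcongr
        linarith
    _ = _ := by ring

/-- The two dispersive bounds for the kernel of the localized propagator. -/
theorem exists_dispersive_bound {n : ℕ} (hn : 1 ≤ n) (D : ℝ) :
    ∃ C : ℝ, 0 < C ∧ ∀ (a : EuclideanSpace ℝ (Fin n) → ℝ) (ε t : ℝ), 0 < ε →
      ContDiff ℝ ∞ (fun η ↦ amplitude a (ε, η)) → HasCompactSupport a →
      (∫ y, ‖𝓕⁻ (fun η ↦ amplitude a (ε, η)) y‖ ≤ D) → ∀ x,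
      ‖𝓕⁻ (localSymbol a ε t) x‖ ≤
        C * ε ^ (-((n - 1) / 2) : ℝ) * (max ε |t|) ^ (-((n - 1) / 2) : ℝ) ∧
      (t ≠ 0 → ‖𝓕⁻ (localSymbol a ε t) x‖ ≤ C * ε ^ (-(n / 2) : ℝ) * |t| ^ (-(n / 2) : ℝ)) := by
  obtain ⟨C, hC, hCz⟩ := exists_norm_fourierInv_semigroupSymbol_le hn
  have hn' : (1 : ℝ) ≤ n := by exact_mod_cast hn
  refine ⟨C * (|D| + 1), by positivity, fun a ε t hε hsm hac hD x ↦ ?_⟩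
  have hint0 : 0 ≤ ∫ y, ‖𝓕⁻ (fun η ↦ amplitude a (ε, η)) y‖ := by positivity
  have hD1 : ∫ y, ‖𝓕⁻ (fun η ↦ amplitude a (ε, η)) y‖ ≤ |D| + 1 :=
    hD.trans ((le_abs_self D).trans (by linarith))
  -- The modulus of complex time dominates both ε and |t|; keeping the maximum in the first bound is
  -- what gives the small-time estimates.
  have hzε : ε ≤ ‖(ε + t * I : ℂ)‖ := by
    have := (le_abs_self _).trans (Complex.abs_re_le_norm (ε + t * I : ℂ)); simpa using this
  have hzt : |t| ≤ ‖(ε + t * I : ℂ)‖ := by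
    have := Complex.abs_im_le_norm (ε + t * I : ℂ); simpa using this
  constructor
  · have h1 := norm_fourierInv_localSymbol_le (t := t) hε hsm hac (fun z hz hzn x ↦
      (hzn ▸ hz ▸ (hCz z (by rw [hz]; exact hε) x).1)) x
    refine h1.trans ?_
    have h2 : ‖(ε + t * I : ℂ)‖ ^ (-((n - 1) / 2) : ℝ) ≤ (max ε |t|) ^ (-((n - 1) / 2) : ℝ) :=
      Real.rpow_le_rpow_of_nonpos (lt_max_of_lt_left hε) (max_le hzε hzt) (by linarith)
    have h3 : ε * ε ^ (-((n + 1) / 2) : ℝ) = ε ^ (-((n - 1) / 2) : ℝ) := by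
      nth_rewrite 1 [← Real.rpow_one ε]
      rw [← Real.rpow_add hε]; congr 1; ring
    rw [← h3]
    calc _ ≤ ε * (C * ε ^ (-((n + 1) / 2) : ℝ) * (max ε |t|) ^ (-((n - 1) / 2) : ℝ)) *
          (|D| + 1) := by gcongr
      _ = _ := by ring
  · intro ht
    have h1 := norm_fourierInv_localSymbol_le (t := t) hε hsm hac (fun z hz hzn x ↦
      (hzn ▸ hz ▸ (hCz z (by rw [hz]; exact hε) x).2)) x
    refine h1.trans ?_
    have h2 : ‖(ε + t * I : ℂ)‖ ^ (-(n / 2) : ℝ) ≤ |t| ^ (-(n / 2) : ℝ) :=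
      Real.rpow_le_rpow_of_nonpos (abs_pos.2 ht) hzt (by linarith)
    have h3 : ε * ε ^ (-((n + 2) / 2) : ℝ) = ε ^ (-(n / 2) : ℝ) := by
      nth_rewrite 1 [← Real.rpow_one ε]
      rw [← Real.rpow_add hε]; congr 1; ring
    rw [← h3]
    calc _ ≤ ε * (C * ε ^ (-((n + 2) / 2) : ℝ) * |t| ^ (-(n / 2) : ℝ)) * (|D| + 1) := by gcongr
      _ = _ := by ring

end Amplitude

/-! ### Comparing powers of frequency and time. -/

section Rates

/-- The size of the kernel of the propagator localized to the frequency `1/ε`, at time `τ > 0`. -/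
noncomputable def dispersiveRate (n : ℕ) (ε τ : ℝ) : ℝ :=
  min (ε ^ (-((n - 1) / 2) : ℝ) * (max ε τ) ^ (-((n - 1) / 2) : ℝ))
    (ε ^ (-(n / 2) : ℝ) * τ ^ (-(n / 2) : ℝ))

theorem dispersiveRate_pos (n : ℕ) {ε τ : ℝ} (hε : 0 < ε) (hτ : 0 < τ) :
    0 < dispersiveRate n ε τ := by
  have : 0 < max ε τ := lt_max_of_lt_left hε
  exact lt_min (by positivity) (by positivity)

/-- The two bounds are at most (ετ)^{-(n-1)/2} and (ετ)^{-n/2}; the first wins for ετ ≤ 1, the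
second for ετ ≥ 1, and any exponent in between is weaker. -/
theorem dispersiveRate_le_mul_rpow {n : ℕ} (hn : 1 ≤ n) {ε τ θ : ℝ} (hε : 0 < ε) (hτ : 0 < τ)
    (hθ : 0 ≤ θ) (hθ1 : θ ≤ 1) :
    dispersiveRate n ε τ ≤ (ε * τ) ^ (-((n - 1 + θ) / 2)) := by
  have hn' : (1 : ℝ) ≤ n := by exact_mod_cast hn
  rcases le_total (ε * τ) 1 with h | h
  · calc _ ≤ ε ^ (-((n - 1) / 2) : ℝ) * (max ε τ) ^ (-((n - 1) / 2) : ℝ) := min_le_left _ _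
      _ ≤ ε ^ (-((n - 1) / 2) : ℝ) * τ ^ (-((n - 1) / 2) : ℝ) := by
        refine mul_le_mul_of_nonneg_left ?_ (by positivity)
        exact Real.rpow_le_rpow_of_nonpos hτ (le_max_right _ _) (by linarith)
      _ = (ε * τ) ^ (-((n - 1) / 2) : ℝ) := (Real.mul_rpow hε.le hτ.le).symm
      _ ≤ _ := Real.rpow_le_rpow_of_exponent_ge (by positivity) h (by linarith)
  · calc _ ≤ ε ^ (-(n / 2) : ℝ) * τ ^ (-(n / 2) : ℝ) := min_le_right _ _
      _ = (ε * τ) ^ (-(n / 2) : ℝ) := (Real.mul_rpow hε.le hτ.le).symm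
      _ ≤ _ := Real.rpow_le_rpow_of_exponent_le h (by linarith)

/-- Only the first bound is used: θ/2 of the decay in max(ε, τ) is spent on ε and the rest on τ. The
condition θ ≤ n - 1 keeps the second exponent nonpositive. -/
theorem dispersiveRate_le_rpow_mul_rpow {n : ℕ} {ε τ θ : ℝ} (hε : 0 < ε) (hτ : 0 < τ)
    (hθ : 0 ≤ θ) (hθ1 : θ ≤ n - 1) :
    dispersiveRate n ε τ ≤ ε ^ (-((n - 1 + θ) / 2)) * τ ^ (-((n - 1 - θ) / 2)) := by
  have hm : 0 < max ε τ := lt_max_of_lt_left hε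
  calc _ ≤ ε ^ (-((n - 1) / 2) : ℝ) * (max ε τ) ^ (-((n - 1) / 2) : ℝ) := min_le_left _ _
    _ = ε ^ (-((n - 1) / 2) : ℝ) * ((max ε τ) ^ (-(θ / 2)) *
        (max ε τ) ^ (-((n - 1 - θ) / 2) : ℝ)) := by
      rw [← Real.rpow_add hm]; congr 2; ring
    _ ≤ ε ^ (-((n - 1) / 2) : ℝ) * (ε ^ (-(θ / 2)) * τ ^ (-((n - 1 - θ) / 2) : ℝ)) := by
      refine mul_le_mul_of_nonneg_left (mul_le_mul ?_ ?_ (by positivity) (by positivity))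
        (by positivity)
      · exact Real.rpow_le_rpow_of_nonpos hε (le_max_left _ _) (by linarith)
      · exact Real.rpow_le_rpow_of_nonpos hτ (le_max_right _ _) (by linarith)
    _ = _ := by
      rw [← mul_assoc, ← Real.rpow_add hε]; congr 2; ring

variable {n : ℕ} {δ s s' θ ε τ : ℝ}

/-- The total power of ε is 1 + s' - s - (n+1+θ)δ ≥ 0, so it is at most 1 for ε ≤ 1. -/
theorem rpow_mul_dispersiveRate_le (hn : 1 ≤ n) (hδ : 0 ≤ δ) (hθ : 0 ≤ θ) (hθ1 : θ ≤ 1)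
    (h : (n + 1 + θ) * δ ≤ 1 + s' - s) (hε : 0 < ε) (hε1 : ε ≤ 1) (hτ : 0 < τ) :
    ε ^ (s' - s) * (dispersiveRate n ε τ ^ (2 * δ) * ε ^ (1 - 2 * δ)) ≤
      τ ^ (-((n - 1 + θ) * δ)) := by
  calc _ ≤ ε ^ (s' - s) * (((ε * τ) ^ (-((n - 1 + θ) / 2))) ^ (2 * δ) * ε ^ (1 - 2 * δ)) := by
        gcongr
        · exact (dispersiveRate_pos n hε hτ).le
        · exact dispersiveRate_le_mul_rpow hn hε hτ hθ hθ1
    _ = ε ^ (1 + s' - s - (n + 1 + θ) * δ) * τ ^ (-((n - 1 + θ) * δ)) := by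
        rw [← Real.rpow_mul (by positivity), Real.mul_rpow hε.le hτ.le]
        have : ε ^ (1 + s' - s - (n + 1 + θ) * δ) = ε ^ (s' - s) *
            (ε ^ (-((n - 1 + θ) / 2) * (2 * δ)) * ε ^ (1 - 2 * δ)) := by
          rw [← Real.rpow_add hε, ← Real.rpow_add hε]; congr 1; ring
        rw [this, show -((n - 1 + θ) / 2) * (2 * δ) = -((n - 1 + θ) * δ) by ring]
        ring
    _ ≤ 1 * τ ^ (-((n - 1 + θ) * δ)) := by
        gcongr
        exact Real.rpow_le_one hε.le hε1 (by linarith)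
    _ = _ := one_mul _

theorem rpow_mul_dispersiveRate_le' (hδ : 0 ≤ δ) (hθ : 0 ≤ θ) (hθ1 : θ ≤ n - 1)
    (h : (n + 1 + θ) * δ = 1 + s' - s) (hε : 0 < ε) (hτ : 0 < τ) :
    ε ^ (s' - s) * (dispersiveRate n ε τ ^ (2 * δ) * ε ^ (1 - 2 * δ)) ≤
      τ ^ (-((n - 1 - θ) * δ)) := by
  calc _ ≤ ε ^ (s' - s) * ((ε ^ (-((n - 1 + θ) / 2)) * τ ^ (-((n - 1 - θ) / 2))) ^ (2 * δ) *
        ε ^ (1 - 2 * δ)) := by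
        gcongr
        · exact (dispersiveRate_pos n hε hτ).le
        · exact dispersiveRate_le_rpow_mul_rpow hε hτ hθ hθ1
    _ = ε ^ (1 + s' - s - (n + 1 + θ) * δ) * τ ^ (-((n - 1 - θ) * δ)) := by
        rw [Real.mul_rpow (by positivity) (by positivity), ← Real.rpow_mul hε.le,
          ← Real.rpow_mul hτ.le]
        have : ε ^ (1 + s' - s - (n + 1 + θ) * δ) = ε ^ (s' - s) *
            (ε ^ (-((n - 1 + θ) / 2) * (2 * δ)) * ε ^ (1 - 2 * δ)) := by
          rw [← Real.rpow_add hε, ← Real.rpow_add hε]; congr 1; ring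
        rw [this, show -((n - 1 - θ) / 2) * (2 * δ) = -((n - 1 - θ) * δ) by ring]
        ring
    _ = _ := by rw [h, sub_self, Real.rpow_zero, one_mul]

/-- The power of ε outside the maximum is 1 + s' - s - (n+1)δ ≥ θδ ≥ 0, so ε may be raised to max(ε,
τ) there. A single power of max(ε, τ) ≤ 1 remains; lowering its exponent to at most 0 allows max(ε,
τ) to be replaced by τ. -/
theorem rpow_mul_dispersiveRate_le_of_le_one (hδ : 0 ≤ δ) (hθ : 0 ≤ θ)
    (h : (n + 1 + θ) * δ ≤ 1 + s' - s) (hε : 0 < ε) (hε1 : ε ≤ 1) (hτ : 0 < τ) (hτ1 : τ ≤ 1) :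
    ε ^ (s' - s) * (dispersiveRate n ε τ ^ (2 * δ) * ε ^ (1 - 2 * δ)) ≤
      τ ^ (min (1 + s' - s - 2 * n * δ) 0) := by
  have hm : 0 < max ε τ := lt_max_of_lt_left hε
  have hθδ := mul_nonneg hθ hδ
  calc _ ≤ ε ^ (s' - s) * ((ε ^ (-((n - 1) / 2) : ℝ) * (max ε τ) ^ (-((n - 1) / 2) : ℝ)) ^ (2 * δ) *
        ε ^ (1 - 2 * δ)) := by
        gcongr
        · exact (dispersiveRate_pos n hε hτ).le
        · exact min_le_left _ _
    _ = ε ^ (1 + s' - s - (n + 1) * δ) * (max ε τ) ^ (-((n - 1) * δ)) := by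
        rw [Real.mul_rpow (by positivity) (by positivity), ← Real.rpow_mul hε.le,
          ← Real.rpow_mul hm.le]
        have : ε ^ (1 + s' - s - (n + 1) * δ) = ε ^ (s' - s) *
            (ε ^ (-((n - 1) / 2) * (2 * δ)) * ε ^ (1 - 2 * δ)) := by
          rw [← Real.rpow_add hε, ← Real.rpow_add hε]; congr 1; ring
        rw [this, show (-((n - 1) / 2) * (2 * δ) : ℝ) = -((n - 1) * δ) by ring]
        ring
    _ ≤ (max ε τ) ^ (1 + s' - s - (n + 1) * δ) * (max ε τ) ^ (-((n - 1) * δ)) := by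
        gcongr
        · linarith
        · exact le_max_left _ _
    _ = (max ε τ) ^ (1 + s' - s - 2 * n * δ) := by
        rw [← Real.rpow_add hm]; congr 1; ring
    _ ≤ (max ε τ) ^ (min (1 + s' - s - 2 * n * δ) 0) :=
        Real.rpow_le_rpow_of_exponent_ge hm (max_le hε1 hτ1) (min_le_left _ _)
    _ ≤ _ := Real.rpow_le_rpow_of_nonpos hτ (le_max_right _ _) (min_le_right _ _)

end Rates

/-! ### Frequency localization and reduction to single blocks. -/

section LittlewoodPaley

open FourierTransform Complex Set Filter

variable {n : ℕ} {Φ : EuclideanSpace ℝ (Fin n) → ℝ}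

theorem IsCutoff.eq_zero (hΦ : IsCutoff Φ) {x : EuclideanSpace ℝ (Fin n)} (hx : 2 < ‖x‖) :
    Φ x = 0 := by
  by_contra h
  have := hΦ.tsupport_subset (subset_tsupport _ h)
  rw [mem_closedBall_zero_iff] at this
  linarith

theorem IsCutoff.hasCompactSupport (hΦ : IsCutoff Φ) : HasCompactSupport Φ :=
  (isCompact_closedBall _ _).of_isClosed_subset (isClosed_tsupport _) hΦ.tsupport_subset

/-- A cutoff that equals `1` on the support of `Φ`. -/
noncomputable def lowCutoff (Φ : EuclideanSpace ℝ (Fin n) → ℝ) (x : EuclideanSpace ℝ (Fin n)) : ℝ :=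
  Φ ((1 / 2 : ℝ) • x)

/-- A cutoff away from the origin that equals `1` where `ψ` does not vanish. -/
noncomputable def highCutoff (Φ : EuclideanSpace ℝ (Fin n) → ℝ) (x : EuclideanSpace ℝ (Fin n)) : ℝ :=
  Φ ((1 / 2 : ℝ) • x) - Φ ((4 : ℝ) • x)

theorem norm_smul_of_pos {c : ℝ} (hc : 0 < c) (x : EuclideanSpace ℝ (Fin n)) :
    ‖c • x‖ = c * ‖x‖ := by
  rw [norm_smul, Real.norm_of_nonneg hc.le]

theorem lowCutoff_mul (hΦ : IsCutoff Φ) (x : EuclideanSpace ℝ (Fin n)) :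
    lowCutoff Φ x * Φ x = Φ x := by
  rcases le_or_gt ‖x‖ 2 with h | h
  · rw [lowCutoff, hΦ.eq_one, one_mul]
    rw [norm_smul_of_pos (by norm_num)]; linarith
  · rw [hΦ.eq_zero h, mul_zero]

theorem highCutoff_mul_psi (hΦ : IsCutoff Φ) (x : EuclideanSpace ℝ (Fin n)) :
    highCutoff Φ x * psi Φ x = psi Φ x := by
  have h2 := norm_smul_of_pos (c := 2) (by norm_num) x
  have h4 := norm_smul_of_pos (c := 4) (by norm_num) x
  have h5 := norm_smul_of_pos (c := 1 / 2) (by norm_num) x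
  rcases le_or_gt ‖x‖ (1 / 2) with h | h
  · rw [psi, hΦ.eq_one x (by linarith), hΦ.eq_one _ (by linarith), sub_self, mul_zero]
  rcases le_or_gt ‖x‖ 2 with h' | h'
  · rw [highCutoff, hΦ.eq_one ((1 / 2 : ℝ) • x) (by linarith),
      hΦ.eq_zero (x := (4 : ℝ) • x) (by linarith), sub_zero, one_mul]
  · rw [psi, hΦ.eq_zero h', hΦ.eq_zero (x := (2 : ℝ) • x) (by linarith), sub_self, mul_zero]

theorem contDiff_lowCutoff (hΦ : IsCutoff Φ) : ContDiff ℝ ∞ (lowCutoff Φ) :=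
  hΦ.smooth.comp (contDiff_const_smul _)

theorem contDiff_highCutoff (hΦ : IsCutoff Φ) : ContDiff ℝ ∞ (highCutoff Φ) :=
  (hΦ.smooth.comp (contDiff_const_smul _)).sub (hΦ.smooth.comp (contDiff_const_smul _))

theorem hasCompactSupport_lowCutoff (hΦ : IsCutoff Φ) : HasCompactSupport (lowCutoff Φ) :=
  hΦ.hasCompactSupport.comp_smul (by norm_num)

theorem hasCompactSupport_highCutoff (hΦ : IsCutoff Φ) : HasCompactSupport (highCutoff Φ) :=
  (hΦ.hasCompactSupport.comp_smul (by norm_num)).sub (hΦ.hasCompactSupport.comp_smul (by norm_num))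

theorem highCutoff_eq_zero (hΦ : IsCutoff Φ) {x : EuclideanSpace ℝ (Fin n)} (hx : ‖x‖ ≤ 1 / 4) :
    highCutoff Φ x = 0 := by
  have h4 := norm_smul_of_pos (c := 4) (by norm_num) x
  have h5 := norm_smul_of_pos (c := 1 / 2) (by norm_num) x
  rw [highCutoff, hΦ.eq_one _ (by linarith), hΦ.eq_one _ (by linarith), sub_self]

theorem highCutoff_eventuallyEq_zero (hΦ : IsCutoff Φ) : highCutoff Φ =ᶠ[nhds 0] 0 := by
  filter_upwards [Metric.closedBall_mem_nhds (0 : EuclideanSpace ℝ (Fin n))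
    (by norm_num : (0 : ℝ) < 1 / 4)] with x hx
  exact highCutoff_eq_zero hΦ (mem_closedBall_zero_iff.1 hx)

theorem abs_lowCutoff_le_one (hΦ : IsCutoff Φ) (x : EuclideanSpace ℝ (Fin n)) :
    |lowCutoff Φ x| ≤ 1 := by
  have := hΦ.mem_Icc ((1 / 2 : ℝ) • x)
  rw [lowCutoff, abs_of_nonneg this.1]
  exact this.2

theorem abs_highCutoff_le_one (hΦ : IsCutoff Φ) (x : EuclideanSpace ℝ (Fin n)) :
    |highCutoff Φ x| ≤ 1 := by
  have h1 := hΦ.mem_Icc ((1 / 2 : ℝ) • x)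
  have h2 := hΦ.mem_Icc ((4 : ℝ) • x)
  rw [highCutoff, abs_le]
  constructor <;> linarith [h1.1, h1.2, h2.1, h2.2]

theorem abs_symbolK_le (t : ℝ) (ξ : EuclideanSpace ℝ (Fin n)) : |symbolK t ξ| ≤ (omega ξ)⁻¹ := by
  have h := one_le_omega ξ
  rw [symbolK, abs_mul, abs_of_nonneg (by positivity)]
  exact mul_le_of_le_one_right (by positivity) (Real.abs_sin_le_one _)

theorem norm_localSymbol_le {a : EuclideanSpace ℝ (Fin n) → ℝ} (ha : ∀ x, |a x| ≤ 1) {ε M : ℝ}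
    (h : ∀ ξ, a (ε • ξ) ≠ 0 → (omega ξ)⁻¹ ≤ M) (hM : 0 ≤ M) (t : ℝ)
    (η : EuclideanSpace ℝ (Fin n)) :
    ‖localSymbol a ε t η‖ ≤ M := by
  rw [localSymbol, Complex.norm_real, Real.norm_eq_abs]
  by_cases h0 : a (ε • (2 * Real.pi) • η) = 0
  · simpa [h0] using hM
  · rw [abs_mul]
    calc _ ≤ 1 * (omega ((2 * Real.pi) • η))⁻¹ :=
          mul_le_mul (ha _) (abs_symbolK_le _ _) (abs_nonneg _) zero_le_one
      _ ≤ M := by rw [one_mul]; exact h _ h0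

theorem contDiff_localSymbol {a : EuclideanSpace ℝ (Fin n) → ℝ} (ha : ContDiff ℝ ∞ a) (ε t : ℝ) :
    ContDiff ℝ ∞ (localSymbol a ε t) := by
  have h1 : ContDiff ℝ ∞ fun η : EuclideanSpace ℝ (Fin n) ↦ a (ε • (2 * Real.pi) • η) :=
    ha.comp (by fun_prop)
  have h2 : ContDiff ℝ ∞ fun η : EuclideanSpace ℝ (Fin n) ↦ symbolK t ((2 * Real.pi) • η) :=
    (hasTemperateGrowth_symbolK t).1.comp (by fun_prop)
  exact Complex.ofRealCLM.contDiff.comp (h1.mul h2)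

theorem hasCompactSupport_localSymbol {a : EuclideanSpace ℝ (Fin n) → ℝ}
    (ha : HasCompactSupport a) {ε : ℝ} (hε : 0 < ε) (t : ℝ) :
    HasCompactSupport (localSymbol a ε t) := by
  have hπ := Real.pi_pos
  have h1 : HasCompactSupport fun η : EuclideanSpace ℝ (Fin n) ↦ a ((ε * (2 * Real.pi)) • η) :=
    ha.comp_smul (by positivity)
  refine h1.mono fun η hη ↦ ?_
  contrapose! hη
  rw [Function.mem_support, not_not, mul_smul] at hη
  rw [Function.mem_support, not_not, localSymbol, hη, zero_mul, Complex.ofReal_zero]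

theorem multiplier_comp {m₁ m₂ : EuclideanSpace ℝ (Fin n) → ℝ} (h₁ : m₁.HasTemperateGrowth)
    (h₂ : m₂.HasTemperateGrowth) (g : 𝓢'(EuclideanSpace ℝ (Fin n), ℂ)) :
    multiplier m₂ (multiplier m₁ g) = multiplier (fun ξ ↦ m₁ ξ * m₂ ξ) g := by
  have hc : ∀ m : EuclideanSpace ℝ (Fin n) → ℝ, m.HasTemperateGrowth →
      (fun η : EuclideanSpace ℝ (Fin n) ↦ (m ((2 * Real.pi) • η) : ℂ)).HasTemperateGrowth :=
    fun m hm ↦ (Complex.ofRealCLM.hasTemperateGrowth).comp (hasTemperateGrowth_dilate hm _)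
  simp only [multiplier]
  rw [TemperedDistribution.fourierMultiplierCLM_fourierMultiplierCLM_apply (hc _ h₁) (hc _ h₂)]
  congr 2
  ext η
  simp

/-- Localizing `K(t)` to the support of a Littlewood–Paley cutoff. -/
theorem multiplier_K {a m : EuclideanSpace ℝ (Fin n) → ℝ} {ε : ℝ} (hm : m.HasTemperateGrowth)
    (ha : a.HasTemperateGrowth) (ham : ∀ ξ, a (ε • ξ) * m ξ = m ξ) (t : ℝ)
    (g : 𝓢'(EuclideanSpace ℝ (Fin n), ℂ)) :
    multiplier m (K t g) =
      TemperedDistribution.fourierMultiplierCLM ℂ (localSymbol a ε t) (multiplier m g) := by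
  have h1 : TemperedDistribution.fourierMultiplierCLM ℂ (localSymbol a ε t) (multiplier m g) =
    multiplier (fun ξ ↦ a (ε • ξ) * symbolK t ξ) (multiplier m g) := rfl
  have h2 := multiplier_comp (m₂ := fun ξ ↦ a (ε • ξ) * symbolK t ξ) hm
    ((hasTemperateGrowth_dilate ha ε).mul (hasTemperateGrowth_symbolK t)) g
  rw [h1, h2, K, multiplier_comp (hasTemperateGrowth_symbolK t) hm]
  congr 2
  ext ξ
  rw [← mul_assoc, mul_comm (m ξ), ham, mul_comm]

theorem distLpNorm_zero (p : ℝ≥0∞) [Fact (1 ≤ p)] :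
    distLpNorm p (0 : 𝓢'(EuclideanSpace ℝ (Fin n), ℂ)) = 0 := by
  refine le_antisymm ?_ zero_le
  refine (iInf₂_le (f := fun (h : Lp ℂ p (volume : Measure (EuclideanSpace ℝ (Fin n))))
    (_ : Lp.toTemperedDistribution h = _) ↦ ‖h‖ₑ) 0 ?_).trans (by simp)
  exact map_zero (Lp.toTemperedDistributionCLM ℂ (volume : Measure (EuclideanSpace ℝ (Fin n))) p)

theorem K_zero_apply (g : 𝓢'(EuclideanSpace ℝ (Fin n), ℂ)) : K 0 g = 0 := by
  have h : (symbolK 0 : EuclideanSpace ℝ (Fin n) → ℝ) = fun _ ↦ 0 := by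
    ext ξ; simp [symbolK]
  rw [K, h, multiplier]
  simp

theorem besovNorm_zero (s : ℝ) {p q : ℝ≥0∞} [Fact (1 ≤ p)] (hq : 1 ≤ q) :
    besovNorm Φ s p q (0 : 𝓢'(EuclideanSpace ℝ (Fin n), ℂ)) = 0 := by
  rw [besovNorm]
  split_ifs with h
  · simp [distLpNorm_zero]
  · have : 0 < q.toReal := ENNReal.toReal_pos (by positivity) h
    simp [distLpNorm_zero, this]

/-- A bound on each Littlewood–Paley piece is a bound on the Besov norm. -/
theorem besovNorm_le_mul {s s' : ℝ} {p p' q : ℝ≥0∞} [Fact (1 ≤ p)] [Fact (1 ≤ p')] (hq : 1 ≤ q)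
    {f g : 𝓢'(EuclideanSpace ℝ (Fin n), ℂ)} {A : ℝ≥0∞}
    (hlow : distLpNorm p (lowProj Φ f) ≤ A * distLpNorm p' (lowProj Φ g))
    (hhigh : ∀ j : ℕ, (2 : ℝ≥0∞) ^ (((j : ℝ) + 1) * s) * distLpNorm p (lpProj Φ ((j : ℤ) + 1) f) ≤
      A * ((2 : ℝ≥0∞) ^ (((j : ℝ) + 1) * s') * distLpNorm p' (lpProj Φ ((j : ℤ) + 1) g))) :
    besovNorm Φ s p q f ≤ A * besovNorm Φ s' p' q g := by
  simp only [besovNorm]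
  split_ifs with h
  · refine max_le (hlow.trans ?_) (iSup_le fun j ↦ (hhigh j).trans ?_)
    · gcongr
      exact le_max_left _ _
    · gcongr
      exact (le_iSup (fun j : ℕ ↦ (2 : ℝ≥0∞) ^ (((j : ℝ) + 1) * s') *
        distLpNorm p' (lpProj Φ ((j : ℤ) + 1) g)) j).trans (le_max_right _ _)
  · have hq0 : 0 < q.toReal := ENNReal.toReal_pos (by positivity) h
    have hA : A = (A ^ q.toReal) ^ (1 / q.toReal) := by
      rw [← ENNReal.rpow_mul, mul_one_div_cancel hq0.ne', ENNReal.rpow_one]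
    nth_rewrite 1 [hA]
    rw [← ENNReal.mul_rpow_of_nonneg _ _ (by positivity)]
    refine ENNReal.rpow_le_rpow ?_ (by positivity)
    rw [mul_add, ← ENNReal.tsum_mul_left]
    refine add_le_add ?_ (ENNReal.tsum_le_tsum fun j ↦ ?_)
    · rw [← ENNReal.mul_rpow_of_nonneg _ _ hq0.le]
      exact ENNReal.rpow_le_rpow hlow hq0.le
    · have := ENNReal.rpow_le_rpow (hhigh j) hq0.le
      rwa [ENNReal.mul_rpow_of_nonneg _ _ hq0.le, ENNReal.mul_rpow_of_nonneg _ _ hq0.le,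
        ENNReal.mul_rpow_of_nonneg _ _ hq0.le, ← ENNReal.rpow_mul, ← ENNReal.rpow_mul] at this

end LittlewoodPaley

/-! ### Assembly of the block estimates. -/

section Main

open FourierTransform Complex Set Filter

variable {n : ℕ} {Φ : EuclideanSpace ℝ (Fin n) → ℝ} {p p' q : ℝ≥0∞} [Fact (1 ≤ p)]
  [Fact (1 ≤ p')] {δ s s' : ℝ}

/-- The kernel estimate for the pieces of `K(t)`. -/
theorem exists_norm_fourierInv_cutoff_le (hn : 1 ≤ n) (hΦ : IsCutoff Φ) :
    ∃ C : ℝ, 0 < C ∧ ∀ (a : EuclideanSpace ℝ (Fin n) → ℝ) (ε t : ℝ), 0 < ε → ε ≤ 1 → t ≠ 0 →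
      (a = highCutoff Φ ∨ a = lowCutoff Φ ∧ ε = 1) → ∀ x,
      ‖𝓕⁻ (localSymbol a ε t) x‖ ≤ C * dispersiveRate n ε |t| := by
  have hh := contDiff_amplitude (contDiff_highCutoff hΦ) (highCutoff_eventuallyEq_zero hΦ)
  have hl := contDiff_amplitude_one (contDiff_lowCutoff hΦ)
  obtain ⟨K₁, hK₁, hK₁0⟩ := exists_compact_amplitude_eq_zero (hasCompactSupport_highCutoff hΦ)
  obtain ⟨K₂, hK₂, hK₂0⟩ := exists_compact_amplitude_eq_zero (hasCompactSupport_lowCutoff hΦ)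
  obtain ⟨D₁, hD₁⟩ := exists_integral_norm_fourierInv_le hh hK₁ hK₁0
  obtain ⟨D₂, hD₂⟩ := exists_integral_norm_fourierInv_le hl hK₂ fun _ ↦ hK₂0 1
  obtain ⟨C, hC, h⟩ := exists_dispersive_bound hn (max D₁ D₂)
  refine ⟨C, hC, fun a ε t hε hε1 ht ha x ↦ ?_⟩
  suffices H : ContDiff ℝ ∞ (fun η ↦ amplitude a (ε, η)) ∧ HasCompactSupport a ∧
      (∫ y, ‖𝓕⁻ (fun η ↦ amplitude a (ε, η)) y‖ ≤ max D₁ D₂) by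
    obtain ⟨h1, h2⟩ := h a ε t hε H.1 H.2.1 H.2.2 x
    rw [dispersiveRate, mul_min_of_nonneg _ _ hC.le, ← mul_assoc, ← mul_assoc]
    exact le_min h1 (h2 ht)
  rcases ha with rfl | ⟨rfl, rfl⟩
  · exact ⟨hh.comp (by fun_prop), hasCompactSupport_highCutoff hΦ,
      (hD₁ ε ⟨hε.le, hε1⟩).trans (le_max_left _ _)⟩
  · exact ⟨hl.comp (by fun_prop : ContDiff ℝ ∞ fun η : EuclideanSpace ℝ (Fin n) ↦ ((1 : ℝ), η)),
      hasCompactSupport_lowCutoff hΦ, (hD₂ 1 ⟨zero_le_one, le_rfl⟩).trans (le_max_right _ _)⟩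

/-- The high cutoff vanishes for |εξ| ≤ 1/4, so ω ≥ |ξ| > 1/(4ε) where it does not vanish. For the
low cutoff ε = 1, and ω ≥ 1 suffices. -/
theorem norm_localSymbol_cutoff_le (hΦ : IsCutoff Φ) {a : EuclideanSpace ℝ (Fin n) → ℝ} {ε : ℝ}
    (hε : 0 < ε) (ha : a = highCutoff Φ ∨ a = lowCutoff Φ ∧ ε = 1) (t : ℝ)
    (η : EuclideanSpace ℝ (Fin n)) : ‖localSymbol a ε t η‖ ≤ 4 * ε := by
  rcases ha with rfl | ⟨rfl, rfl⟩
  · refine norm_localSymbol_le (abs_highCutoff_le_one hΦ) (fun ξ hξ ↦ ?_) (by positivity) t η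
    have h1 : 1 / 4 < ‖ε • ξ‖ := by
      by_contra! h
      exact hξ (highCutoff_eq_zero hΦ h)
    rw [norm_smul_of_pos hε] at h1
    have h2 := norm_le_omega ξ
    have h3 := one_le_omega ξ
    rw [inv_le_iff_one_le_mul₀ (by positivity)]
    nlinarith
  · refine norm_localSymbol_le (abs_lowCutoff_le_one hΦ) (fun ξ _ ↦ ?_) (by positivity) t η
    exact (inv_le_one_of_one_le₀ (one_le_omega ξ)).trans (by norm_num)

/-- Interpolation of the kernel bound with the L² bound 4ε, using 1 - 2/p = 2δ. -/
theorem exists_distLpNorm_localSymbol_le (hn : 1 ≤ n) (hΦ : IsCutoff Φ) (hp : 2 ≤ p)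
    (hpp' : p⁻¹ + p'⁻¹ = 1) (hδ : δ = 1 / 2 - (p⁻¹).toReal) :
    ∃ C : ℝ, 0 < C ∧ ∀ (a : EuclideanSpace ℝ (Fin n) → ℝ) (ε t : ℝ), 0 < ε → ε ≤ 1 → t ≠ 0 →
      (a = highCutoff Φ ∨ a = lowCutoff Φ ∧ ε = 1) → ∀ u,
      distLpNorm p (TemperedDistribution.fourierMultiplierCLM ℂ (localSymbol a ε t) u) ≤
        ENNReal.ofReal (C * (dispersiveRate n ε |t| ^ (2 * δ) * ε ^ (1 - 2 * δ))) *
          distLpNorm p' u := by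
  obtain ⟨C, hC, h⟩ := exists_norm_fourierInv_cutoff_le hn hΦ
  refine ⟨C ^ (2 * δ) * 4 ^ (1 - 2 * δ), by positivity, fun a ε t hε hε1 ht ha u ↦ ?_⟩
  have hr := dispersiveRate_pos n hε (abs_pos.2 ht)
  have hac : ContDiff ℝ ∞ a ∧ HasCompactSupport a := by
    rcases ha with rfl | ⟨rfl, -⟩
    · exact ⟨contDiff_highCutoff hΦ, hasCompactSupport_highCutoff hΦ⟩
    · exact ⟨contDiff_lowCutoff hΦ, hasCompactSupport_lowCutoff hΦ⟩
  refine (distLpNorm_multiplier_le (contDiff_localSymbol hac.1 ε t)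
    (hasCompactSupport_localSymbol hac.2 hε t) (mul_pos hC hr) (by positivity : 0 < 4 * ε)
    (h a ε t hε hε1 ht ha) (norm_localSymbol_cutoff_le hΦ hε ha t) hp hpp' u).trans_eq ?_
  congr 2
  rw [show 1 - 2 * p⁻¹.toReal = 2 * δ by rw [hδ]; ring,
    show 2 * p⁻¹.toReal = 1 - 2 * δ by rw [hδ]; ring, Real.mul_rpow hC.le hr.le,
    Real.mul_rpow (by norm_num) hε.le]
  ring

/-- With 2^{ks} = ε^{-s}, the passage from smoothness s' to s costs ε^{s'-s} on each block. `R`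
bounds the resulting constant for all ε in (0, 1], in particular for the dyadic ones, and for ε = 1
on the low-frequency block. -/
theorem exists_besovNorm_K_le (hn : 1 ≤ n) (hΦ : IsCutoff Φ) (hp : 2 ≤ p) (hq : 1 ≤ q)
    (hpp' : p⁻¹ + p'⁻¹ = 1) (hδ : δ = 1 / 2 - (p⁻¹).toReal) (s s' : ℝ) :
    ∃ C : ℝ≥0, ∀ (t R : ℝ), t ≠ 0 →
      (∀ ε, 0 < ε → ε ≤ 1 →
        ε ^ (s' - s) * (dispersiveRate n ε |t| ^ (2 * δ) * ε ^ (1 - 2 * δ)) ≤ R) → ∀ g,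
      besovNorm Φ s p q (K t g) ≤ C * ENNReal.ofReal R * besovNorm Φ s' p' q g := by
  obtain ⟨C, hC, h⟩ := exists_distLpNorm_localSymbol_le (p' := p') hn hΦ hp hpp' hδ
  refine ⟨C.toNNReal, fun t R ht hR g ↦ ?_⟩
  change _ ≤ ENNReal.ofReal C * _ * _
  have hgrow : ∀ a : EuclideanSpace ℝ (Fin n) → ℝ, HasCompactSupport a → ContDiff ℝ ∞ a →
    a.HasTemperateGrowth := fun a h1 h2 ↦ h1.hasTemperateGrowth h2
  refine besovNorm_le_mul hq ?_ fun j ↦ ?_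
  · have h1 := multiplier_K (a := lowCutoff Φ) (ε := 1) (hasTemperateGrowth_cutoff hΦ)
      (hgrow _ (hasCompactSupport_lowCutoff hΦ) (contDiff_lowCutoff hΦ))
      (fun ξ ↦ by rw [one_smul]; exact lowCutoff_mul hΦ ξ) t g
    rw [lowProj, h1]
    refine (h _ 1 t one_pos le_rfl ht (Or.inr ⟨rfl, rfl⟩) _).trans ?_
    rw [← ENNReal.ofReal_mul hC.le]
    gcongr
    simpa using hR 1 one_pos le_rfl
  · set ε : ℝ := (2 : ℝ) ^ (-((j : ℤ) + 1)) with hεdef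
    have hε : 0 < ε := by positivity
    have hε1 : ε ≤ 1 := zpow_le_one_of_nonpos₀ (by norm_num) (by omega)
    have h1 := multiplier_K (a := highCutoff Φ) (ε := ε) (m := fun ξ ↦ psi Φ (ε • ξ))
      (hasTemperateGrowth_dilate (hasTemperateGrowth_psi hΦ) ε)
      (hgrow _ (hasCompactSupport_highCutoff hΦ) (contDiff_highCutoff hΦ))
      (fun ξ ↦ highCutoff_mul_psi hΦ (ε • ξ)) t g
    have h2 := h _ ε t hε hε1 ht (Or.inl rfl) (multiplier (fun ξ ↦ psi Φ (ε • ξ)) g)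
    rw [← h1] at h2
    change _ * distLpNorm p (multiplier (fun ξ ↦ psi Φ (ε • ξ)) (K t g)) ≤
      _ * (_ * distLpNorm p' (multiplier (fun ξ ↦ psi Φ (ε • ξ)) g))
    set W := dispersiveRate n ε |t| ^ (2 * δ) * ε ^ (1 - 2 * δ) with hW
    have hpow : ∀ x : ℝ, (2 : ℝ≥0∞) ^ (((j : ℝ) + 1) * x) = ENNReal.ofReal (ε ^ (-x)) := by
      intro x
      have h3 : ε = (2 : ℝ) ^ (-((j : ℝ) + 1)) := by
        rw [hεdef, ← Real.rpow_intCast]; push_cast; rfl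
      rw [h3, ← Real.rpow_mul (by norm_num), ← ENNReal.ofReal_rpow_of_pos (by norm_num)]
      congr 1
      · simp
      · ring
    rw [hpow, hpow]
    calc _ ≤ ENNReal.ofReal (ε ^ (-s)) * (ENNReal.ofReal (C * W) *
          distLpNorm p' (multiplier (fun ξ ↦ psi Φ (ε • ξ)) g)) := by gcongr
      _ = ENNReal.ofReal (C * (ε ^ (s' - s) * W)) * (ENNReal.ofReal (ε ^ (-s')) *
          distLpNorm p' (multiplier (fun ξ ↦ psi Φ (ε • ξ)) g)) := by
        rw [← mul_assoc (ENNReal.ofReal _), ← mul_assoc (ENNReal.ofReal (C * (ε ^ (s' - s) * W))),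
          ← ENNReal.ofReal_mul (by positivity), ← ENNReal.ofReal_mul' (by positivity)]
        congr 2
        rw [show ε ^ (-s) = ε ^ (s' - s) * ε ^ (-s') by rw [← Real.rpow_add hε]; congr 1; ring]
        ring
      _ ≤ _ := by
        rw [← ENNReal.ofReal_mul hC.le]
        gcongr
        exact hR ε hε hε1

end Main

end KleinGordon

theorem proposition2 (n : ℕ) (hn : 1 ≤ n)
    (Φ : EuclideanSpace ℝ (Fin n) → ℝ) (hΦ : KleinGordon.IsCutoff Φ)
    (p p' q : ℝ≥0∞) [Fact (1 ≤ p)] [Fact (1 ≤ p')]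
    (hp : 2 ≤ p) (hq : 1 ≤ q) (hpp' : p⁻¹ + p'⁻¹ = 1)
    (δ : ℝ) (hδ : δ = 1 / 2 - (p⁻¹).toReal) (s s' θ : ℝ) :
    -- (i)
    (0 ≤ θ → θ ≤ 1 → (n + 1 + θ) * δ = 1 + s' - s →
      ∃ C : ℝ≥0, ∀ (t : ℝ) (g : 𝓢'(EuclideanSpace ℝ (Fin n), ℂ)),
        KleinGordon.besovNorm Φ s p q (KleinGordon.K t g) ≤
          C * ENNReal.ofReal |t| ^ (-((n - 1 + θ) * δ)) * KleinGordon.besovNorm Φ s' p' q g) ∧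
    -- (ii)
    (0 ≤ θ → θ ≤ n - 1 → (n + 1 + θ) * δ = 1 + s' - s →
      ∃ C : ℝ≥0, ∀ (t : ℝ) (g : 𝓢'(EuclideanSpace ℝ (Fin n), ℂ)),
        KleinGordon.besovNorm Φ s p q (KleinGordon.K t g) ≤
          C * ENNReal.ofReal |t| ^ (-((n - 1 - θ) * δ)) * KleinGordon.besovNorm Φ s' p' q g) ∧
    -- (iii)
    (0 ≤ θ → θ ≤ 1 → (n + 1 + θ) * δ ≤ 1 + s' - s →
      ∃ C : ℝ≥0, ∀ (t : ℝ) (g : 𝓢'(EuclideanSpace ℝ (Fin n), ℂ)),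
        KleinGordon.besovNorm Φ s p q (KleinGordon.K t g) ≤
          C * KleinGordon.kernel n δ θ s s' t * KleinGordon.besovNorm Φ s' p' q g) := by
  have hδ0 : 0 ≤ δ := by
    have h1 : (p⁻¹).toReal ≤ ((2 : ℝ≥0∞)⁻¹).toReal :=
      ENNReal.toReal_mono (by simp) (ENNReal.inv_le_inv.2 hp)
    rw [ENNReal.toReal_inv 2, ENNReal.toReal_ofNat] at h1
    rw [hδ]
    linarith
  obtain ⟨C, hC⟩ := KleinGordon.exists_besovNorm_K_le (p' := p') hn hΦ hp hq hpp' hδ s s'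
  -- Reduces each claim to an inequality between real powers at t ≠ 0. The exponent may depend on t,
  -- as the piecewise kernel requires; at t = 0 the left-hand side is 0, whatever value `k` takes.
  have key : ∀ (k : ℝ → ℝ≥0∞) (e : ℝ → ℝ),
      (∀ t, t ≠ 0 → k t = ENNReal.ofReal |t| ^ e t) →
      (∀ t ε, t ≠ 0 → 0 < ε → ε ≤ 1 → ε ^ (s' - s) *
        (KleinGordon.dispersiveRate n ε |t| ^ (2 * δ) * ε ^ (1 - 2 * δ)) ≤ |t| ^ e t) →
      ∃ C : ℝ≥0, ∀ (t : ℝ) (g : 𝓢'(EuclideanSpace ℝ (Fin n), ℂ)),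
        KleinGordon.besovNorm Φ s p q (KleinGordon.K t g) ≤
          C * k t * KleinGordon.besovNorm Φ s' p' q g := by
    intro k e hk he
    refine ⟨C, fun t g ↦ ?_⟩
    by_cases ht : t = 0
    · rw [ht, KleinGordon.K_zero_apply, KleinGordon.besovNorm_zero s hq]
      exact zero_le
    · rw [hk t ht, ENNReal.ofReal_rpow_of_pos (abs_pos.2 ht)]
      exact hC t _ ht (fun ε hε hε1 ↦ he t ε ht hε hε1) g
  refine ⟨fun h0 h1 h ↦ ?_, fun h0 h1 h ↦ ?_, fun h0 h1 h ↦ ?_⟩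
  · exact key _ (fun _ ↦ -((n - 1 + θ) * δ)) (fun _ _ ↦ rfl) fun t ε ht hε hε1 ↦
      KleinGordon.rpow_mul_dispersiveRate_le hn hδ0 h0 h1 h.le hε hε1 (abs_pos.2 ht)
  · exact key _ (fun _ ↦ -((n - 1 - θ) * δ)) (fun _ _ ↦ rfl) fun t ε ht hε _ ↦
      KleinGordon.rpow_mul_dispersiveRate_le' hδ0 h0 h1 h hε (abs_pos.2 ht)
  · refine key _ (fun t ↦ if |t| ≤ 1 then min (1 + s' - s - 2 * n * δ) 0
      else -((n - 1 + θ) * δ)) (fun t _ ↦ ?_) fun t ε ht hε hε1 ↦ ?_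
    · simp only [KleinGordon.kernel]
      split_ifs <;> rfl
    · split_ifs with h2
      · exact KleinGordon.rpow_mul_dispersiveRate_le_of_le_one hδ0 h0 h hε hε1 (abs_pos.2 ht) h2
      · exact KleinGordon.rpow_mul_dispersiveRate_le hn hδ0 h0 h1 h hε hε1 (abs_pos.2 ht)
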